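/- Let $\Omega\subset\mathbb R^d$, $d\ge 2$, be a bounded Lipschitz domain, $T>0$, $\nu\ge 0$, $p>d$. Let $L^2_\sigma$, $H^1_{0,\sigma}$ be the closures of $C^\infty_{c,\sigma}(\Omega;\mathbb R^d)$ (smooth, compactly supported, divergence-free fields) in $L^2(\Omega)$, $H^1(\Omega)$. Put $\mathbb X=L^\infty(0,T;L^2_\sigma)\cap L^2(0,T;H^1_{0,\sigma})$ and $\mathbb Y=\mathbb X\cap L^2(0,T;H^2)\cap L^1(0,T;W^{1,\infty})\cap H^1(0,T;(L^2_\sigma)^*)$ if $\nu>0$, and $\mathbb X=L^\infty(0,T;L^2_\sigma)$, $\mathbb Y=\mathbb X\cap L^1(0,T;W^{1,\infty})\cap H^1(0,T;(L^2_\sigma)^*)$ if $\nu=0$. Let $f=f_1+f_2$ with $f_1\in L^2(0,T;H^{-1}(\Omega))$, $f_2\in L^1(0,T;L^2(\Omega))$, and $f_1=0$ if $\nu=0$. Set $\mathcal R(v|\tilde v)=\frac12\|v-\tilde v\|_{L^2}^2$ and $\langle\mathcal A_\nu(\tilde v),\cdot\rangle=\langle\partial_t\tilde v+(\tilde v\cdot\nabla)\tilde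 v-\nu\Delta\tilde v-f,\cdot\rangle$, the Laplacian being understood weakly. For $\mathcal K:L^2_\sigma\to[0,\infty]$ with $\mathcal K(0)=0$ let $\mathcal D(\mathcal K)=\{\tilde v\in\mathbb X:\mathcal K(\tilde v)\in L^1(0,T)\}$ and $$\mathcal W_\nu(v|\tilde v)=\nu\|\nabla v-\nabla\tilde v\|_{L^2}^2-\int_\Omega((v-\tilde v)\cdot\nabla)(v-\tilde v)\cdot\tilde v\,dx+\mathcal K(\tilde v)\mathcal R(v|\tilde v)\quad(\nu>0),$$ $$\mathcal W_0(v|\tilde v)=\int_\Omega(v-\tilde v)^T(\nabla\tilde v)_{\rm sym}(v-\tilde v)\,dx+\mathcal K(\tilde v)\mathcal R(v|\tilde v)\quad(\nu=0).$$ $\mathcal K$ is admissible if $\mathcal W_\nu(v|\tilde v)\ge0$ a.e. in $(0,T)$ for all $v\in\mathbb X$, $\tilde v\in\mathbb Y\cap\mathcal D(\mathcal K)$, and if $\mathcal D(\mathcal K)$ carries a topology for which $\mathcal K:\mathcal D(\mathcal K)\to L^1(0,T)$ is continuous and $C^1([0,T];C^\infty_{c,\sigma}(\Omega;\mathbb R^d))$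 is a dense subset of $\mathcal D(\mathcal K)$. A pair $(v,\xi)\in\mathbb X\times L^\infty(0,T)$ with $\xi\ge0$ and prescribed initial values $v(0)=v_0\in L^2_\sigma$, $\xi(0)$ is an energy-variational solution if $v(t)\rightharpoonup v_0$ in $L^2_\sigma$ as $t\searrow0$ (outside a null set) and if, for every admissible $\mathcal K$ and all $\tilde v\in\mathbb Y\cap\mathcal D(\mathcal K)$, $$\mathcal R(v(t)|\tilde v(t))+\xi(t)+\int_s^t\Big(\mathcal W_\nu(v|\tilde v)+\langle\mathcal A_\nu(\tilde v),v-\tilde v\rangle-\mathcal K(\tilde v)(\mathcal R(v|\tilde v)+\xi)\Big)d\tau\le\mathcal R(v(s)|\tilde v(s))+\xi(s)\qquad(*)$$ for $s=0$ and a.e. $t$, and for a.e. $s<t$ in $(0,T)$; here $\tilde v$ is its representative in $C([0,T];L^2_\sigma)$. Then every energy-variational solution $(v,\xi)$ has, after modification on a null set of times in $(0,T]$, the following properties: $\xi\ge0$ on $[0,T]$; the energy $E(t)=\frac12\|v(t)\|_{L^2}^2+\xi(t)$ is of bounded variation on $[0,T]$; $v\in C_w([0,T];L^2_\sigma)$;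 $v\in W^{1,1}(0,T;(H^1_{0,\sigma}\cap W^{2,p})^*)$, and $v\in H^1(0,T;(H^1_{0,\sigma}\cap W^{2,p})^*)$ whenever $f_2\in L^2(0,T;L^2(\Omega))$ (in particular when $f_2\in H^1(0,T;L^2(\Omega))$ or $f_2\in L^\infty(0,T;L^2(\Omega))$); and $(*)$ holds for all $0\le s\le t\le T$. For fixed $\Omega,T,\nu,p$, the total variation and the supremum of $E$ and the norm of $\partial_t v$ in $L^1$ (respectively in $L^2$, if $f_2\in L^2(0,T;L^2(\Omega))$) with values in $(H^1_{0,\sigma}\cap W^{2,p})^*$ are bounded by a constant that depends only on $v_0$, $\xi(0)$ and $f$. -/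

import Mathlib

open MeasureTheory Set Filter Topology
open scoped ENNReal NNReal ContDiff RealInnerProductSpace

noncomputable section

namespace EnVar

/-! Fields on `ℝ^d`. The entry `(i, j)` of a gradient is `∂_j u_i`; `Mat d` carries the Frobenius
norm. -/

abbrev Vec (d : ℕ) := EuclideanSpace ℝ (Fin d)

abbrev Mat (d : ℕ) := EuclideanSpace ℝ (Fin d × Fin d)

abbrev Ten (d : ℕ) := EuclideanSpace ℝ ((Fin d × Fin d) × Fin d)

/-- The `j`-th standard basis vector. -/
def basisVec (d : ℕ) (j : Fin d) : Vec d := EuclideanSpace.single j 1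

/-- The classical gradient `(∂_j φ_i)_{(i,j)}`. -/
def classicalGrad {d : ℕ} (φ : Vec d → Vec d) (x : Vec d) : Mat d :=
  WithLp.toLp 2 fun ij => fderiv ℝ φ x (basisVec d ij.2) ij.1

/-- Bounded Lipschitz domain: open, connected, nonempty, bounded, and near each boundary point the
strict epigraph, in some direction `e`, of a Lipschitz function of the coordinates orthogonal
to `e`. -/
def IsBoundedLipschitzDomain {d : ℕ} (Ω : Set (Vec d)) : Prop :=
  IsOpen Ω ∧ IsConnected Ω ∧ Bornology.IsBounded Ω ∧
  ∀ x₀ ∈ frontier Ω, ∃ e : Vec d, ‖e‖ = 1 ∧ ∃ U : Set (Vec d), IsOpen U ∧ x₀ ∈ U ∧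
    ∃ (γ : Vec d → ℝ) (L : ℝ≥0), LipschitzWith L γ ∧
      ∀ x ∈ U, (x ∈ Ω ↔ γ (x - ⟪x, e⟫ • e) < ⟪x, e⟫)

/-- `C_c^∞(Ω; ℝ^d)`. -/
def IsTestField {d : ℕ} (Ω : Set (Vec d)) (φ : Vec d → Vec d) : Prop :=
  ContDiff ℝ ∞ φ ∧ HasCompactSupport φ ∧ tsupport φ ⊆ Ω

/-- `C_{c,σ}^∞(Ω; ℝ^d)`. -/
def IsSolTestField {d : ℕ} (Ω : Set (Vec d)) (φ : Vec d → Vec d) : Prop :=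
  IsTestField Ω φ ∧ ∀ x, ∑ i : Fin d, fderiv ℝ φ x (basisVec d i) i = 0

/-- `G` is the weak gradient of `u` in `Ω`. -/
def IsWeakGrad {d : ℕ} {ι : Type*} (Ω : Set (Vec d)) (u : Vec d → EuclideanSpace ℝ ι)
    (G : Vec d → EuclideanSpace ℝ (ι × Fin d)) : Prop :=
  ∀ φ : Vec d → ℝ, ContDiff ℝ ∞ φ → HasCompactSupport φ → tsupport φ ⊆ Ω →
    ∀ (i : ι) (j : Fin d),
      ∫ x in Ω, fderiv ℝ φ x (basisVec d j) * u x i = -∫ x in Ω, φ x * G x (i, j)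

/-- `L^p(Ω; F)`. -/
abbrev LpΩ {d : ℕ} (Ω : Set (Vec d)) (F : Type) [NormedAddCommGroup F] (p : ℝ≥0∞) :=
  Lp F p ((volume : Measure (Vec d)).restrict Ω)

/-- `L²_σ(Ω)`: the closure of `C_{c,σ}^∞` in `L²` (the classes of the test fields already form a
linear subspace). -/
def L2sigma {d : ℕ} (Ω : Set (Vec d)) : Submodule ℝ (LpΩ Ω (Vec d) 2) :=
  (Submodule.span ℝ {u : LpΩ Ω (Vec d) 2 | ∃ φ, IsSolTestField Ω φ ∧
    u =ᵐ[volume.restrict Ω] φ}).topologicalClosure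

/-- `H^1_0(Ω; ℝ^d)`: the closure of `C_c^∞` in the `H^1` topology, as pairs `(u, ∇u)`. -/
def H10 {d : ℕ} (Ω : Set (Vec d)) : Submodule ℝ (LpΩ Ω (Vec d) 2 × LpΩ Ω (Mat d) 2) :=
  (Submodule.span ℝ {u : LpΩ Ω (Vec d) 2 × LpΩ Ω (Mat d) 2 | ∃ φ, IsTestField Ω φ ∧
    u.1 =ᵐ[volume.restrict Ω] φ ∧
    u.2 =ᵐ[volume.restrict Ω] classicalGrad φ}).topologicalClosure

/-- `H^1_{0,σ}(Ω)`: the closure of `C_{c,σ}^∞` in the `H^1` topology, as pairs `(u, ∇u)`. -/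
def H10sigma {d : ℕ} (Ω : Set (Vec d)) : Submodule ℝ (LpΩ Ω (Vec d) 2 × LpΩ Ω (Mat d) 2) :=
  (Submodule.span ℝ {u : LpΩ Ω (Vec d) 2 × LpΩ Ω (Mat d) 2 | ∃ φ, IsSolTestField Ω φ ∧
    u.1 =ᵐ[volume.restrict Ω] φ ∧
    u.2 =ᵐ[volume.restrict Ω] classicalGrad φ}).topologicalClosure

theorem integrable_mul_coord {d : ℕ} {ι : Type} [Fintype ι] {Ω : Set (Vec d)} {p : ℝ≥0∞}
    (hp : 1 ≤ p) (u : LpΩ Ω (EuclideanSpace ℝ ι) p) {g : Vec d → ℝ} (hg : Continuous g)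
    (hgc : HasCompactSupport g) (i : ι) :
    Integrable (fun x => g x * u x i) (volume.restrict Ω) := by
  have h1 : LocallyIntegrable (fun x => u x) (volume.restrict Ω) :=
    (Lp.memLp u).locallyIntegrable hp
  have h2 : Integrable (fun x => g x • u x) (volume.restrict Ω) :=
    h1.integrable_smul_left_of_hasCompactSupport hg hgc
  have h3 := (EuclideanSpace.proj i : EuclideanSpace ℝ ι →L[ℝ] ℝ).integrable_comp h2
  simpa using h3

theorem isWeakGrad_zero {d : ℕ} {ι : Type} [Fintype ι] {Ω : Set (Vec d)} {p : ℝ≥0∞} :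
    IsWeakGrad Ω (0 : LpΩ Ω (EuclideanSpace ℝ ι) p)
      (0 : LpΩ Ω (EuclideanSpace ℝ (ι × Fin d)) p) := by
  intro φ _ _ _ i j
  have h1 : ∀ᵐ x ∂((volume : Measure (Vec d)).restrict Ω),
      fderiv ℝ φ x (basisVec d j) * (0 : LpΩ Ω (EuclideanSpace ℝ ι) p) x i = 0 := by
    filter_upwards [Lp.coeFn_zero (EuclideanSpace ℝ ι) p
      ((volume : Measure (Vec d)).restrict Ω)] with x hx
    rw [hx]; simp
  have h2 : ∀ᵐ x ∂((volume : Measure (Vec d)).restrict Ω),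
      φ x * (0 : LpΩ Ω (EuclideanSpace ℝ (ι × Fin d)) p) x (i, j) = 0 := by
    filter_upwards [Lp.coeFn_zero (EuclideanSpace ℝ (ι × Fin d)) p
      ((volume : Measure (Vec d)).restrict Ω)] with x hx
    rw [hx]; simp
  rw [integral_congr_ae h1, integral_congr_ae h2]
  simp

theorem continuous_partial {d : ℕ} {φ : Vec d → ℝ} (hφ : ContDiff ℝ ∞ φ) (j : Fin d) :
    Continuous fun x => fderiv ℝ φ x (basisVec d j) :=
  (hφ.continuous_fderiv (by simp)).clm_apply continuous_const

theorem hasCompactSupport_partial {d : ℕ} {φ : Vec d → ℝ} (hφ : HasCompactSupport φ) (j : Fin d) :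
    HasCompactSupport fun x => fderiv ℝ φ x (basisVec d j) :=
  hφ.fderiv_apply ℝ (basisVec d j)

theorem isWeakGrad_add {d : ℕ} {ι : Type} [Fintype ι] {Ω : Set (Vec d)} {p : ℝ≥0∞} (hp : 1 ≤ p)
    {u v : LpΩ Ω (EuclideanSpace ℝ ι) p} {G H : LpΩ Ω (EuclideanSpace ℝ (ι × Fin d)) p}
    (hu : IsWeakGrad Ω u G) (hv : IsWeakGrad Ω v H) :
    IsWeakGrad Ω (u + v : LpΩ Ω (EuclideanSpace ℝ ι) p)
      (G + H : LpΩ Ω (EuclideanSpace ℝ (ι × Fin d)) p) := by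
  intro φ h1 h2 h3 i j
  have e1 : ∀ᵐ x ∂((volume : Measure (Vec d)).restrict Ω),
      fderiv ℝ φ x (basisVec d j) * (u + v : LpΩ Ω (EuclideanSpace ℝ ι) p) x i =
      fderiv ℝ φ x (basisVec d j) * u x i + fderiv ℝ φ x (basisVec d j) * v x i := by
    filter_upwards [Lp.coeFn_add u v] with x hx
    rw [hx, Pi.add_apply, PiLp.add_apply, mul_add]
  have e2 : ∀ᵐ x ∂((volume : Measure (Vec d)).restrict Ω),
      φ x * (G + H : LpΩ Ω (EuclideanSpace ℝ (ι × Fin d)) p) x (i, j) =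
      φ x * G x (i, j) + φ x * H x (i, j) := by
    filter_upwards [Lp.coeFn_add G H] with x hx
    rw [hx, Pi.add_apply, PiLp.add_apply, mul_add]
  rw [integral_congr_ae e1, integral_congr_ae e2,
    integral_add (integrable_mul_coord hp u (continuous_partial h1 j)
      (hasCompactSupport_partial h2 j) i)
      (integrable_mul_coord hp v (continuous_partial h1 j) (hasCompactSupport_partial h2 j) i),
    integral_add (integrable_mul_coord hp G h1.continuous h2 (i, j))
      (integrable_mul_coord hp H h1.continuous h2 (i, j)),
    hu φ h1 h2 h3 i j, hv φ h1 h2 h3 i j]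
  ring

theorem isWeakGrad_smul {d : ℕ} {ι : Type} [Fintype ι] {Ω : Set (Vec d)} {p : ℝ≥0∞} (c : ℝ)
    {u : LpΩ Ω (EuclideanSpace ℝ ι) p} {G : LpΩ Ω (EuclideanSpace ℝ (ι × Fin d)) p}
    (hu : IsWeakGrad Ω u G) :
    IsWeakGrad Ω (c • u : LpΩ Ω (EuclideanSpace ℝ ι) p)
      (c • G : LpΩ Ω (EuclideanSpace ℝ (ι × Fin d)) p) := by
  intro φ h1 h2 h3 i j
  have e1 : ∀ᵐ x ∂((volume : Measure (Vec d)).restrict Ω),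
      fderiv ℝ φ x (basisVec d j) * (c • u : LpΩ Ω (EuclideanSpace ℝ ι) p) x i =
      c * (fderiv ℝ φ x (basisVec d j) * u x i) := by
    filter_upwards [Lp.coeFn_smul c u] with x hx
    rw [hx, Pi.smul_apply, PiLp.smul_apply, smul_eq_mul]; ring
  have e2 : ∀ᵐ x ∂((volume : Measure (Vec d)).restrict Ω),
      φ x * (c • G : LpΩ Ω (EuclideanSpace ℝ (ι × Fin d)) p) x (i, j) =
      c * (φ x * G x (i, j)) := by
    filter_upwards [Lp.coeFn_smul c G] with x hx
    rw [hx, Pi.smul_apply, PiLp.smul_apply, smul_eq_mul]; ring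
  rw [integral_congr_ae e1, integral_congr_ae e2, integral_const_mul, integral_const_mul,
    hu φ h1 h2 h3 i j]
  ring

/-- `W^{1,p}(Ω; ℝ^d)`, as pairs `(u, ∇u)`, with the maximum of the `L^p` norms. -/
def W1 {d : ℕ} (Ω : Set (Vec d)) (p : ℝ≥0∞) [hp : Fact (1 ≤ p)] :
    Submodule ℝ (LpΩ Ω (Vec d) p × LpΩ Ω (Mat d) p) where
  carrier := {u | IsWeakGrad Ω u.1 u.2}
  zero_mem' := isWeakGrad_zero
  add_mem' hu hv := isWeakGrad_add hp.out hu hv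
  smul_mem' c _ hu := isWeakGrad_smul c hu

/-- `W^{2,p}(Ω; ℝ^d)`, as triples `(u, ∇u, ∇²u)`, with the maximum of the `L^p` norms. -/
def W2 {d : ℕ} (Ω : Set (Vec d)) (p : ℝ≥0∞) [hp : Fact (1 ≤ p)] :
    Submodule ℝ (LpΩ Ω (Vec d) p × LpΩ Ω (Mat d) p × LpΩ Ω (Ten d) p) where
  carrier := {u | IsWeakGrad Ω u.1 u.2.1 ∧ IsWeakGrad Ω u.2.1 u.2.2}
  zero_mem' := ⟨isWeakGrad_zero, isWeakGrad_zero⟩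
  add_mem' hu hv := ⟨isWeakGrad_add hp.out hu.1 hv.1, isWeakGrad_add hp.out hu.2 hv.2⟩
  smul_mem' c _ hu := ⟨isWeakGrad_smul c hu.1, isWeakGrad_smul c hu.2⟩

/-- The intersection `H^1_{0,σ}(Ω) ∩ W^{2,p}(Ω)`, with the maximum of the two norms. -/
def VSpace {d : ℕ} (Ω : Set (Vec d)) (p : ℝ≥0∞) [Fact (1 ≤ p)] :
    Submodule ℝ ((LpΩ Ω (Vec d) 2 × LpΩ Ω (Mat d) 2) ×
      (LpΩ Ω (Vec d) p × LpΩ Ω (Mat d) p × LpΩ Ω (Ten d) p)) where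
  carrier := {x | x.1 ∈ H10sigma Ω ∧ x.2 ∈ W2 Ω p ∧ x.1.1 =ᵐ[volume.restrict Ω] x.2.1}
  zero_mem' := ⟨zero_mem _, zero_mem _,
    (Lp.coeFn_zero (Vec d) 2 _).trans (Lp.coeFn_zero (Vec d) p _).symm⟩
  add_mem' hx hy := ⟨add_mem hx.1 hy.1, add_mem hx.2.1 hy.2.1,
    (Lp.coeFn_add _ _).trans ((hx.2.2.add hy.2.2).trans (Lp.coeFn_add _ _).symm)⟩
  smul_mem' c _ hx := ⟨Submodule.smul_mem _ c hx.1, Submodule.smul_mem _ c hx.2.1,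
    (Lp.coeFn_smul c _).trans ((hx.2.2.const_smul c).trans (Lp.coeFn_smul c _).symm)⟩

/-- The inclusion of `H^1_{0,σ} ∩ W^{2,p}` into `L²`. -/
def VSpace.toL2 {d : ℕ} (Ω : Set (Vec d)) (p : ℝ≥0∞) [Fact (1 ≤ p)] :
    VSpace Ω p →L[ℝ] LpΩ Ω (Vec d) 2 :=
  (ContinuousLinearMap.fst ℝ _ _).comp
    ((ContinuousLinearMap.fst ℝ _ _).comp (VSpace Ω p).subtypeL)

/-- The embedding `L²_σ → (H^1_{0,σ} ∩ W^{2,p})^*`, `u ↦ (u, ·)_{L²}`. -/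
def toVDual {d : ℕ} (Ω : Set (Vec d)) (p : ℝ≥0∞) [Fact (1 ≤ p)] (u : L2sigma Ω) :
    StrongDual ℝ (VSpace Ω p) :=
  (innerSL ℝ (u : LpΩ Ω (Vec d) 2)).comp (VSpace.toL2 Ω p)

open Classical in
/-- The (unique) weak gradient in `L²` of `u ∈ L²`, and `0` if there is none. -/
def wgrad {d : ℕ} {Ω : Set (Vec d)} (u : LpΩ Ω (Vec d) 2) : LpΩ Ω (Mat d) 2 :=
  if h : ∃ G : LpΩ Ω (Mat d) 2, IsWeakGrad Ω u G then h.choose else 0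

open Classical in
/-- `u ∈ L²` as an element of `H^1_0` (unique, since the gradient is), and `0` if it is none. -/
def liftH10 {d : ℕ} {Ω : Set (Vec d)} (u : LpΩ Ω (Vec d) 2) : H10 Ω :=
  if h : ∃ w : H10 Ω, (w : LpΩ Ω (Vec d) 2 × LpΩ Ω (Mat d) 2).1 = u then h.choose else 0

/-! Time-dependent functions: `L^q(0,T; B)` is `MemLp u q (timeMeasure T)`. -/

/-- Lebesgue measure on `(0,T)`. -/
def timeMeasure (T : ℝ) : Measure ℝ := volume.restrict (Ioo 0 T)

/-- `g` is the weak time derivative of `u` on `(0,T)`. -/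
def HasWeakTimeDeriv {B : Type*} [NormedAddCommGroup B] [NormedSpace ℝ B] (T : ℝ)
    (u g : ℝ → B) : Prop :=
  ∀ φ : ℝ → ℝ, ContDiff ℝ ∞ φ → HasCompactSupport φ → tsupport φ ⊆ Ioo 0 T →
    ∫ t, deriv φ t • u t ∂timeMeasure T = -∫ t, φ t • g t ∂timeMeasure T

/-- The energy space: `L^∞(0,T; L²_σ) ∩ L²(0,T; H^1_{0,σ})` for `ν > 0` and `L^∞(0,T; L²_σ)` for
`ν = 0`. -/
def InX {d : ℕ} (Ω : Set (Vec d)) (T ν : ℝ) (v : ℝ → L2sigma Ω) : Prop :=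
  MemLp v ∞ (timeMeasure T) ∧
  (0 < ν → ∃ w : ℝ → H10sigma Ω, MemLp w 2 (timeMeasure T) ∧
    ∀ᵐ t ∂timeMeasure T,
      (w t : LpΩ Ω (Vec d) 2 × LpΩ Ω (Mat d) 2).1 = (v t : LpΩ Ω (Vec d) 2))

/-- `v` belongs to the space of test functions and `g` is its time derivative: `v` is in the energy
space, in `L²(0,T; H²)` (if `ν > 0`), in `L^1(0,T; W^{1,∞})` and in `H^1(0,T; (L²_σ)^*)`; `v` is
its representative in `C([0,T]; L²_σ)`. -/
structure IsTestPath {d : ℕ} (Ω : Set (Vec d)) (T ν : ℝ) (v : ℝ → L2sigma Ω)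
    (g : ℝ → StrongDual ℝ (L2sigma Ω)) : Prop where
  continuousOn : ContinuousOn v (Icc 0 T)
  inX : InX Ω T ν v
  inH2 : 0 < ν → ∃ h : ℝ → W2 Ω 2, MemLp h 2 (timeMeasure T) ∧
    ∀ᵐ t ∂timeMeasure T, (h t : LpΩ Ω (Vec d) 2 × LpΩ Ω (Mat d) 2 × LpΩ Ω (Ten d) 2).1 =
      (v t : LpΩ Ω (Vec d) 2)
  inW1inf : ∃ h : ℝ → W1 Ω ∞, MemLp h 1 (timeMeasure T) ∧
    ∀ᵐ t ∂timeMeasure T, (h t : LpΩ Ω (Vec d) ∞ × LpΩ Ω (Mat d) ∞).1 =ᵐ[volume.restrict Ω]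
      (v t : LpΩ Ω (Vec d) 2)
  deriv_memLp : MemLp g 2 (timeMeasure T)
  deriv_weak : HasWeakTimeDeriv T (fun t => (innerSL ℝ (v t) : StrongDual ℝ (L2sigma Ω))) g

/-- `v` is in `C^1([0,T]; C_{c,σ}^∞(Ω; ℝ^d))`: the supports of `Φ t` lie in one compact subset of
`Ω`, and `Φ` and its time derivative `Ψ` are continuous together with all derivatives in `x`. -/
def IsSmoothPath {d : ℕ} (Ω : Set (Vec d)) (T : ℝ) (v : ℝ → L2sigma Ω) : Prop :=
  ∃ (Φ Ψ : ℝ → Vec d → Vec d) (S : Set (Vec d)), IsCompact S ∧ S ⊆ Ω ∧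
    (∀ t ∈ Icc 0 T, IsSolTestField Ω (Φ t) ∧ tsupport (Φ t) ⊆ S ∧
      IsSolTestField Ω (Ψ t) ∧ tsupport (Ψ t) ⊆ S) ∧
    (∀ n : ℕ, ContinuousOn (fun q : ℝ × Vec d => iteratedFDeriv ℝ n (Φ q.1) q.2)
      (Icc 0 T ×ˢ univ)) ∧
    (∀ n : ℕ, ContinuousOn (fun q : ℝ × Vec d => iteratedFDeriv ℝ n (Ψ q.1) q.2)
      (Icc 0 T ×ˢ univ)) ∧
    (∀ t ∈ Icc 0 T, ∀ x, HasDerivWithinAt (fun s => Φ s x) (Ψ t x) (Icc 0 T) t) ∧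
    ∀ t ∈ Icc 0 T, (v t : LpΩ Ω (Vec d) 2) =ᵐ[volume.restrict Ω] Φ t

/-- The relative energy `R(u | ũ) = ½ ‖u - ũ‖²`. -/
def relEnergy {d : ℕ} {Ω : Set (Vec d)} (u u' : L2sigma Ω) : ℝ := 1 / 2 * ‖u - u'‖ ^ 2

/-- The trilinear form `((a · ∇) b, c) = ∫_Ω ∑_{i,j} a_j (∂_j b_i) c_i`. -/
def convForm {d : ℕ} {Ω : Set (Vec d)} (a b c : L2sigma Ω) : ℝ :=
  ∫ x in Ω, ∑ i : Fin d, ∑ j : Fin d, (a : LpΩ Ω (Vec d) 2) x j *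
    wgrad (b : LpΩ Ω (Vec d) 2) x (i, j) * (c : LpΩ Ω (Vec d) 2) x i

/-- The form `∫_Ω wᵀ (∇ũ)_sym w`. -/
def symForm {d : ℕ} {Ω : Set (Vec d)} (w u' : L2sigma Ω) : ℝ :=
  ∫ x in Ω, ∑ i : Fin d, ∑ j : Fin d, (w : LpΩ Ω (Vec d) 2) x i *
    (1 / 2 * (wgrad (u' : LpΩ Ω (Vec d) 2) x (i, j) + wgrad (u' : LpΩ Ω (Vec d) 2) x (j, i))) *
      (w : LpΩ Ω (Vec d) 2) x j

open Classical in
/-- The relative form `W_ν(u | ũ)`, with `k` the value of the regularity measure at `ũ`. -/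
def relForm {d : ℕ} {Ω : Set (Vec d)} (ν : ℝ) (u u' : L2sigma Ω) (k : ℝ) : ℝ :=
  (if 0 < ν then
      ν * ‖wgrad (u : LpΩ Ω (Vec d) 2) - wgrad (u' : LpΩ Ω (Vec d) 2)‖ ^ 2
        - convForm (u - u') (u - u') u'
    else symForm (u - u') u') + k * relEnergy u u'

/-- The value of `⟨∂_t ũ + (ũ · ∇) ũ - ν Δ ũ - f, w⟩` at one time, where `g` is the value of
`∂_t ũ` and `f₁ + f₂` the one of `f`; the Laplacian is understood weakly. -/
def systemOp {d : ℕ} {Ω : Set (Vec d)} (ν : ℝ) (f₁ : StrongDual ℝ (H10 Ω))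
    (f₂ : LpΩ Ω (Vec d) 2) (g : StrongDual ℝ (L2sigma Ω)) (u' w : L2sigma Ω) : ℝ :=
  g w + convForm u' u' w
    + ν * ⟪wgrad (u' : LpΩ Ω (Vec d) 2), wgrad (w : LpΩ Ω (Vec d) 2)⟫
    - (f₁ (liftH10 (w : LpΩ Ω (Vec d) 2)) + ⟪f₂, (w : LpΩ Ω (Vec d) 2)⟫)

/-- The domain `D(K)`: paths in the energy space along which `K` is integrable. -/
def KDomain {d : ℕ} (Ω : Set (Vec d)) (T ν : ℝ) (K : L2sigma Ω → ℝ≥0∞) : Set (ℝ → L2sigma Ω) :=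
  {v | InX Ω T ν v ∧ AEMeasurable (fun t => K (v t)) (timeMeasure T) ∧
    ∫⁻ t, K (v t) ∂timeMeasure T ≠ ⊤}

theorem integrable_K {d : ℕ} {Ω : Set (Vec d)} {T ν : ℝ} {K : L2sigma Ω → ℝ≥0∞}
    (v : KDomain Ω T ν K) :
    Integrable (fun t => (K (v.1 t)).toReal) (timeMeasure T) :=
  integrable_toReal_of_lintegral_ne_top v.2.2.1 v.2.2.2

/-- `K` as a map `D(K) → L^1(0,T)`. -/
def KMap {d : ℕ} {Ω : Set (Vec d)} {T ν : ℝ} (K : L2sigma Ω → ℝ≥0∞) (v : KDomain Ω T ν K) :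
    Lp ℝ 1 (timeMeasure T) :=
  (integrable_K v).toL1 _

/-- Admissible regularity measures. -/
structure IsAdmissible {d : ℕ} (Ω : Set (Vec d)) (T ν : ℝ) (K : L2sigma Ω → ℝ≥0∞) : Prop where
  zero : K 0 = 0
  smooth_mem : ∀ v, IsSmoothPath Ω T v → v ∈ KDomain Ω T ν K
  topology : ∃ τ : TopologicalSpace (KDomain Ω T ν K),
    @Continuous _ _ τ _ (KMap (T := T) (ν := ν) K) ∧
    @Dense _ τ {v : KDomain Ω T ν K | IsSmoothPath Ω T v.1}
  nonneg : ∀ v v' g, InX Ω T ν v → IsTestPath Ω T ν v' g → v' ∈ KDomain Ω T ν K →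
    ∀ᵐ t ∂timeMeasure T, 0 ≤ relForm ν (v t) (v' t) (K (v' t)).toReal

/-- The relative energy inequality between the times `s` and `t`. -/
def RelEnergyIneq {d : ℕ} {Ω : Set (Vec d)} (ν : ℝ) (f₁ : ℝ → StrongDual ℝ (H10 Ω))
    (f₂ : ℝ → LpΩ Ω (Vec d) 2) (K : L2sigma Ω → ℝ≥0∞) (v : ℝ → L2sigma Ω) (ξ : ℝ → ℝ)
    (v' : ℝ → L2sigma Ω) (g : ℝ → StrongDual ℝ (L2sigma Ω)) (s t : ℝ) : Prop :=
  relEnergy (v t) (v' t) + ξ t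
    + ∫ r in s..t, (relForm ν (v r) (v' r) (K (v' r)).toReal
        + systemOp ν (f₁ r) (f₂ r) (g r) (v' r) (v r - v' r)
        - (K (v' r)).toReal * (relEnergy (v r) (v' r) + ξ r))
    ≤ relEnergy (v s) (v' s) + ξ s

/-- Right-hand sides `f = f₁ + f₂` with `f₁ ∈ L²(0,T; H^{-1})` and `f₂ ∈ L^1(0,T; L²)`, where
`f₁ = 0` if `ν = 0`. -/
def InZ {d : ℕ} (Ω : Set (Vec d)) (T ν : ℝ) (f₁ : ℝ → StrongDual ℝ (H10 Ω))
    (f₂ : ℝ → LpΩ Ω (Vec d) 2) : Prop :=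
  MemLp f₁ 2 (timeMeasure T) ∧ MemLp f₂ 1 (timeMeasure T) ∧ (ν = 0 → f₁ = 0)

/-- Energy-variational solutions. As `v` and `ξ` are elements of Lebesgue spaces in time, the
inequality is imposed for almost all times and for the initial time, where `v` and `ξ` take
prescribed values. -/
structure IsEnergyVariationalSolution {d : ℕ} (Ω : Set (Vec d)) (T ν : ℝ)
    (f₁ : ℝ → StrongDual ℝ (H10 Ω)) (f₂ : ℝ → LpΩ Ω (Vec d) 2) (v₀ : L2sigma Ω)
    (v : ℝ → L2sigma Ω) (ξ : ℝ → ℝ) : Prop where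
  inX : InX Ω T ν v
  memLp_xi : MemLp ξ ∞ (timeMeasure T)
  nonneg_xi : ∀ t ∈ Ioo 0 T, 0 ≤ ξ t
  initial : v 0 = v₀
  initial_weak : ∀ φ : L2sigma Ω,
    Tendsto (fun t => ⟪v t, φ⟫) (𝓝[>] 0 ⊓ ae (timeMeasure T)) (𝓝 ⟪v₀, φ⟫)
  ineq_zero : ∀ K, IsAdmissible Ω T ν K → ∀ v' g, IsTestPath Ω T ν v' g →
    v' ∈ KDomain Ω T ν K → ∀ᵐ t ∂timeMeasure T, RelEnergyIneq ν f₁ f₂ K v ξ v' g 0 t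
  ineq : ∀ K, IsAdmissible Ω T ν K → ∀ v' g, IsTestPath Ω T ν v' g →
    v' ∈ KDomain Ω T ν K → ∀ᵐ s ∂timeMeasure T, ∀ᵐ t ∂timeMeasure T,
      s < t → RelEnergyIneq ν f₁ f₂ K v ξ v' g s t

/-- The total energy `E = ½ ‖v‖² + ξ`. -/
def energy {d : ℕ} {Ω : Set (Vec d)} (v : ℝ → L2sigma Ω) (ξ : ℝ → ℝ) (t : ℝ) : ℝ :=
  1 / 2 * ‖v t‖ ^ 2 + ξ t

end EnVar

end

noncomputable section

namespace EnVar

/-! ### Functions that are monotone up to null sets -/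

/-! Everything except the relative energy inequality at all times comes from one regularity measure,
`K(u) = 2‖∇u‖_{L^∞}` (`gradMeasure`), and from test paths constant in time, `ũ = n x` with `x` in `V
= H^1_{0,σ} ∩ W^{2,p}` and `n` an integer. This `K` is admissible (`isAdmissible_gradMeasure`): the
relative form is nonnegative because `|∫ w · G w| ≤ ‖G‖ ‖w‖²`, and if the domain of `K` carries the
topology induced by `K`, density of smooth paths only asks that nonnegative functions in `L¹(0,T)`
be approximated by `|P(t)|` with polynomials `P`.

For `ũ = n x` the term quadratic in `n` disappears, since `(v·∇)x · x` has integral zero. With `E`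
the energy, `D` the dissipation minus the power of the force (`dissip`) and `F` the tested momentum
balance (`momentum`), what is left is `E(t) - n (v(t), x) + ∫ (D + n F - 2|n| ‖∇x‖_∞ ξ) ≤ E(s) - n
(v(s), x)`. The choice `n = 0` is the energy inequality. Boundedness in `n` forces `|(v(t) - v(s),
x) - ∫ F| ≤ 2 ‖∇x‖_∞ ∫ ξ` (`increment_of_forall_int`). So the increments of `v`, tested with `x`,
are at most `size(x) ∫ γ`, where `size` is the `H^1` norm plus `‖∇x‖_∞` and `γ` (`velDensity`) is
integrable, and square integrable if `f₂` is. Integers are enough for this argument, and their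
countability lets the exceptional null sets be united.

The energy inequality bounds `E`, `∫ |D|` and `∫ γ` by the data (`bounds_of_energy_ineq`). A
function that decreases for almost all pairs of times decreases on a set of full measure
(`exists_antitoneOn_of_ae`). Applied to `E + ∫ D` this makes `E` of bounded variation with left
limits along that set; applied to `±(v, x)` minus a multiple of `∫ γ`, together with the density of
`V`, it yields the weakly continuous representative `w` (`exists_weaklyContinuous_representative`).
The new defect is the left limit of `E` minus `½‖w‖²`, nonnegative by weak lower semicontinuity
(`exists_energy_representative`). The relative energy is `E` plus a continuous function of time, so
for every admissible `K` the inequality passes to left limits (`ineq_of_ae_ineq`).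

The time derivative needs an argument of its own: `p = ∞` is allowed, so reflexivity of `V` is not
at hand. Compactness takes its place. A Morrey estimate on domains with the cone property gives the
Ehrling inequality `size x ≤ ε‖x‖ + ∑ |Λ_k x|` (`VSpace.size_le`), so the unit ball of `V` has
finite nets for `size`. Difference quotients of `w` are dominated by `size`, hence they converge in
the norm of the dual as soon as they converge on a countable union of nets, which holds at almost
every time because the scalar paths are absolutely continuous (`exists_hasWeakTimeDeriv`). -/

theorem ae_timeMeasure_iff {T : ℝ} {P : ℝ → Prop} :
    (∀ᵐ t ∂timeMeasure T, P t) ↔ ∀ᵐ t, t ∈ Ioo 0 T → P t :=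
  ae_restrict_iff' measurableSet_Ioo

instance {T : ℝ} : IsFiniteMeasure (timeMeasure T) :=
  ⟨by simp [timeMeasure]⟩

/-- Averages of `f` over `(s, s + δ)` and `(t, t + δ)` are ordered for small `δ`, and they converge
to the values of `f` wherever the primitive has derivative `f`. Such points form one set of full
measure that serves all pairs. -/
theorem exists_antitoneOn_of_ae {T : ℝ} {f : ℝ → ℝ} (hf : Integrable f (timeMeasure T))
    (h : ∀ᵐ s ∂timeMeasure T, ∀ᵐ t ∂timeMeasure T, s < t → f t ≤ f s) :
    ∃ L ⊆ Ioo 0 T, (∀ᵐ t ∂timeMeasure T, t ∈ L) ∧ AntitoneOn f L := by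
  set g : ℝ → ℝ := (Ioo 0 T).indicator f with hg
  have hgi : Integrable g volume := (integrable_indicator_iff measurableSet_Ioo).2 hf
  have hder := _root_.LocallyIntegrable.ae_hasDerivAt_integral hgi.locallyIntegrable
  refine ⟨{t | t ∈ Ioo 0 T ∧ ∀ c, HasDerivAt (fun x => ∫ r in c..x, g r) (g t) t},
    fun t ht => ht.1, ?_, ?_⟩
  · rw [ae_timeMeasure_iff]
    filter_upwards [hder] with t ht h0
    exact ⟨h0, ht⟩
  rintro s ⟨hs, hs'⟩ t ⟨ht, ht'⟩ hst
  rcases hst.eq_or_lt with rfl | hst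
  · exact le_rfl
  have hgs : g s = f s := indicator_of_mem hs f
  have hgt : g t = f t := indicator_of_mem ht f
  rw [← hgs, ← hgt]
  have key : ∀ᶠ δ in 𝓝[>] (0 : ℝ), ∫ r in t..(t + δ), g r ≤ ∫ r in s..(s + δ), g r := by
    have : Ioo (0 : ℝ) (min (t - s) (T - t)) ∈ 𝓝[>] (0 : ℝ) :=
      Ioo_mem_nhdsGT (lt_min (by linarith) (by linarith [ht.2]))
    filter_upwards [this] with δ hδ
    have hδ1 : δ < t - s := hδ.2.trans_le (min_le_left _ _)
    have hδ2 : δ < T - t := hδ.2.trans_le (min_le_right _ _)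
    have hδ0 := hδ.1
    -- The null set of later times depends on `σ`, so the later variable is integrated first, with
    -- `σ` frozen.
    have step : ∀ᵐ σ ∂volume.restrict (Ioc s (s + δ)),
        ∫ r in t..(t + δ), g r ≤ δ * g σ := by
      rw [ae_restrict_iff' measurableSet_Ioc]
      filter_upwards [ae_timeMeasure_iff.1 h] with σ hσ hσ1
      have hσ2 : σ ∈ Ioo 0 T := ⟨by linarith [hs.1, hσ1.1], by linarith [hσ1.2]⟩
      have h1 : ∫ r in t..(t + δ), g r ≤ ∫ _ in t..(t + δ), g σ := by
        refine intervalIntegral.integral_mono_ae_restrict (by linarith)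
          hgi.intervalIntegrable intervalIntegrable_const ?_
        rw [EventuallyLE, ae_restrict_iff' measurableSet_Icc]
        filter_upwards [ae_timeMeasure_iff.1 (hσ hσ2)] with τ hτ hτ1
        have hτ2 : τ ∈ Ioo 0 T := ⟨by linarith [ht.1, hτ1.1], by linarith [hτ1.2]⟩
        rw [hg, indicator_of_mem hσ2, indicator_of_mem hτ2]
        exact hτ hτ2 (by linarith [hσ1.2, hτ1.1])
      simpa using h1
    have h2 : ∫ _ in s..(s + δ), (∫ r in t..(t + δ), g r) ≤ ∫ σ in s..(s + δ), δ * g σ := by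
      have hss : s ≤ s + δ := by linarith
      simp only [intervalIntegral.integral_of_le hss]
      exact integral_mono_ae (integrable_const _) ((hgi.const_mul δ).integrableOn) step
    rw [intervalIntegral.integral_const, intervalIntegral.integral_const_mul, add_sub_cancel_left,
      smul_eq_mul] at h2
    exact le_of_mul_le_mul_left h2 hδ0
  have lim : ∀ a, HasDerivAt (fun x => ∫ r in a..x, g r) (g a) a →
      Tendsto (fun δ => δ⁻¹ * ∫ r in a..(a + δ), g r) (𝓝[>] 0) (𝓝 (g a)) := by
    intro a ha
    have := ha.tendsto_slope_zero.mono_left (nhdsWithin_mono _ (fun x hx => ne_of_gt hx) :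
      𝓝[>] (0 : ℝ) ≤ 𝓝[≠] 0)
    simpa using this
  refine le_of_tendsto_of_tendsto (lim t (ht' t)) (lim s (hs' s)) ?_
  filter_upwards [key, self_mem_nhdsWithin] with δ h1 h2
  exact mul_le_mul_of_nonneg_left h1 (inv_nonneg.2 (le_of_lt h2))

/-- Nonempty open sets have positive measure, so a set of full measure meets each of them. -/
theorem mem_closure_of_ae {T : ℝ} {L : Set ℝ} (hL : ∀ᵐ t ∂timeMeasure T, t ∈ L) {a b t : ℝ}
    (ha : 0 ≤ a) (hb : b ≤ T) (hab : a < b) (ht : t ∈ Icc a b) : t ∈ closure (L ∩ Ioo a b) := by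
  have h1 : Ioo a b ⊆ closure (L ∩ Ioo a b) := by
    intro x hx
    rw [mem_closure_iff]
    intro o ho hxo
    have h2 : ∀ᵐ t ∂(volume.restrict (o ∩ Ioo a b)), t ∈ L := by
      refine ae_mono ?_ hL
      exact Measure.restrict_mono (fun y (hy : y ∈ o ∩ Ioo a b) =>
        (⟨by linarith [hy.2.1], by linarith [hy.2.2]⟩ : y ∈ Ioo 0 T)) le_rfl
    have h3 : (ae (volume.restrict (o ∩ Ioo a b))).NeBot := by
      rw [ae_neBot]
      intro h0
      rw [Measure.restrict_eq_zero] at h0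
      exact (ho.inter isOpen_Ioo).measure_ne_zero volume ⟨x, hxo, hx⟩ h0
    have h4 : ∀ᵐ t ∂(volume.restrict (o ∩ Ioo a b)), t ∈ o ∩ Ioo a b :=
      ae_restrict_mem (ho.inter isOpen_Ioo).measurableSet
    obtain ⟨y, hy1, hy2⟩ := (h2.and h4).exists
    exact ⟨y, hy2.1, hy1, hy2.2⟩
  have h5 := closure_mono h1
  rw [closure_closure, closure_Ioo hab.ne] at h5
  exact h5 ht

theorem neBot_nhdsWithin_Iio {T : ℝ} {L : Set ℝ} (hL : ∀ᵐ t ∂timeMeasure T, t ∈ L) {t : ℝ}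
    (ht : t ∈ Ioc 0 T) : (𝓝[L ∩ Iio t] t).NeBot := by
  rw [← mem_closure_iff_nhdsWithin_neBot]
  exact closure_mono (inter_subset_inter_right _ Ioo_subset_Iio_self)
    (mem_closure_of_ae hL le_rfl ht.2 ht.1 ⟨ht.1.le, le_rfl⟩)

theorem neBot_nhdsWithin_Icc {T : ℝ} {L : Set ℝ} (hT : 0 < T) (hL : ∀ᵐ t ∂timeMeasure T, t ∈ L)
    {t : ℝ} (ht : t ∈ Icc 0 T) : (𝓝[L] t).NeBot := by
  rw [← mem_closure_iff_nhdsWithin_neBot]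
  exact closure_mono inter_subset_left (mem_closure_of_ae hL le_rfl le_rfl hT ht)

/-- The midpoint of `s` and `t` separates the arguments. The filters are left free so that both
one-sided and full limits within `L` are covered. -/
theorem limit_le_limit_of_antitoneOn {f : ℝ → ℝ} {L : Set ℝ} (hf : AntitoneOn f L) {s t a b : ℝ}
    (hst : s < t) {l₁ l₂ : Filter ℝ} [l₁.NeBot] [l₂.NeBot] (h1 : l₁ ≤ 𝓝[L] s) (h2 : l₂ ≤ 𝓝[L] t)
    (ha : Tendsto f l₁ (𝓝 a)) (hb : Tendsto f l₂ (𝓝 b)) : b ≤ a := by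
  have ha' : Tendsto (fun q : ℝ × ℝ => f q.1) (l₁ ×ˢ l₂) (𝓝 a) := ha.comp tendsto_fst
  have hb' : Tendsto (fun q : ℝ × ℝ => f q.2) (l₁ ×ˢ l₂) (𝓝 b) := hb.comp tendsto_snd
  refine le_of_tendsto_of_tendsto hb' ha' ?_
  have e1 : ∀ᶠ x in l₁, x ∈ L ∧ x < (s + t) / 2 :=
    h1 (inter_mem self_mem_nhdsWithin (nhdsWithin_le_nhds (Iio_mem_nhds (by linarith))))
  have e2 : ∀ᶠ x in l₂, x ∈ L ∧ (s + t) / 2 < x :=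
    h2 (inter_mem self_mem_nhdsWithin (nhdsWithin_le_nhds (Ioi_mem_nhds (by linarith))))
  filter_upwards [e1.prod_mk e2] with q hq
  exact hf hq.1.1 hq.2.1 (by linarith [hq.1.2, hq.2.2])

theorem antitoneOn_Icc_of_ae {T : ℝ} (hT : 0 < T) {f : ℝ → ℝ} (hf : ContinuousOn f (Icc 0 T))
    (h : ∀ᵐ s ∂timeMeasure T, ∀ᵐ t ∂timeMeasure T, s < t → f t ≤ f s) :
    AntitoneOn f (Icc 0 T) := by
  have hi : Integrable f (timeMeasure T) :=
    (hf.integrableOn_compact isCompact_Icc).mono_set Ioo_subset_Icc_self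
  obtain ⟨L, hL0, hL, hfL⟩ := exists_antitoneOn_of_ae hi h
  have hL1 : L ⊆ Icc 0 T := hL0.trans Ioo_subset_Icc_self
  intro s hs t ht hst
  rcases hst.eq_or_lt with rfl | hst
  · exact le_rfl
  have := neBot_nhdsWithin_Icc hT hL hs
  have := neBot_nhdsWithin_Icc hT hL ht
  exact limit_le_limit_of_antitoneOn hfL hst le_rfl le_rfl
    ((hf s hs).mono_left (nhdsWithin_mono _ hL1)) ((hf t ht).mono_left (nhdsWithin_mono _ hL1))

/-- The left-continuous representative of a function that is antitone on a set of full measure. -/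
theorem exists_antitone_leftLim {T : ℝ} {f : ℝ → ℝ} {L : Set ℝ}
    (hL0 : L ⊆ Ioo 0 T) (hL : ∀ᵐ t ∂timeMeasure T, t ∈ L) (hf : AntitoneOn f L) {m e : ℝ}
    (hm : ∀ t ∈ L, m ≤ f t) (he : ∀ t ∈ L, f t ≤ e) (hme : m ≤ e) :
    ∃ F : ℝ → ℝ, Antitone F ∧ F 0 = e ∧ F =ᵐ[timeMeasure T] f ∧ (∀ t, m ≤ F t) ∧
      ∀ t ∈ Ioc 0 T, Tendsto f (𝓝[L ∩ Iio t] t) (𝓝 (F t)) := by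
  -- For an antitone function the infimum over earlier times is the left limit. Inserting `e`
  -- produces the prescribed value at `0`, which has no points of `L` to its left.
  set F : ℝ → ℝ := fun t => sInf (insert e (f '' (L ∩ Iio t))) with hF
  have hbdd : ∀ t, BddBelow (insert e (f '' (L ∩ Iio t))) := by
    intro t
    refine ⟨m, ?_⟩
    rintro x (rfl | ⟨y, hy, rfl⟩)
    · exact hme
    · exact hm y hy.1
  have hle : ∀ t, ∀ s ∈ L, s < t → F t ≤ f s := fun t s hs hst =>
    csInf_le (hbdd t) (mem_insert_of_mem _ ⟨s, ⟨hs, hst⟩, rfl⟩)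
  have hanti : Antitone F := by
    intro s t hst
    refine csInf_le_csInf (hbdd t) (insert_nonempty _ _) (insert_subset_insert (image_mono ?_))
    exact inter_subset_inter_right _ (Iio_subset_Iio hst)
  have hge : ∀ t ∈ L, f t ≤ F t := by
    intro t ht
    refine le_csInf (insert_nonempty _ _) ?_
    rintro x (rfl | ⟨y, hy, rfl⟩)
    · exact he t ht
    · exact hf hy.1 ht hy.2.le
  refine ⟨F, hanti, ?_, ?_, ?_, ?_⟩
  · have : L ∩ Iio 0 = ∅ := by
      ext x
      simp only [mem_inter_iff, mem_Iio, mem_empty_iff_false, iff_false, not_and, not_lt]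
      exact fun hx => (hL0 hx).1.le
    simp [hF, this]
  -- A monotone function is continuous off a countable set; there `F t` is the limit of `F s` as `s
  -- ↓ t`, and `F s ≤ f t` for these `s`.
  · have hc : ∀ᵐ t ∂timeMeasure T, ContinuousAt F t :=
      ae_restrict_of_ae (hanti.countable_not_continuousAt.ae_notMem volume |>.mono
        fun t ht => by simpa using ht)
    filter_upwards [hL, hc] with t htL htc
    refine le_antisymm ?_ (hge t htL)
    have : Tendsto F (𝓝[>] t) (𝓝 (F t)) := htc.mono_left nhdsWithin_le_nhds
    refine le_of_tendsto this ?_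
    filter_upwards [self_mem_nhdsWithin] with s hs
    exact hle s t htL hs
  · intro t
    refine le_csInf (insert_nonempty _ _) ?_
    rintro x (rfl | ⟨y, hy, rfl⟩)
    · exact hme
    · exact hm y hy.1
  · intro t ht
    have := neBot_nhdsWithin_Iio hL ht
    rw [tendsto_order]
    constructor
    · intro a ha
      filter_upwards [self_mem_nhdsWithin] with s hs
      exact ha.trans_le (hle t s hs.1 hs.2)
    · intro a ha
      obtain ⟨s₀, hs₀⟩ : (L ∩ Iio t).Nonempty := by
        have : ∀ᶠ s in 𝓝[L ∩ Iio t] t, s ∈ L ∩ Iio t := self_mem_nhdsWithin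
        exact this.exists
      obtain ⟨s, hs, hsa⟩ : ∃ s ∈ L ∩ Iio t, f s < a := by
        obtain ⟨x, hx, hxa⟩ := exists_lt_of_csInf_lt (insert_nonempty _ _) ha
        rcases hx with rfl | ⟨y, hy, rfl⟩
        · exact ⟨s₀, hs₀, (he _ hs₀.1).trans_lt hxa⟩
        · exact ⟨y, hy, hxa⟩
      have : Ioi s ∈ 𝓝[L ∩ Iio t] t := nhdsWithin_le_nhds (Ioi_mem_nhds hs.2)
      filter_upwards [self_mem_nhdsWithin, this] with r hr hr'
      exact (hf hs.1 hr.1 (le_of_lt hr')).trans_lt hsa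

/-! ### Weak gradients -/

variable {d : ℕ} {Ω : Set (Vec d)}

theorem isFiniteMeasure_restrict (hΩ : IsBoundedLipschitzDomain Ω) :
    IsFiniteMeasure ((volume : Measure (Vec d)).restrict Ω) :=
  ⟨by simpa using hΩ.2.2.1.measure_lt_top⟩

theorem integrable_coord {α ι : Type*} [Fintype ι] [MeasurableSpace α] {μ : Measure α}
    {u : α → EuclideanSpace ℝ ι} (hu : Integrable u μ) (i : ι) : Integrable (fun x => u x i) μ :=
  (EuclideanSpace.proj i : EuclideanSpace ℝ ι →L[ℝ] ℝ).integrable_comp hu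

theorem IsWeakGrad.congr {ι : Type*} {u v : Vec d → EuclideanSpace ℝ ι}
    {G H : Vec d → EuclideanSpace ℝ (ι × Fin d)} (h : IsWeakGrad Ω u G)
    (huv : u =ᵐ[volume.restrict Ω] v) (hGH : G =ᵐ[volume.restrict Ω] H) :
    IsWeakGrad Ω v H := by
  intro φ h1 h2 h3 i j
  have e1 : (fun x => fderiv ℝ φ x (basisVec d j) * v x i) =ᵐ[volume.restrict Ω]
      fun x => fderiv ℝ φ x (basisVec d j) * u x i := by
    filter_upwards [huv] with x hx
    rw [hx]
  have e2 : (fun x => φ x * H x (i, j)) =ᵐ[volume.restrict Ω] fun x => φ x * G x (i, j) := by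
    filter_upwards [hGH] with x hx
    rw [hx]
  rw [integral_congr_ae e1, integral_congr_ae e2]
  exact h φ h1 h2 h3 i j

/-- The fundamental lemma of the calculus of variations, entry by entry. Only integrability is
asked, so a gradient in `L²` can be compared with one in `L^p` or `L^∞`. -/
theorem IsWeakGrad.unique {ι : Type*} [Fintype ι] (hΩ : IsOpen Ω) {u : Vec d → EuclideanSpace ℝ ι}
    {G H : Vec d → EuclideanSpace ℝ (ι × Fin d)} (hG : IsWeakGrad Ω u G) (hH : IsWeakGrad Ω u H)
    (hGi : Integrable G (volume.restrict Ω)) (hHi : Integrable H (volume.restrict Ω)) :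
    G =ᵐ[volume.restrict Ω] H := by
  have key : ∀ q : ι × Fin d, ∀ᵐ x ∂(volume.restrict Ω), G x q - H x q = 0 := by
    rintro ⟨i, j⟩
    rw [ae_restrict_iff' hΩ.measurableSet]
    have hi := (integrable_coord hGi (i, j)).sub (integrable_coord hHi (i, j))
    refine IsOpen.ae_eq_zero_of_integral_contDiff_smul_eq_zero hΩ
      (IntegrableOn.locallyIntegrableOn hi) ?_
    intro g h1 h2 h3
    have e0 : ∀ x, x ∉ Ω → g x • (G x (i, j) - H x (i, j)) = 0 := fun x hx => by
      rw [image_eq_zero_of_notMem_tsupport (fun h => hx (h3 h)), zero_smul]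
    rw [← setIntegral_eq_integral_of_forall_compl_eq_zero e0]
    obtain ⟨C, hC⟩ := h1.continuous.bounded_above_of_compact_support h2
    have b1 : Integrable (fun x => g x * G x (i, j)) (volume.restrict Ω) :=
      (integrable_coord hGi (i, j)).bdd_mul h1.continuous.aestronglyMeasurable
        (Eventually.of_forall hC)
    have b2 : Integrable (fun x => g x * H x (i, j)) (volume.restrict Ω) :=
      (integrable_coord hHi (i, j)).bdd_mul h1.continuous.aestronglyMeasurable
        (Eventually.of_forall hC)
    simp only [smul_eq_mul, mul_sub]
    rw [integral_sub b1 b2]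
    have a1 := hG g h1 h2 h3 i j
    have a2 := hH g h1 h2 h3 i j
    linarith
  filter_upwards [eventually_countable_forall.2 key] with x hx
  ext q
  exact sub_eq_zero.1 (hx q)

theorem integrable_of_Lp [IsFiniteMeasure ((volume : Measure (Vec d)).restrict Ω)] {F : Type}
    [NormedAddCommGroup F] {p : ℝ≥0∞} (hp : 1 ≤ p) (u : LpΩ Ω F p) :
    Integrable u (volume.restrict Ω) :=
  (Lp.memLp u).integrable hp

/-- A closed condition: pairing an `L²` function with a bounded compactly supported one. -/
theorem continuous_integral_mul_coord {ι : Type} [Fintype ι] {g : Vec d → ℝ} (hg : Continuous g)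
    (hgc : HasCompactSupport g) (i : ι) :
    Continuous fun u : LpΩ Ω (EuclideanSpace ℝ ι) 2 => ∫ x in Ω, g x * u x i := by
  classical
  have hm : MemLp (fun x => EuclideanSpace.single i (g x)) 2
      ((volume : Measure (Vec d)).restrict Ω) := by
    have : MemLp g 2 ((volume : Measure (Vec d)).restrict Ω) :=
      (hg.memLp_of_hasCompactSupport hgc).restrict Ω
    refine MemLp.of_le this ?_ (Eventually.of_forall fun x => by simp)
    exact ((PiLp.continuous_toLp 2 _).comp
      ((continuous_single i).comp hg)).aestronglyMeasurable
  have : (fun u : LpΩ Ω (EuclideanSpace ℝ ι) 2 => ∫ x in Ω, g x * u x i) =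
      fun u => ⟪hm.toLp _, u⟫ := by
    ext u
    rw [L2.inner_def]
    refine integral_congr_ae ?_
    filter_upwards [hm.coeFn_toLp] with x hx
    rw [hx]
    simp [EuclideanSpace.inner_single_left]
  rw [this]
  exact continuous_const.inner continuous_id

theorem isClosed_W1_two : IsClosed (W1 Ω 2 : Set (LpΩ Ω (Vec d) 2 × LpΩ Ω (Mat d) 2)) := by
  have : (W1 Ω 2 : Set (LpΩ Ω (Vec d) 2 × LpΩ Ω (Mat d) 2)) =
      ⋂ (φ : Vec d → ℝ) (_ : ContDiff ℝ ∞ φ) (_ : HasCompactSupport φ) (_ : tsupport φ ⊆ Ω)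
        (i : Fin d) (j : Fin d), {u : LpΩ Ω (Vec d) 2 × LpΩ Ω (Mat d) 2 |
          ∫ x in Ω, fderiv ℝ φ x (basisVec d j) * u.1 x i = -∫ x in Ω, φ x * u.2 x (i, j)} := by
    ext u
    simp only [mem_iInter, SetLike.mem_coe]
    exact Iff.rfl
  rw [this]
  refine isClosed_iInter fun φ => isClosed_iInter fun h1 => isClosed_iInter fun h2 =>
    isClosed_iInter fun h3 => isClosed_iInter fun i => isClosed_iInter fun j => ?_
  exact isClosed_eq ((continuous_integral_mul_coord (continuous_partial h1 j)
    (hasCompactSupport_partial h2 j) i).comp continuous_fst)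
    ((continuous_integral_mul_coord h1.continuous h2 (i, j)).comp continuous_snd).neg

theorem hasFDerivAt_coord {φ : Vec d → Vec d} (hφ : ContDiff ℝ ∞ φ) (x : Vec d) (i : Fin d) :
    HasFDerivAt (fun y => φ y i)
      ((EuclideanSpace.proj i : Vec d →L[ℝ] ℝ).comp (fderiv ℝ φ x)) x :=
  (EuclideanSpace.proj i : Vec d →L[ℝ] ℝ).hasFDerivAt.comp x
    ((hφ.differentiable (by simp)) x).hasFDerivAt

theorem fderiv_coord {φ : Vec d → Vec d} (hφ : ContDiff ℝ ∞ φ) (x : Vec d) (i j : Fin d) :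
    fderiv ℝ (fun y => φ y i) x (basisVec d j) = classicalGrad φ x (i, j) := by
  rw [(hasFDerivAt_coord hφ x i).fderiv]
  rfl

theorem contDiff_coord {φ : Vec d → Vec d} (hφ : ContDiff ℝ ∞ φ) (i : Fin d) :
    ContDiff ℝ ∞ fun y => φ y i :=
  (EuclideanSpace.proj i : Vec d →L[ℝ] ℝ).contDiff.comp hφ

theorem continuous_classicalGrad {φ : Vec d → Vec d} (hφ : ContDiff ℝ ∞ φ) :
    Continuous (classicalGrad φ) := by
  refine (PiLp.continuous_toLp 2 _).comp (continuous_pi fun ij => ?_)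
  have : Continuous fun x => fderiv ℝ φ x (basisVec d ij.2) :=
    (hφ.continuous_fderiv (by simp)).clm_apply continuous_const
  exact (EuclideanSpace.proj ij.1 : Vec d →L[ℝ] ℝ).continuous.comp this

theorem tsupport_classicalGrad_subset (φ : Vec d → Vec d) :
    tsupport (classicalGrad φ) ⊆ tsupport φ := by
  refine closure_minimal (fun x hx => ?_) (isClosed_tsupport φ)
  by_contra h
  apply hx
  have : fderiv ℝ φ x = 0 := by
    have h2 := mt (fun hx' => tsupport_fderiv_subset ℝ (f := φ) hx') h
    exact image_eq_zero_of_notMem_tsupport h2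
  ext ij
  simp [classicalGrad, this]

theorem IsTestField.hasCompactSupport_classicalGrad {φ : Vec d → Vec d} (h : IsTestField Ω φ) :
    HasCompactSupport (classicalGrad φ) :=
  h.2.1.of_isClosed_subset (isClosed_tsupport _) (tsupport_classicalGrad_subset φ)

theorem IsTestField.hasCompactSupport_coord {φ : Vec d → Vec d} (h : IsTestField Ω φ)
    (i : Fin d) : HasCompactSupport fun y => φ y i :=
  h.2.1.comp_left (g := fun v : Vec d => v i) rfl

/-- The scalar test function alone provides the compact support for the integration by parts. -/
theorem isWeakGrad_classicalGrad {ψ : Vec d → Vec d} (hψ : ContDiff ℝ ∞ ψ) :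
    IsWeakGrad Ω ψ (classicalGrad ψ) := by
  intro φ h1 h2 h3 i j
  have e1 : ∀ x, x ∉ Ω → fderiv ℝ φ x (basisVec d j) * ψ x i = 0 := fun x hx => by
    have h4 : x ∉ tsupport (fderiv ℝ φ) := fun h => hx (h3 (tsupport_fderiv_subset ℝ h))
    rw [image_eq_zero_of_notMem_tsupport h4]
    simp
  have e2 : ∀ x, x ∉ Ω → φ x * classicalGrad ψ x (i, j) = 0 := fun x hx => by
    rw [image_eq_zero_of_notMem_tsupport (fun h => hx (h3 h)), zero_mul]
  rw [setIntegral_eq_integral_of_forall_compl_eq_zero e1,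
    setIntegral_eq_integral_of_forall_compl_eq_zero e2]
  simp only [← fderiv_coord hψ]
  have c1 := contDiff_coord hψ i
  have hc : Continuous fun x => fderiv ℝ (fun y => ψ y i) x (basisVec d j) :=
    continuous_partial c1 j
  have := integral_mul_fderiv_eq_neg_fderiv_mul_of_integrable (μ := (volume : Measure (Vec d)))
    (f := φ) (g := fun y => ψ y i) (v := basisVec d j)
    (((continuous_partial h1 j).mul c1.continuous).integrable_of_hasCompactSupport
      (hasCompactSupport_partial h2 j).mul_right)
    ((h1.continuous.mul hc).integrable_of_hasCompactSupport h2.mul_right)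
    ((h1.continuous.mul c1.continuous).integrable_of_hasCompactSupport h2.mul_right)
    (fun x _ => h1.differentiable (by simp) x) (fun x _ => c1.differentiable (by simp) x)
  linarith

theorem H10_le_W1 : H10 Ω ≤ W1 Ω 2 := by
  refine Submodule.topologicalClosure_minimal _ (Submodule.span_le.2 ?_) isClosed_W1_two
  rintro u ⟨φ, hφ, h1, h2⟩
  exact (isWeakGrad_classicalGrad hφ.1).congr h1.symm h2.symm

theorem H10sigma_le_H10 : H10sigma Ω ≤ H10 Ω :=
  Submodule.topologicalClosure_mono (Submodule.span_mono
    fun _ ⟨φ, hφ, h⟩ => ⟨φ, hφ.1, h⟩)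

theorem fst_mem_L2sigma {w : LpΩ Ω (Vec d) 2 × LpΩ Ω (Mat d) 2} (hw : w ∈ H10sigma Ω) :
    w.1 ∈ L2sigma Ω := by
  have : H10sigma Ω ≤ (L2sigma Ω).comap
      (ContinuousLinearMap.fst ℝ (LpΩ Ω (Vec d) 2) (LpΩ Ω (Mat d) 2)).toLinearMap := by
    refine Submodule.topologicalClosure_minimal _ (Submodule.span_le.2 ?_) ?_
    · rintro u ⟨φ, hφ, h1, h2⟩
      exact Submodule.le_topologicalClosure _ (Submodule.subset_span ⟨φ, hφ, h1⟩)
    · exact (Submodule.isClosed_topologicalClosure _).preimage continuous_fst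
  exact this hw

/-! ### Identification of the chosen gradients and lifts -/

section wgrad

variable [IsFiniteMeasure ((volume : Measure (Vec d)).restrict Ω)]

theorem wgrad_eq (hΩ : IsOpen Ω) {u : LpΩ Ω (Vec d) 2} {G : LpΩ Ω (Mat d) 2}
    (h : IsWeakGrad Ω u G) : wgrad u = G := by
  have hex : ∃ G : LpΩ Ω (Mat d) 2, IsWeakGrad Ω u G := ⟨G, h⟩
  rw [wgrad, dif_pos hex]
  exact Lp.ext (hex.choose_spec.unique hΩ h (integrable_of_Lp (by norm_num) _)
    (integrable_of_Lp (by norm_num) _))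

theorem wgrad_eq_of_mem_H10 (hΩ : IsOpen Ω) {w : LpΩ Ω (Vec d) 2 × LpΩ Ω (Mat d) 2}
    (hw : w ∈ H10 Ω) : wgrad w.1 = w.2 :=
  wgrad_eq hΩ (H10_le_W1 hw)

theorem wgrad_zero (hΩ : IsOpen Ω) : wgrad (0 : LpΩ Ω (Vec d) 2) = 0 :=
  wgrad_eq_of_mem_H10 hΩ (w := 0) (zero_mem _)

theorem liftH10_eq (hΩ : IsOpen Ω) (w : H10 Ω) :
    liftH10 (w : LpΩ Ω (Vec d) 2 × LpΩ Ω (Mat d) 2).1 = w := by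
  have hex : ∃ w' : H10 Ω, (w' : LpΩ Ω (Vec d) 2 × LpΩ Ω (Mat d) 2).1 =
    (w : LpΩ Ω (Vec d) 2 × LpΩ Ω (Mat d) 2).1 := ⟨w, rfl⟩
  rw [liftH10, dif_pos hex]
  have h1 := hex.choose_spec
  refine Subtype.ext (Prod.ext h1 ?_)
  rw [← wgrad_eq_of_mem_H10 hΩ hex.choose.2, ← wgrad_eq_of_mem_H10 hΩ w.2, h1]

end wgrad

/-! ### The trilinear form -/

variable {d : ℕ} {Ω : Set (Vec d)}

theorem sum_mul_sq_le_norm {d : ℕ} (M : Mat d) (a : Vec d) :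
    ∑ i : Fin d, (∑ j : Fin d, M (i, j) * a j) ^ 2 ≤ (‖M‖ * ‖a‖) ^ 2 := by
  rw [mul_pow, EuclideanSpace.norm_sq_eq, EuclideanSpace.norm_sq_eq, Fintype.sum_prod_type,
    Finset.sum_mul]
  refine Finset.sum_le_sum fun i _ => ?_
  simp only [Real.norm_eq_abs, sq_abs]
  exact Finset.sum_mul_sq_le_sq_mul_sq _ _ _

/-- The product `M a` of a matrix and a vector. -/
def matVec (d : ℕ) : Mat d →L[ℝ] Vec d →L[ℝ] Vec d :=
  LinearMap.mkContinuous₂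
    (LinearMap.mk₂ ℝ (fun (M : Mat d) (a : Vec d) =>
      (WithLp.toLp 2 fun i => ∑ j : Fin d, M (i, j) * a j : Vec d))
      (fun M N a => by ext i; simp [add_mul, Finset.sum_add_distrib])
      (fun c M a => by ext i; simp [mul_assoc, Finset.mul_sum])
      (fun M a b => by ext i; simp [mul_add, Finset.sum_add_distrib])
      (fun c M a => by ext i; simp [mul_left_comm, Finset.mul_sum])) 1
    (fun M a => by
      rw [one_mul]
      refine le_of_sq_le_sq ?_ (by positivity)
      rw [EuclideanSpace.norm_sq_eq]
      simpa using sum_mul_sq_le_norm M a)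

theorem matVec_apply (M : Mat d) (a : Vec d) (i : Fin d) :
    matVec d M a i = ∑ j : Fin d, M (i, j) * a j := rfl

theorem norm_matVec_le : ‖matVec d‖ ≤ 1 :=
  LinearMap.mkContinuous₂_norm_le _ zero_le_one _

/-- The transposition of matrices. -/
def transposeL (d : ℕ) : Mat d →L[ℝ] Mat d :=
  (LinearIsometryEquiv.piLpCongrLeft 2 ℝ ℝ (Equiv.prodComm (Fin d) (Fin d))).toLinearIsometry
    |>.toContinuousLinearMap

theorem transposeL_apply (M : Mat d) (i j : Fin d) : transposeL d M (i, j) = M (j, i) := by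
  simp [transposeL, LinearIsometryEquiv.piLpCongrLeft_apply]

/-- The product `Mᵀ c` of a transposed matrix and a vector. -/
def matTVec (d : ℕ) : Mat d →L[ℝ] Vec d →L[ℝ] Vec d := (matVec d).comp (transposeL d)

theorem matTVec_apply (M : Mat d) (a : Vec d) (i : Fin d) :
    matTVec d M a i = ∑ j : Fin d, M (j, i) * a j := by
  simp [matTVec, matVec_apply, transposeL_apply]

/-- The trilinear form `∫ ∑ a_j G_{ij} c_i` for a bounded matrix field `G`. -/
def triForm (G : LpΩ Ω (Mat d) ∞) (a c : LpΩ Ω (Vec d) 2) : ℝ :=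
  ⟪(matVec d).holderL (volume.restrict Ω) ∞ 2 2 G a, c⟫

theorem triForm_eq (G : LpΩ Ω (Mat d) ∞) (a c : LpΩ Ω (Vec d) 2) :
    triForm G a c = ∫ x in Ω, ∑ i : Fin d, ∑ j : Fin d, a x j * G x (i, j) * c x i := by
  rw [triForm, L2.inner_def]
  refine integral_congr_ae ?_
  filter_upwards [(matVec d).coeFn_holder (r := 2) G a] with x hx
  rw [ContinuousLinearMap.holderL_apply_apply, hx, PiLp.inner_apply]
  refine Finset.sum_congr rfl fun i _ => ?_
  rw [matVec_apply]
  simp only [RCLike.inner_apply, conj_trivial, Finset.mul_sum]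
  exact Finset.sum_congr rfl fun j _ => by ring

theorem abs_triForm_le (G : LpΩ Ω (Mat d) ∞) (a c : LpΩ Ω (Vec d) 2) :
    |triForm G a c| ≤ ‖G‖ * ‖a‖ * ‖c‖ := by
  refine (abs_real_inner_le_norm _ _).trans ?_
  gcongr
  refine ((matVec d).norm_holder_apply_apply_le G a).trans ?_
  have := norm_matVec_le (d := d)
  calc _ ≤ 1 * ‖G‖ * ‖a‖ := by gcongr
    _ = _ := by ring

/-- The trilinear form `∫ ∑ a_j B_{ij} c_i` for a bounded vector field `c`. -/
def triForm' (a : LpΩ Ω (Vec d) 2) (B : LpΩ Ω (Mat d) 2) (c : LpΩ Ω (Vec d) ∞) : ℝ :=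
  ⟪(matTVec d).holderL (volume.restrict Ω) 2 ∞ 2 B c, a⟫

theorem triForm'_eq (a : LpΩ Ω (Vec d) 2) (B : LpΩ Ω (Mat d) 2) (c : LpΩ Ω (Vec d) ∞) :
    triForm' a B c = ∫ x in Ω, ∑ i : Fin d, ∑ j : Fin d, a x j * B x (i, j) * c x i := by
  rw [triForm', L2.inner_def]
  refine integral_congr_ae ?_
  filter_upwards [(matTVec d).coeFn_holder (r := 2) B c] with x hx
  rw [ContinuousLinearMap.holderL_apply_apply, hx, PiLp.inner_apply, Finset.sum_comm]
  refine Finset.sum_congr rfl fun i _ => ?_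
  rw [matTVec_apply]
  simp only [RCLike.inner_apply, conj_trivial, Finset.mul_sum]
  exact Finset.sum_congr rfl fun j _ => by ring

/-- The products `a_j b_i` are scalar test functions for the weak gradient of `c`. Their derivatives
contain the extra term `(div a) b_i`, which vanishes after summation over `j`. -/
theorem integral_smooth_by_parts {a b : Vec d → Vec d} (ha : IsSolTestField Ω a)
    (hb : IsTestField Ω b) {c : LpΩ Ω (Vec d) ∞} {G : LpΩ Ω (Mat d) ∞} (h : IsWeakGrad Ω c G) :
    ∫ x in Ω, ∑ i : Fin d, ∑ j : Fin d, a x j * classicalGrad b x (i, j) * c x i =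
      -∫ x in Ω, ∑ i : Fin d, ∑ j : Fin d, a x j * G x (i, j) * b x i := by
  have sm : ∀ i j, ContDiff ℝ ∞ fun x => a x j * b x i := fun i j =>
    (contDiff_coord ha.1.1 j).mul (contDiff_coord hb.1 i)
  have hcs : ∀ i j, HasCompactSupport fun x => a x j * b x i := fun i j =>
    (hb.hasCompactSupport_coord i).mul_left
  have hts : ∀ i j, tsupport (fun x => a x j * b x i) ⊆ Ω := fun i j => by
    refine (tsupport_mul_subset_left).trans ((closure_mono ?_).trans ha.1.2.2)
    intro x hx h0
    exact hx (by simp [h0])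
  have hp : ∀ i j x, fderiv ℝ (fun x => a x j * b x i) x (basisVec d j) =
      a x j * classicalGrad b x (i, j) + classicalGrad a x (j, j) * b x i := by
    intro i j x
    have := (hasFDerivAt_coord ha.1.1 x j).mul (hasFDerivAt_coord hb.1 x i)
    have e : fderiv ℝ (fun x => a x j * b x i) x = _ := HasFDerivAt.fderiv this
    rw [e]
    simp [classicalGrad]
    ring
  have hi1 : ∀ i j, Integrable (fun x => fderiv ℝ (fun x => a x j * b x i) x (basisVec d j) *
      c x i) (volume.restrict Ω) := fun i j =>
    integrable_mul_coord le_top c (continuous_partial (sm i j) j)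
      (hasCompactSupport_partial (hcs i j) j) i
  have hi2 : ∀ i j, Integrable (fun x => a x j * b x i * G x (i, j)) (volume.restrict Ω) :=
    fun i j => integrable_mul_coord le_top G (sm i j).continuous (hcs i j) (i, j)
  have e1 : ∀ x, ∑ i : Fin d, ∑ j : Fin d, a x j * classicalGrad b x (i, j) * c x i =
      ∑ i : Fin d, ∑ j : Fin d,
        fderiv ℝ (fun x => a x j * b x i) x (basisVec d j) * c x i := by
    intro x
    refine Finset.sum_congr rfl fun i _ => ?_
    simp only [hp, add_mul, Finset.sum_add_distrib]
    have h0 : ∑ j : Fin d, classicalGrad a x (j, j) = 0 := ha.2 x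
    rw [← Finset.sum_mul, ← Finset.sum_mul, ← Finset.sum_mul, h0]
    simp
  have e2 : ∀ x, ∑ i : Fin d, ∑ j : Fin d, a x j * G x (i, j) * b x i =
      ∑ i : Fin d, ∑ j : Fin d, a x j * b x i * G x (i, j) := fun x =>
    Finset.sum_congr rfl fun i _ => Finset.sum_congr rfl fun j _ => by ring
  simp only [e1, e2]
  rw [integral_finsetSum _ fun i _ => integrable_finsetSum _ fun j _ => hi1 i j,
    integral_finsetSum _ fun i _ => integrable_finsetSum _ fun j _ => hi2 i j,
    ← Finset.sum_neg_distrib]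
  refine Finset.sum_congr rfl fun i _ => ?_
  rw [integral_finsetSum _ fun j _ => hi1 i j, integral_finsetSum _ fun j _ => hi2 i j,
    ← Finset.sum_neg_distrib]
  exact Finset.sum_congr rfl fun j _ => h _ (sm i j) (hcs i j) (hts i j) i j

/-- Integration by parts in the trilinear form. -/
theorem triForm'_eq_neg_triForm {a : LpΩ Ω (Vec d) 2} (ha : a ∈ L2sigma Ω)
    {b : LpΩ Ω (Vec d) 2 × LpΩ Ω (Mat d) 2} (hb : b ∈ H10 Ω) {c : LpΩ Ω (Vec d) ∞}
    {G : LpΩ Ω (Mat d) ∞} (h : IsWeakGrad Ω c G) :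
    triForm' a b.2 c = -triForm G a b.1 := by
  set X := (matTVec d).holderL (volume.restrict Ω) 2 ∞ 2
  set Y := (matVec d).holderL (volume.restrict Ω) ∞ 2 2
  -- For fixed `a` the identity is the vanishing of a continuous functional of `(b, ∇b)`, so test
  -- fields `b` suffice; for such `b` it is a continuous functional of `a`, so solenoidal test
  -- fields `a` suffice.
  have main : H10 Ω ≤ LinearMap.ker ((((innerSL ℝ a).comp (X.flip c)).comp
      (ContinuousLinearMap.snd ℝ _ _) + (innerSL ℝ (Y G a)).comp
      (ContinuousLinearMap.fst ℝ (LpΩ Ω (Vec d) 2) (LpΩ Ω (Mat d) 2))).toLinearMap) := by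
    refine Submodule.topologicalClosure_minimal _ (Submodule.span_le.2 ?_)
      (ContinuousLinearMap.isClosed_ker _)
    rintro u ⟨φ, hφ, hu1, hu2⟩
    have main2 : L2sigma Ω ≤ LinearMap.ker ((innerSL ℝ (X u.2 c) +
        (innerSL ℝ u.1).comp (Y G)).toLinearMap) := by
      refine Submodule.topologicalClosure_minimal _ (Submodule.span_le.2 ?_)
        (ContinuousLinearMap.isClosed_ker _)
      rintro e ⟨ψ, hψ, he⟩
      have := integral_smooth_by_parts hψ hφ h
      have e1 : triForm' e u.2 c =
          ∫ x in Ω, ∑ i : Fin d, ∑ j : Fin d, ψ x j * classicalGrad φ x (i, j) * c x i := by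
        rw [triForm'_eq]
        refine integral_congr_ae ?_
        filter_upwards [he, hu2] with x h1 h2
        rw [h1, h2]
      have e2 : triForm G e u.1 =
          ∫ x in Ω, ∑ i : Fin d, ∑ j : Fin d, ψ x j * G x (i, j) * φ x i := by
        rw [triForm_eq]
        refine integral_congr_ae ?_
        filter_upwards [he, hu1] with x h1 h2
        rw [h1, h2]
      have e3 : triForm' e u.2 c + triForm G e u.1 = 0 := by rw [e1, e2, this]; ring
      rw [SetLike.mem_coe, LinearMap.mem_ker]
      simpa [triForm', triForm, real_inner_comm, X, Y] using e3
    have := main2 ha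
    rw [LinearMap.mem_ker] at this
    rw [SetLike.mem_coe, LinearMap.mem_ker]
    simpa [real_inner_comm, X, Y] using this
  have := main hb
  rw [LinearMap.mem_ker] at this
  have h2 : triForm' a b.2 c + triForm G a b.1 = 0 := by
    simpa [triForm', triForm, real_inner_comm, X, Y] using this
  linarith

/-- This is `∫ a · ∇(½|c|²) = 0`: for equal fields the two trilinear forms coincide, and integration
by parts makes them opposite. It removes the part of the inequality quadratic in the test field. -/
theorem triForm_self_eq_zero {a : LpΩ Ω (Vec d) 2} (ha : a ∈ L2sigma Ω)
    {b : LpΩ Ω (Vec d) 2 × LpΩ Ω (Mat d) 2} (hb : b ∈ H10 Ω) {c : LpΩ Ω (Vec d) ∞}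
    {G : LpΩ Ω (Mat d) ∞} (h : IsWeakGrad Ω c G) (h1 : b.1 =ᵐ[volume.restrict Ω] c)
    (h2 : b.2 =ᵐ[volume.restrict Ω] G) : triForm G a b.1 = 0 := by
  have e := triForm'_eq_neg_triForm ha hb h
  have e1 : triForm' a b.2 c = triForm G a b.1 := by
    rw [triForm'_eq, triForm_eq]
    refine integral_congr_ae ?_
    filter_upwards [h1, h2] with x h1 h2
    rw [h1, h2]
  linarith

theorem convForm_eq_triForm {a b c : L2sigma Ω} {G : LpΩ Ω (Mat d) ∞}
    (h : wgrad (b : LpΩ Ω (Vec d) 2) =ᵐ[volume.restrict Ω] G) :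
    convForm a b c = triForm G a c := by
  rw [convForm, triForm_eq]
  refine integral_congr_ae ?_
  filter_upwards [h] with x hx
  rw [hx]

/-- The antisymmetric part of a matrix does not contribute to its quadratic form; so the inviscid
case leads to the same form as the viscous one. -/
theorem symForm_eq_triForm {w b : L2sigma Ω} {G : LpΩ Ω (Mat d) ∞}
    (h : wgrad (b : LpΩ Ω (Vec d) 2) =ᵐ[volume.restrict Ω] G) :
    symForm w b = triForm G w w := by
  rw [symForm, triForm_eq]
  refine integral_congr_ae ?_
  filter_upwards [h] with x hx
  rw [hx]
  have e1 : ∑ i : Fin d, ∑ j : Fin d, (w : LpΩ Ω (Vec d) 2) x i * (1 / 2 * (G x (i, j) +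
      G x (j, i))) * (w : LpΩ Ω (Vec d) 2) x j =
      1 / 2 * ∑ i : Fin d, ∑ j : Fin d, (w : LpΩ Ω (Vec d) 2) x j * G x (i, j) *
        (w : LpΩ Ω (Vec d) 2) x i +
      1 / 2 * ∑ i : Fin d, ∑ j : Fin d, (w : LpΩ Ω (Vec d) 2) x i * G x (j, i) *
        (w : LpΩ Ω (Vec d) 2) x j := by
    simp only [Finset.mul_sum, ← Finset.sum_add_distrib]
    exact Finset.sum_congr rfl fun i _ => Finset.sum_congr rfl fun j _ => by ring
  rw [e1, Finset.sum_comm (f := fun i j => (w : LpΩ Ω (Vec d) 2) x i * G x (j, i) *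
        (w : LpΩ Ω (Vec d) 2) x j)]
  ring

/-- The convective term of the relative form, after integration by parts. -/
theorem convForm_self_eq_neg_triForm [IsFiniteMeasure ((volume : Measure (Vec d)).restrict Ω)]
    (hΩ : IsOpen Ω) {w : L2sigma Ω} (hw : ∃ u ∈ H10sigma Ω, u.1 = (w : LpΩ Ω (Vec d) 2))
    {b : L2sigma Ω} {c : LpΩ Ω (Vec d) ∞} {G : LpΩ Ω (Mat d) ∞} (h : IsWeakGrad Ω c G)
    (hb : (b : LpΩ Ω (Vec d) 2) =ᵐ[volume.restrict Ω] c) :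
    convForm w w b = -triForm G w w := by
  obtain ⟨u, hu, huw⟩ := hw
  have e := triForm'_eq_neg_triForm w.2 (H10sigma_le_H10 hu) h
  rw [huw] at e
  rw [← e, triForm'_eq, convForm]
  have : wgrad (w : LpΩ Ω (Vec d) 2) = u.2 := by
    rw [← huw, wgrad_eq_of_mem_H10 hΩ (H10sigma_le_H10 hu)]
  rw [this]
  refine integral_congr_ae ?_
  filter_upwards [hb] with x hx
  rw [hx]

/-! ### Sobolev embedding on domains with the cone property -/

section Morrey

variable {d : ℕ}

/-- Normalised bumps around a point of `W` are admissible test functions of integral one, and the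
corresponding mollifications converge to `f` almost everywhere. -/
theorem ae_abs_le_of_integral_le {W : Set (Vec d)} (hW : IsOpen W) {f : Vec d → ℝ}
    (hf : LocallyIntegrable f volume) {M : ℝ}
    (h : ∀ ψ : Vec d → ℝ, ContDiff ℝ ∞ ψ → HasCompactSupport ψ → tsupport ψ ⊆ W → (∀ x, 0 ≤ ψ x) →
      |∫ x, f x * ψ x| ≤ M * ∫ x, ψ x) : ∀ᵐ x, x ∈ W → |f x| ≤ M := by
  let φ : ℕ → ContDiffBump (0 : Vec d) := fun n =>
    ⟨1 / ((n : ℝ) + 1), 2 / ((n : ℝ) + 1), by positivity, by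
      gcongr
      norm_num⟩
  have hφ : Tendsto (fun n => (φ n).rOut) atTop (𝓝 0) := by
    have := (tendsto_one_div_add_atTop_nhds_zero_nat (𝕜 := ℝ)).const_mul 2
    simpa [φ, div_eq_mul_inv] using this
  have hφ' : ∀ᶠ n in atTop, (φ n).rOut ≤ 2 * (φ n).rIn :=
    Eventually.of_forall fun n => by simp [φ, div_eq_mul_inv]
  filter_upwards [ContDiffBump.ae_convolution_tendsto_right_of_locallyIntegrable
    (μ := (volume : Measure (Vec d))) hφ hφ' hf] with x hx hxW
  obtain ⟨r, hr, hrW⟩ := Metric.isOpen_iff.1 hW x hxW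
  refine le_of_tendsto hx.abs ?_
  filter_upwards [hφ.eventually (Iio_mem_nhds hr)] with n hn
  have hb : ∀ y, (φ n).normed volume (x - y) = (φ n).normed volume (y - x) := fun y => by
    rw [← ContDiffBump.normed_neg, neg_sub]
  have hsm : ContDiff ℝ ∞ fun y => (φ n).normed volume (y - x) :=
    (φ n).contDiff_normed.comp (contDiff_id.sub contDiff_const)
  have hsupp : tsupport (fun y => (φ n).normed volume (y - x)) ⊆
      Metric.closedBall x (φ n).rOut := by
    refine closure_minimal (fun y hy => ?_) Metric.isClosed_closedBall
    have : y - x ∈ Function.support ((φ n).normed volume) := hy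
    rw [ContDiffBump.support_normed_eq] at this
    rw [Metric.mem_closedBall, dist_eq_norm]
    simpa using (le_of_lt (by simpa using this : ‖y - x‖ < _))
  have := h (fun y => (φ n).normed volume (y - x)) hsm
    (HasCompactSupport.of_support_subset_isCompact (isCompact_closedBall x (φ n).rOut)
      (subset_closure.trans hsupp))
    (hsupp.trans ((Metric.closedBall_subset_ball hn).trans hrW))
    (fun y => (φ n).nonneg_normed _)
  rw [integral_sub_right_eq_self (fun y => (φ n).normed volume y), ContDiffBump.integral_normed,
    mul_one] at this
  rw [convolution_eq_swap]
  simpa [hb, mul_comm] using this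

/-- `G` is the weak gradient in `Ω` of the function `u`, both defined on the whole space. -/
def IsScalarWeakGrad (Ω : Set (Vec d)) (u : Vec d → ℝ) (G : Vec d → Vec d) : Prop :=
  ∀ φ : Vec d → ℝ, ContDiff ℝ ∞ φ → HasCompactSupport φ → tsupport φ ⊆ Ω →
    ∀ b : Vec d, ∫ x, fderiv ℝ φ x b * u x = -∫ x, φ x * ⟪G x, b⟫

variable {Ω W : Set (Vec d)} {u : Vec d → ℝ} {G : Vec d → Vec d}

/-- The weak form of `u(x + b) - u(x) = ∫₀¹ G(x + s b) · b ds`: the translation is moved to `ψ`,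
whose translates stay supported in `Ω` because the segments do. -/
theorem IsScalarWeakGrad.integral_translate_sub (hw : IsScalarWeakGrad Ω u G)
    (hu : Integrable u volume) {ψ : Vec d → ℝ} (hψ : ContDiff ℝ ∞ ψ)
    (hψc : HasCompactSupport ψ) (hψW : tsupport ψ ⊆ W) {b : Vec d}
    (hb : ∀ x ∈ W, ∀ s ∈ Icc (0 : ℝ) 1, x + s • b ∈ Ω) :
    (∫ y, u y * ψ (y - b)) - ∫ y, u y * ψ y =
      ∫ s in (0 : ℝ)..1, ∫ y, ψ (y - s • b) * ⟪G y, b⟫ := by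
  have hd : ∀ y s, HasDerivAt (fun s : ℝ => ψ (y - s • b)) (-fderiv ℝ ψ (y - s • b) b) s := by
    intro y s
    have h1 : HasDerivAt (fun s : ℝ => y - s • b) (-b) s := by
      simpa using ((hasDerivAt_id s).smul_const b).const_sub y
    have h2 := ((hψ.differentiable (by simp)) (y - s • b)).hasFDerivAt.comp_hasDerivAt s h1
    rw [map_neg] at h2
    exact h2
  have hc : Continuous fun q : Vec d × ℝ => fderiv ℝ ψ (q.1 - q.2 • b) b := by
    have := hψ.continuous_fderiv (by simp)
    exact (this.comp (by fun_prop)).clm_apply continuous_const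
  have hpt : ∀ y, ψ (y - b) - ψ y = ∫ s in (0 : ℝ)..1, -fderiv ℝ ψ (y - s • b) b := by
    intro y
    rw [intervalIntegral.integral_eq_sub_of_hasDerivAt (f := fun s : ℝ => ψ (y - s • b))
      (fun s _ => hd y s)]
    · simp
    · exact ((hc.comp (Continuous.prodMk_right y)).neg).intervalIntegrable _ _
  obtain ⟨C, hC⟩ := hψ.continuous.bounded_above_of_compact_support hψc
  obtain ⟨C', hC'⟩ := (hψ.continuous_fderiv (by simp)).bounded_above_of_compact_support
    (hψc.fderiv ℝ)
  have hi : ∀ c : Vec d, Integrable (fun y => u y * ψ (y - c)) volume := fun c =>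
    hu.mul_bdd (c := C)
      (hψ.continuous.comp (continuous_id.sub continuous_const)).aestronglyMeasurable
      (Eventually.of_forall fun y => hC _)
  have e0 : (∫ y, u y * ψ (y - b)) - ∫ y, u y * ψ y =
      ∫ y, ∫ s in (0 : ℝ)..1, u y * -fderiv ℝ ψ (y - s • b) b := by
    have := hi 0
    simp only [sub_zero] at this
    rw [← integral_sub (hi b) this]
    refine integral_congr_ae (Eventually.of_forall fun y => ?_)
    simp only [intervalIntegral.integral_const_mul]
    rw [← hpt, mul_sub]
  have hprod : Integrable (Function.uncurry fun (y : Vec d) (s : ℝ) =>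
      u y * -fderiv ℝ ψ (y - s • b) b)
      ((volume : Measure (Vec d)).prod (volume.restrict (Ioc (0 : ℝ) 1))) := by
    refine (hu.comp_fst (volume.restrict (Ioc (0 : ℝ) 1))).mul_bdd (c := C' * ‖b‖)
      hc.neg.aestronglyMeasurable (Eventually.of_forall fun q => ?_)
    rw [norm_neg]
    exact (ContinuousLinearMap.le_opNorm _ _).trans
      (mul_le_mul_of_nonneg_right (hC' _) (norm_nonneg _))
  rw [e0]
  simp only [intervalIntegral.integral_of_le zero_le_one]
  rw [integral_integral_swap hprod]
  refine setIntegral_congr_fun measurableSet_Ioc fun s hs => ?_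
  have hsm : ContDiff ℝ ∞ fun y => ψ (y - s • b) := hψ.comp (contDiff_id.sub contDiff_const)
  have hf : ∀ y, fderiv ℝ (fun y => ψ (y - s • b)) y = fderiv ℝ ψ (y - s • b) := fun y => by
    simpa [sub_eq_add_neg] using fderiv_comp_add_right (𝕜 := ℝ) (f := ψ) (x := y) (-(s • b))
  have hcs : HasCompactSupport fun y => ψ (y - s • b) :=
    hψc.comp_homeomorph (Homeomorph.subRight (s • b))
  have hts : tsupport (fun y => ψ (y - s • b)) ⊆ Ω := by
    intro y hy
    have h1 : y - s • b ∈ tsupport ψ := by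
      have := tsupport_comp_subset_preimage ψ (f := fun y : Vec d => y - s • b) (by fun_prop) hy
      exact this
    have := hb _ (hψW h1) s ⟨hs.1.le, hs.2⟩
    simpa using this
  have := hw _ hsm hcs hts b
  simp only [hf] at this
  have h3 : ∫ y, u y * -fderiv ℝ ψ (y - s • b) b = -∫ y, fderiv ℝ ψ (y - s • b) b * u y := by
    rw [← integral_neg]
    exact integral_congr_ae (Eventually.of_forall fun y => by simp [mul_comm])
  rw [h3, this, neg_neg]

theorem IsScalarWeakGrad.enorm_integral_translate_sub_le (hw : IsScalarWeakGrad Ω u G)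
    (hu : Integrable u volume) {ψ : Vec d → ℝ} (hψ : ContDiff ℝ ∞ ψ)
    (hψc : HasCompactSupport ψ) (hψW : tsupport ψ ⊆ W) {b : Vec d}
    (hb : ∀ x ∈ W, ∀ s ∈ Icc (0 : ℝ) 1, x + s • b ∈ Ω) :
    ‖(∫ y, u y * ψ (y - b)) - ∫ y, u y * ψ y‖ₑ ≤
      ∫⁻ s in Ioc (0 : ℝ) 1, ∫⁻ x, ‖ψ x‖ₑ * (‖b‖ₑ * ‖G (x + s • b)‖ₑ) := by
  rw [hw.integral_translate_sub hu hψ hψc hψW hb, intervalIntegral.integral_of_le zero_le_one]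
  refine (enorm_integral_le_lintegral_enorm _).trans (lintegral_mono fun s => ?_)
  refine (enorm_integral_le_lintegral_enorm _).trans ?_
  rw [← lintegral_add_right_eq_self _ (s • b)]
  refine lintegral_mono fun x => ?_
  rw [add_sub_cancel_right, enorm_mul]
  gcongr
  rw [mul_comm, ← ofReal_norm, ← ofReal_norm, ← ofReal_norm, ← ENNReal.ofReal_mul (norm_nonneg _)]
  exact ENNReal.ofReal_le_ofReal (norm_inner_le_norm _ _)

/-- Averaging the translation formula over `b` with weight `κ` compares `u` with its mean over a
cone at `x`. Pairing with `ψ` avoids pointwise values of `u`. -/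
theorem IsScalarWeakGrad.enorm_integral_sub_le (hw : IsScalarWeakGrad Ω u G)
    (hu : Integrable u volume) (hG : Measurable G) {ψ κ : Vec d → ℝ} (hψ : ContDiff ℝ ∞ ψ)
    (hψc : HasCompactSupport ψ) (hψW : tsupport ψ ⊆ W) (hκ : Continuous κ)
    (hκc : HasCompactSupport κ) (hκi : ∫ b, κ b = 1)
    (hb : ∀ x ∈ W, ∀ b ∈ Function.support κ, ∀ s ∈ Icc (0 : ℝ) 1, x + s • b ∈ Ω) {A : ℝ≥0∞}
    (hA : ∀ x, ∫⁻ s in Ioc (0 : ℝ) 1, ∫⁻ b, ‖κ b‖ₑ * (‖b‖ₑ * ‖G (x + s • b)‖ₑ) ≤ A) :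
    ‖(∫ x, ψ x * ∫ y, u y * κ (y - x)) - ∫ y, u y * ψ y‖ₑ ≤ A * ∫⁻ x, ‖ψ x‖ₑ := by
  obtain ⟨C, hC⟩ := hψ.continuous.bounded_above_of_compact_support hψc
  obtain ⟨D, hD⟩ := hκ.bounded_above_of_compact_support hκc
  have iψ : Integrable ψ volume := hψ.continuous.integrable_of_hasCompactSupport hψc
  have iκ : Integrable κ volume := hκ.integrable_of_hasCompactSupport hκc
  -- Fubini and the substitution `b = y - x`.
  have e1 : ∫ x, ψ x * ∫ y, u y * κ (y - x) = ∫ b, κ b * ∫ y, u y * ψ (y - b) := by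
    simp only [← integral_const_mul]
    have i1 : Integrable (Function.uncurry fun (x y : Vec d) => ψ x * (u y * κ (y - x)))
        ((volume : Measure (Vec d)).prod volume) := by
      refine ((iψ.mul_prod hu).mul_bdd (c := D) (g := fun q : Vec d × Vec d => κ (q.2 - q.1))
        (hκ.comp (by fun_prop)).aestronglyMeasurable
        (Eventually.of_forall fun q => hD _)).congr (Eventually.of_forall fun q => ?_)
      simp only [Function.uncurry]
      ring
    have i2 : Integrable (Function.uncurry fun (b y : Vec d) => κ b * (u y * ψ (y - b)))
        ((volume : Measure (Vec d)).prod volume) := by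
      refine ((iκ.mul_prod hu).mul_bdd (c := C) (g := fun q : Vec d × Vec d => ψ (q.2 - q.1))
        (hψ.continuous.comp (by fun_prop)).aestronglyMeasurable
        (Eventually.of_forall fun q => hC _)).congr (Eventually.of_forall fun q => ?_)
      simp only [Function.uncurry]
      ring
    rw [integral_integral_swap i1, integral_integral_swap i2]
    refine integral_congr_ae (Eventually.of_forall fun y => ?_)
    have := integral_sub_left_eq_self (fun b => κ b * (u y * ψ (y - b))) volume y
    simp only [sub_sub_cancel] at this
    beta_reduce
    rw [← this]
    exact integral_congr_ae (Eventually.of_forall fun x => by ring)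
  have hcont : Continuous fun b => ∫ y, u y * ψ (y - b) := by
    refine continuous_of_dominated (bound := fun y => ‖u y‖ * C) (fun b => ?_) (fun b => ?_)
      (hu.norm.mul_const C) (Eventually.of_forall fun y => ?_)
    · exact hu.aestronglyMeasurable.mul (hψ.continuous.comp (by fun_prop)).aestronglyMeasurable
    · exact Eventually.of_forall fun y => by
        rw [norm_mul]
        exact mul_le_mul_of_nonneg_left (hC _) (norm_nonneg _)
    · exact continuous_const.mul (hψ.continuous.comp (by fun_prop))
  have e2 : (∫ x, ψ x * ∫ y, u y * κ (y - x)) - ∫ y, u y * ψ y =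
      ∫ b, κ b * ((∫ y, u y * ψ (y - b)) - ∫ y, u y * ψ y) := by
    simp only [mul_sub]
    rw [integral_sub, integral_mul_const, hκi, one_mul, e1]
    · exact (hκ.mul hcont).integrable_of_hasCompactSupport hκc.mul_right
    · exact iκ.mul_const _
  rw [e2]
  have mG : Measurable fun q : (Vec d × ℝ) × Vec d => ‖G (q.2 + q.1.2 • q.1.1)‖ₑ :=
    (hG.comp (by fun_prop)).enorm
  have mψ : Measurable ψ := hψ.continuous.measurable
  have mκ : Measurable κ := hκ.measurable
  -- Tonelli is applied until `x` is outermost, where the uniform bound `hA` on the inner integrals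
  -- can be used.
  calc _ ≤ ∫⁻ b, ‖κ b * ((∫ y, u y * ψ (y - b)) - ∫ y, u y * ψ y)‖ₑ :=
        enorm_integral_le_lintegral_enorm _
    _ ≤ ∫⁻ b, ‖κ b‖ₑ * ∫⁻ s in Ioc (0 : ℝ) 1, ∫⁻ x, ‖ψ x‖ₑ * (‖b‖ₑ * ‖G (x + s • b)‖ₑ) := by
        refine lintegral_mono fun b => ?_
        rw [enorm_mul]
        by_cases hb0 : κ b = 0
        · simp [hb0]
        · gcongr
          exact hw.enorm_integral_translate_sub_le hu hψ hψc hψW fun x hx => hb x hx b hb0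
    _ = ∫⁻ b, ∫⁻ s in Ioc (0 : ℝ) 1, ∫⁻ x, ‖κ b‖ₑ * (‖ψ x‖ₑ * (‖b‖ₑ * ‖G (x + s • b)‖ₑ)) := by
        refine lintegral_congr fun b => ?_
        rw [← lintegral_const_mul' _ _ enorm_ne_top]
        exact lintegral_congr fun s => (lintegral_const_mul' _ _ enorm_ne_top).symm
    _ = ∫⁻ s in Ioc (0 : ℝ) 1, ∫⁻ b, ∫⁻ x,
          ‖κ b‖ₑ * (‖ψ x‖ₑ * (‖b‖ₑ * ‖G (x + s • b)‖ₑ)) := by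
        rw [lintegral_lintegral_swap]
        refine Measurable.aemeasurable (Measurable.lintegral_prod_right' (f :=
          fun q : (Vec d × ℝ) × Vec d => ‖κ q.1.1‖ₑ * (‖ψ q.2‖ₑ * (‖q.1.1‖ₑ *
            ‖G (q.2 + q.1.2 • q.1.1)‖ₑ))) ?_)
        fun_prop
    _ = ∫⁻ s in Ioc (0 : ℝ) 1, ∫⁻ x, ∫⁻ b,
          ‖κ b‖ₑ * (‖ψ x‖ₑ * (‖b‖ₑ * ‖G (x + s • b)‖ₑ)) := by
        refine lintegral_congr fun s => ?_
        rw [lintegral_lintegral_swap]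
        have : Measurable fun q : Vec d × Vec d => ‖G (q.2 + s • q.1)‖ₑ :=
          (hG.comp (by fun_prop)).enorm
        refine Measurable.aemeasurable ?_
        unfold Function.uncurry
        fun_prop
    _ = ∫⁻ x, ∫⁻ s in Ioc (0 : ℝ) 1, ∫⁻ b,
          ‖κ b‖ₑ * (‖ψ x‖ₑ * (‖b‖ₑ * ‖G (x + s • b)‖ₑ)) := by
        rw [lintegral_lintegral_swap]
        refine Measurable.aemeasurable (Measurable.lintegral_prod_right' (f :=
          fun q : (ℝ × Vec d) × Vec d => ‖κ q.2‖ₑ * (‖ψ q.1.2‖ₑ * (‖q.2‖ₑ *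
            ‖G (q.1.2 + q.1.1 • q.2)‖ₑ))) ?_)
        have : Measurable fun q : (ℝ × Vec d) × Vec d => ‖G (q.1.2 + q.1.1 • q.2)‖ₑ :=
          (hG.comp (by fun_prop)).enorm
        fun_prop
    _ = ∫⁻ x, ‖ψ x‖ₑ * ∫⁻ s in Ioc (0 : ℝ) 1, ∫⁻ b, ‖κ b‖ₑ * (‖b‖ₑ * ‖G (x + s • b)‖ₑ) := by
        refine lintegral_congr fun x => ?_
        rw [← lintegral_const_mul' _ _ enorm_ne_top]
        refine lintegral_congr fun s => ?_
        rw [← lintegral_const_mul' _ _ enorm_ne_top]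
        exact lintegral_congr fun b => by ring
    _ ≤ ∫⁻ x, ‖ψ x‖ₑ * A := lintegral_mono fun x => by gcongr; exact hA x
    _ = _ := by rw [lintegral_mul_const _ mψ.enorm, mul_comm]

end Morrey

/-! ### Scaling of the kernels and the local estimate -/

section MorreyLocal

variable {d : ℕ}

theorem eLpNorm_comp_affine {q : ℝ≥0∞} (hq : q ≠ ⊤) {G : Vec d → Vec d} (hG : Measurable G)
    (x : Vec d) {s : ℝ} (hs : 0 < s) :
    eLpNorm (fun b => G (x + s • b)) q volume =
      ENNReal.ofReal (s ^ (-(d : ℝ) / q.toReal)) * eLpNorm G q volume := by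
  have e1 : eLpNorm (fun b => G (x + b)) q volume = eLpNorm G q volume :=
    eLpNorm_comp_measurePreserving hG.aestronglyMeasurable (measurePreserving_add_left volume x)
  have hm : AEStronglyMeasurable (fun b => G (x + b))
      (Measure.map (fun b : Vec d => s • b) volume) :=
    (hG.comp (measurable_const_add x)).aestronglyMeasurable
  have e2 := eLpNorm_map_measure (p := q) hm (measurable_const_smul s).aemeasurable
  have e3 : (fun b => G (x + s • b)) = (fun b => G (x + b)) ∘ fun b : Vec d => s • b := rfl
  have e4 : Measure.map (fun b : Vec d => s • b) volume =
      ENNReal.ofReal |(s ^ Module.finrank ℝ (Vec d))⁻¹| • (volume : Measure (Vec d)) :=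
    Measure.map_addHaar_smul volume hs.ne'
  rw [e3, ← e2, e4, eLpNorm_smul_measure_of_ne_top hq, e1, smul_eq_mul, finrank_euclideanSpace,
    Fintype.card_fin, abs_of_pos (by positivity), one_div, ENNReal.toReal_inv,
    ENNReal.ofReal_rpow_of_nonneg (by positivity) (by positivity)]
  congr 2
  rw [← Real.rpow_natCast, ← Real.rpow_neg hs.le, ← Real.rpow_mul hs.le, div_eq_mul_inv]

/-- Hölder in `b` over the ball containing the support of `κ`; the dilation by `s` costs `s^{-d/q}`.
The remaining integral in `s` is finite as soon as `q > d`. -/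
theorem lintegral_kernel_le {q : ℝ≥0∞} (hq1 : 1 ≤ q) (hq : q ≠ ⊤) {G : Vec d → Vec d}
    (hG : Measurable G) {κ : Vec d → ℝ} {Θ R : ℝ} (hΘ : ∀ b, ‖κ b‖ ≤ Θ)
    (hR : Function.support κ ⊆ Metric.ball 0 R) (x : Vec d) :
    ∫⁻ s in Ioc (0 : ℝ) 1, ∫⁻ b, ‖κ b‖ₑ * (‖b‖ₑ * ‖G (x + s • b)‖ₑ) ≤
      (ENNReal.ofReal (Θ * R) * volume (Metric.ball (0 : Vec d) R) ^ (1 - 1 / q.toReal) *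
        ∫⁻ s in Ioc (0 : ℝ) 1, ENNReal.ofReal (s ^ (-(d : ℝ) / q.toReal))) *
          eLpNorm G q volume := by
  have hΘ0 : 0 ≤ Θ := (norm_nonneg _).trans (hΘ 0)
  have key : ∀ s ∈ Ioc (0 : ℝ) 1, ∫⁻ b, ‖κ b‖ₑ * (‖b‖ₑ * ‖G (x + s • b)‖ₑ) ≤
      ENNReal.ofReal (Θ * R) * volume (Metric.ball (0 : Vec d) R) ^ (1 - 1 / q.toReal) *
        eLpNorm G q volume * ENNReal.ofReal (s ^ (-(d : ℝ) / q.toReal)) := by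
    intro s hs
    calc _ ≤ ∫⁻ b, (Metric.ball (0 : Vec d) R).indicator
          (fun b => ENNReal.ofReal (Θ * R) * ‖G (x + s • b)‖ₑ) b := by
          refine lintegral_mono fun b => ?_
          by_cases hb : b ∈ Metric.ball (0 : Vec d) R
          · rw [indicator_of_mem hb, ← mul_assoc, ENNReal.ofReal_mul hΘ0]
            gcongr
            · rw [← ofReal_norm]
              exact ENNReal.ofReal_le_ofReal (hΘ b)
            · rw [← ofReal_norm]
              exact ENNReal.ofReal_le_ofReal (le_of_lt (by simpa using hb))
          · have : κ b = 0 := by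
              by_contra h
              exact hb (hR h)
            simp [this]
      _ = ENNReal.ofReal (Θ * R) * eLpNorm (fun b => G (x + s • b)) 1
            (volume.restrict (Metric.ball (0 : Vec d) R)) := by
          rw [lintegral_indicator Metric.isOpen_ball.measurableSet,
            lintegral_const_mul' _ _ ENNReal.ofReal_ne_top, eLpNorm_one_eq_lintegral_enorm]
      _ ≤ ENNReal.ofReal (Θ * R) * (eLpNorm (fun b => G (x + s • b)) q
            (volume.restrict (Metric.ball (0 : Vec d) R)) *
              volume (Metric.ball (0 : Vec d) R) ^ (1 - 1 / q.toReal)) := by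
          gcongr
          have := eLpNorm_le_eLpNorm_mul_rpow_measure_univ (p := 1) (q := q)
            (μ := volume.restrict (Metric.ball (0 : Vec d) R)) (f := fun b => G (x + s • b)) hq1
            (hG.comp (by fun_prop)).aestronglyMeasurable
          simpa using this
      _ ≤ ENNReal.ofReal (Θ * R) * (eLpNorm (fun b => G (x + s • b)) q volume *
              volume (Metric.ball (0 : Vec d) R) ^ (1 - 1 / q.toReal)) := by
          gcongr
          exact Measure.restrict_le_self
      _ = _ := by
          rw [eLpNorm_comp_affine hq hG x hs.1]
          ring
  calc _ ≤ ∫⁻ s in Ioc (0 : ℝ) 1,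
        ENNReal.ofReal (Θ * R) * volume (Metric.ball (0 : Vec d) R) ^ (1 - 1 / q.toReal) *
          eLpNorm G q volume * ENNReal.ofReal (s ^ (-(d : ℝ) / q.toReal)) :=
        setLIntegral_mono' measurableSet_Ioc key
    _ = _ := by
        rw [lintegral_const_mul]
        · ring
        · exact (measurable_id.pow_const _).ennreal_ofReal

theorem lintegral_rpow_lt_top {α : ℝ} (hα : -1 < α) :
    ∫⁻ s in Ioc (0 : ℝ) 1, ENNReal.ofReal (s ^ α) < ⊤ := by
  have h := (intervalIntegral.intervalIntegrable_rpow' (a := 0) (b := 1) hα).1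
  refine lt_of_le_of_lt (setLIntegral_mono' measurableSet_Ioc fun s hs => ?_)
    h.hasFiniteIntegral
  exact Real.ofReal_le_enorm _

/-- Power counting: the kernel contributes `r^{-d}`, the length `r` and the volume `r^{d(1 - 1/q)}`,
in total `r^{1 - d/q}`, which tends to zero because `q > d`. -/
theorem exists_scale {q : ℝ} (hq1 : 1 ≤ q) (hdq : (d : ℝ) < q) {ρ R : ℝ} (hρ : 0 < ρ)
    (hR : 0 < R) (I : ℝ) {ε : ℝ} (hε : 0 < ε) :
    ∃ r ∈ Ioc (0 : ℝ) 1,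
      1 / volume.real (Metric.closedBall (0 : Vec d) (r * ρ)) * (r * R) *
        volume.real (Metric.ball (0 : Vec d) (r * R)) ^ (1 - 1 / q) * I ≤ ε := by
  set om := volume.real (Metric.ball (0 : Vec d) 1) with hom
  have hom0 : 0 < om := by
    rw [hom]
    exact ENNReal.toReal_pos (Metric.measure_ball_pos _ _ one_pos).ne' measure_ball_lt_top.ne
  have hq0 : 0 < q := by linarith
  set C := 1 / (ρ ^ d * om) * R * (R ^ d * om) ^ (1 - 1 / q) * I with hC
  have key : ∀ r ∈ Ioc (0 : ℝ) 1,
      1 / volume.real (Metric.closedBall (0 : Vec d) (r * ρ)) * (r * R) *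
        volume.real (Metric.ball (0 : Vec d) (r * R)) ^ (1 - 1 / q) * I = C * r ^ (1 - d / q) := by
    intro r hr
    have e1 : volume.real (Metric.closedBall (0 : Vec d) (r * ρ)) = r ^ d * (ρ ^ d * om) := by
      rw [Measure.addHaar_real_closedBall volume _ (mul_pos hr.1 hρ).le, finrank_euclideanSpace,
        Fintype.card_fin, mul_pow, mul_assoc]
    have e2 : volume.real (Metric.ball (0 : Vec d) (r * R)) = r ^ d * (R ^ d * om) := by
      rw [measureReal_def, Measure.addHaar_ball_of_pos volume _ (mul_pos hr.1 hR),
        ENNReal.toReal_mul, ENNReal.toReal_ofReal (pow_pos (mul_pos hr.1 hR) _).le,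
        ← measureReal_def, finrank_euclideanSpace,
        Fintype.card_fin, mul_pow, mul_assoc]
    have hrd : 0 < r ^ d := pow_pos hr.1 d
    rw [e1, e2, Real.mul_rpow hrd.le (by positivity), hC]
    have e3 : r ^ (1 - d / q) = (r ^ d)⁻¹ * r * (r ^ d) ^ (1 - 1 / q) := by
      have h1 : r ^ (1 - d / q) = r ^ (-(d : ℝ)) * r ^ (1 : ℝ) * r ^ ((d : ℝ) * (1 - 1 / q)) := by
        rw [← Real.rpow_add hr.1, ← Real.rpow_add hr.1]
        congr 1
        ring
      rw [h1, Real.rpow_one, Real.rpow_mul hr.1.le, Real.rpow_natCast, Real.rpow_neg hr.1.le,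
        Real.rpow_natCast]
    rw [e3]
    field_simp
  have hpos : 0 < 1 - d / q := by
    rw [sub_pos, div_lt_one hq0]
    exact hdq
  have lim : Tendsto (fun r : ℝ => C * r ^ (1 - d / q)) (𝓝[>] 0) (𝓝 0) := by
    have h1 := (Real.continuousAt_rpow_const 0 (1 - d / q) (Or.inr hpos.le)).tendsto
    rw [Real.zero_rpow hpos.ne'] at h1
    have := (h1.mono_left nhdsWithin_le_nhds : Tendsto _ (𝓝[>] (0 : ℝ)) _).const_mul C
    simpa using this
  obtain ⟨r, hr1, hr2⟩ := ((lim.eventually (Iic_mem_nhds hε)).and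
    (Ioc_mem_nhdsGT (one_pos))).exists
  exact ⟨r, hr2, by rw [key r hr2]; exact hr1⟩

variable {Ω W : Set (Vec d)}

/-- Over a sufficiently short cone, `u` differs from its weighted mean by a small multiple of the
gradient norm. The means depend on the vertex in a Lipschitz way, so finitely many vertices capture
them up to a small multiple of `∫ |u|`. -/
theorem exists_kernels_local {q : ℝ≥0∞} (hq1 : 1 ≤ q) (hdq : (d : ℝ≥0∞) < q) (hq : q ≠ ⊤)
    (hW : IsOpen W) (hWb : Bornology.IsBounded W) {z : Vec d} {ρ : ℝ} (hρ : 0 < ρ)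
    (hb : ∀ x ∈ W, ∀ b ∈ Metric.ball z ρ, ∀ s ∈ Icc (0 : ℝ) 1, x + s • b ∈ Ω)
    {ε : ℝ} (hε : 0 < ε) :
    ∃ K : Finset (Vec d → ℝ), (∀ κ ∈ K, Continuous κ ∧ HasCompactSupport κ) ∧
      ∀ (u : Vec d → ℝ) (G : Vec d → Vec d), Integrable u volume → Measurable G →
        MemLp G q volume → IsScalarWeakGrad Ω u G → ∀ᵐ x, x ∈ W →
          |u x| ≤ ε * ((eLpNorm G q volume).toReal + ∫ y, |u y|) + ∑ κ ∈ K, |∫ y, κ y * u y| := by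
  classical
  set q' := q.toReal with hq'
  have hq1' : 1 ≤ q' := by
    have := ENNReal.toReal_mono hq hq1
    simpa using this
  have hdq' : (d : ℝ) < q' := by
    have := (ENNReal.toReal_lt_toReal (by simp) hq).2 hdq
    simpa using this
  set I : ℝ≥0∞ := ∫⁻ s in Ioc (0 : ℝ) 1, ENNReal.ofReal (s ^ (-(d : ℝ) / q')) with hI
  have hI' : I < ⊤ := lintegral_rpow_lt_top (by
    rw [neg_div, neg_lt_neg_iff, div_lt_one (by linarith)]
    exact hdq')
  set R := ‖z‖ + ρ with hRdef
  have hR : 0 < R := by positivity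
  -- Half the opening enters because the sup of a normalised bump is bounded by the inverse volume
  -- of its inner ball, taken of radius `r ρ / 2`.
  obtain ⟨r, hr, hrε⟩ := exists_scale (d := d) hq1' hdq' (half_pos hρ) hR I.toReal hε
  let κ₀ : ContDiffBump (r • z) := ⟨r * (ρ / 2), r * ρ, mul_pos hr.1 (half_pos hρ), by
    have := mul_pos hr.1 hρ
    linarith⟩
  set κ : Vec d → ℝ := κ₀.normed volume with hκ
  have hκs : ContDiff ℝ ∞ κ := κ₀.contDiff_normed
  have hκc : HasCompactSupport κ := κ₀.hasCompactSupport_normed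
  obtain ⟨L, hL⟩ := hκs.lipschitzWith_of_hasCompactSupport hκc (by simp)
  set Θ := 1 / volume.real (Metric.closedBall (0 : Vec d) (r * (ρ / 2))) with hΘ
  have hκΘ : ∀ b, ‖κ b‖ ≤ Θ := fun b => by
    rw [Real.norm_of_nonneg (κ₀.nonneg_normed b), hΘ]
    have := κ₀.normed_le_div_measure_closedBall_rIn volume b
    rw [Measure.addHaar_real_closedBall_center] at this
    exact this
  have hsuppb : ∀ b ∈ Function.support κ, ∃ b' ∈ Metric.ball z ρ, b = r • b' := by
    intro b hb
    rw [hκ, ContDiffBump.support_normed_eq] at hb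
    refine ⟨r⁻¹ • b, ?_, by rw [smul_inv_smul₀ hr.1.ne']⟩
    rw [Metric.mem_ball, dist_eq_norm] at hb ⊢
    have : r⁻¹ • b - z = r⁻¹ • (b - r • z) := by rw [smul_sub, inv_smul_smul₀ hr.1.ne']
    rw [this, norm_smul, norm_inv, Real.norm_of_nonneg hr.1.le, inv_mul_lt_iff₀ hr.1]
    exact hb
  have hκR : Function.support κ ⊆ Metric.ball 0 (r * R) := by
    intro b hb
    obtain ⟨b', hb', rfl⟩ := hsuppb b hb
    rw [Metric.mem_ball, dist_eq_norm] at hb'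
    rw [mem_ball_zero_iff, norm_smul, Real.norm_of_nonneg hr.1.le]
    gcongr
    · exact hr.1
    have := norm_add_le (b' - z) z
    rw [sub_add_cancel] at this
    linarith
  have hcone : ∀ x ∈ W, ∀ b ∈ Function.support κ, ∀ s ∈ Icc (0 : ℝ) 1, x + s • b ∈ Ω := by
    intro x hx b hbs s hs
    obtain ⟨b', hb', rfl⟩ := hsuppb b hbs
    rw [smul_smul]
    exact hb x hx b' hb' _ ⟨mul_nonneg hs.1 hr.1.le, mul_le_one₀ hs.2 hr.1.le hr.2⟩
  -- With this spacing a change of vertex alters the kernel by at most `L δ ≤ ε`; the summand `1`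
  -- excludes division by zero.
  set δ := ε / (L + 1) with hδ
  have hδ0 : 0 < δ := by positivity
  have hLδ : L * δ ≤ ε := by
    rw [hδ, mul_div_assoc', div_le_iff₀ (by positivity)]
    nlinarith [L.2]
  obtain ⟨t, htf, ht⟩ := Metric.totallyBounded_iff.1 (hWb.isCompact_closure.totallyBounded.subset
    subset_closure) δ hδ0
  refine ⟨htf.toFinset.image fun x y => κ (y - x), ?_, ?_⟩
  · intro f hf
    obtain ⟨x, -, rfl⟩ := Finset.mem_image.1 hf
    exact ⟨hκs.continuous.comp (by fun_prop), hκc.comp_homeomorph (Homeomorph.subRight x)⟩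
  intro u G hu hGm hG hw
  set S := ∑ κ ∈ htf.toFinset.image fun x y => κ (y - x), |∫ y, κ y * u y| with hS
  set N := (eLpNorm G q volume).toReal with hN
  have hiκ : ∀ x, Integrable (fun y => u y * κ (y - x)) volume := fun x =>
    hu.mul_bdd (c := Θ) (hκs.continuous.comp (by fun_prop)).aestronglyMeasurable
      (Eventually.of_forall fun y => hκΘ _)
  have hU : ∀ x ∈ W, |∫ y, u y * κ (y - x)| ≤ ε * (∫ y, |u y|) + S := by
    intro x hx
    obtain ⟨x', hx', hxx⟩ := mem_iUnion₂.1 (ht hx)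
    have h1 : |(∫ y, u y * κ (y - x)) - ∫ y, u y * κ (y - x')| ≤ ε * ∫ y, |u y| := by
      rw [← integral_sub (hiκ x) (hiκ x'), ← integral_const_mul]
      refine (abs_integral_le_integral_abs).trans (integral_mono_of_nonneg
        (Eventually.of_forall fun y => abs_nonneg _) (hu.abs.const_mul ε)
        (Eventually.of_forall fun y => ?_))
      simp only [← mul_sub, abs_mul]
      rw [mul_comm]
      gcongr
      have h2 := hL.dist_le_mul (y - x) (y - x')
      rw [Real.dist_eq] at h2
      refine h2.trans (le_trans ?_ hLδ)
      gcongr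
      rw [dist_sub_left]
      exact (Metric.mem_ball.1 hxx).le
    have h2 : |∫ y, u y * κ (y - x')| ≤ S := by
      have := Finset.single_le_sum (f := fun κ : Vec d → ℝ => |∫ y, κ y * u y|)
        (fun _ _ => abs_nonneg _) (Finset.mem_image_of_mem (fun x y => κ (y - x))
          (htf.mem_toFinset.2 hx'))
      refine le_trans (le_of_eq ?_) this
      simp only [mul_comm]
    have h3 := abs_sub_abs_le_abs_sub (∫ y, u y * κ (y - x)) (∫ y, u y * κ (y - x'))
    linarith
  have hA := fun x => lintegral_kernel_le hq1 hq hGm hκΘ hκR x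
  set A : ℝ≥0∞ := (ENNReal.ofReal (Θ * (r * R)) *
    volume (Metric.ball (0 : Vec d) (r * R)) ^ (1 - 1 / q.toReal) * I) *
          eLpNorm G q volume with hAdef
  have hAfin : A ≠ ⊤ := by
    refine ENNReal.mul_ne_top (ENNReal.mul_ne_top (ENNReal.mul_ne_top ENNReal.ofReal_ne_top ?_)
      hI'.ne) hG.eLpNorm_ne_top
    refine ENNReal.rpow_ne_top_of_nonneg ?_ measure_ball_lt_top.ne
    rw [sub_nonneg, div_le_one (by linarith)]
    exact hq1'
  have hAle : A.toReal ≤ ε * N := by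
    rw [hAdef, ENNReal.toReal_mul, ENNReal.toReal_mul, ENNReal.toReal_mul,
      ENNReal.toReal_ofReal (mul_nonneg ((norm_nonneg _).trans (hκΘ 0)) (mul_pos hr.1 hR).le),
      ← ENNReal.toReal_rpow]
    exact mul_le_mul_of_nonneg_right (by rw [← mul_assoc] at *; exact hrε) ENNReal.toReal_nonneg
  -- The pointwise bound is deduced from its integrated form: the mean is bounded by `hU`, the
  -- deviation from the mean by `main`.
  refine ae_abs_le_of_integral_le hW hu.locallyIntegrable fun ψ h1 h2 h3 h4 => ?_
  have main := hw.enorm_integral_sub_le hu hGm h1 h2 h3 hκs.continuous hκc κ₀.integral_normed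
    hcone hA
  have iψ : Integrable ψ volume := h1.continuous.integrable_of_hasCompactSupport h2
  have e1 : ∫⁻ x, ‖ψ x‖ₑ = ENNReal.ofReal (∫ x, ψ x) := by
    rw [ofReal_integral_eq_lintegral_ofReal iψ (Eventually.of_forall h4)]
    exact lintegral_congr fun x => Real.enorm_of_nonneg (h4 x)
  rw [e1, ← ofReal_norm, ← ENNReal.ofReal_toReal hAfin, ← ENNReal.ofReal_mul
    ENNReal.toReal_nonneg, ENNReal.ofReal_le_ofReal_iff (mul_nonneg ENNReal.toReal_nonneg
      (integral_nonneg h4)), Real.norm_eq_abs] at main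
  have h5 : |∫ x, ψ x * ∫ y, u y * κ (y - x)| ≤ (ε * (∫ y, |u y|) + S) * ∫ x, ψ x := by
    rw [← integral_const_mul]
    refine (abs_integral_le_integral_abs).trans (integral_mono_of_nonneg
        (Eventually.of_forall fun y => abs_nonneg _) (iψ.const_mul _)
        (Eventually.of_forall fun x => ?_))
    simp only [abs_mul, abs_of_nonneg (h4 x)]
    by_cases hx : ψ x = 0
    · simp [hx]
    · rw [mul_comm]
      gcongr
      · exact h4 x
      · exact hU x (h3 (subset_tsupport _ hx))
  have h6 := abs_sub_abs_le_abs_sub (∫ y, u y * ψ y) (∫ x, ψ x * ∫ y, u y * κ (y - x))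
  rw [abs_sub_comm] at h6
  have h7 := mul_le_mul_of_nonneg_right hAle (integral_nonneg (μ := volume) h4)
  have h8 : (ε * (N + ∫ y, |u y|) + S) * ∫ x, ψ x =
    ε * N * (∫ x, ψ x) + (ε * (∫ y, |u y|) + S) * ∫ x, ψ x := by ring
  rw [h8]
  linarith

end MorreyLocal

/-! ### Cone property and the estimate on the whole domain -/

section MorreyGlobal

variable {d : ℕ} {Ω : Set (Vec d)}

/-- The uniform interior cone property. -/
theorem IsBoundedLipschitzDomain.exists_cone (hΩ : IsBoundedLipschitzDomain Ω) {x₀ : Vec d}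
    (hx₀ : x₀ ∈ closure Ω) :
    ∃ (δ : ℝ) (z : Vec d) (ρ : ℝ), 0 < δ ∧ 0 < ρ ∧ ∀ x ∈ Metric.ball x₀ δ ∩ Ω,
      ∀ b ∈ Metric.ball z ρ, ∀ s ∈ Icc (0 : ℝ) 1, x + s • b ∈ Ω := by
  by_cases h0 : x₀ ∈ Ω
  · obtain ⟨r, hr, hrΩ⟩ := Metric.isOpen_iff.1 hΩ.1 x₀ h0
    refine ⟨r / 2, 0, r / 2, half_pos hr, half_pos hr, fun x hx b hb s hs => hrΩ ?_⟩
    rw [mem_ball_zero_iff] at hb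
    have h1 := Metric.mem_ball.1 hx.1
    rw [dist_eq_norm] at h1
    rw [Metric.mem_ball, dist_eq_norm, add_sub_right_comm]
    have h2 : ‖s • b‖ ≤ ‖b‖ := by
      rw [norm_smul, Real.norm_of_nonneg hs.1]
      exact mul_le_of_le_one_left (norm_nonneg _) hs.2
    linarith [norm_add_le (x - x₀) (s • b)]
  · have hfr : x₀ ∈ frontier Ω := ⟨hx₀, fun h => h0 (interior_subset h)⟩
    obtain ⟨e, he, U, hU, hxU, γ, L, hγ, hiff⟩ := hΩ.2.2.2 x₀ hfr
    obtain ⟨r, hr, hrU⟩ := Metric.isOpen_iff.1 hU x₀ hxU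
    set δ := r / 2 with hδ
    have hδ0 : 0 < δ := half_pos hr
    -- Chosen so that `(2L + 2) ρ = δ / 2`: a tilt `c` of size below `ρ` leaves the component along
    -- `e` at least `L` times the transversal one, and `ρ ≤ δ / 4` keeps the cone inside `U`.
    set ρ := δ / (2 * (2 * (L : ℝ) + 2)) with hρ
    have hL0 : (0 : ℝ) ≤ L := L.2
    have hρ0 : 0 < ρ := by positivity
    have hρδ : (2 * (L : ℝ) + 2) * ρ = δ / 2 := by
      rw [hρ]
      field_simp
    refine ⟨δ, (δ / 2) • e, ρ, hδ0, hρ0, fun x hx b hb s hs => ?_⟩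
    set c := b - (δ / 2) • e with hc
    have hcn : ‖c‖ < ρ := by
      rw [Metric.mem_ball, dist_eq_norm] at hb
      exact hb
    have hbc : b = (δ / 2) • e + c := by rw [hc]; abel
    have hee : ⟪e, e⟫ = 1 := by rw [real_inner_self_eq_norm_sq, he, one_pow]
    have hbe : ⟪b, e⟫ = δ / 2 + ⟪c, e⟫ := by
      rw [hbc, inner_add_left, real_inner_smul_left, hee, mul_one]
    have hce : |⟪c, e⟫| ≤ ‖c‖ := by
      have := abs_real_inner_le_norm c e
      rwa [he, mul_one] at this
    have hperp : ‖b - ⟪b, e⟫ • e‖ ≤ 2 * ‖c‖ := by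
      have : b - ⟪b, e⟫ • e = c - ⟪c, e⟫ • e := by
        rw [hbe, hbc, add_smul]
        abel
      rw [this]
      refine (norm_sub_le _ _).trans ?_
      rw [norm_smul, he, mul_one, Real.norm_eq_abs]
      linarith
    have hbn : ‖b‖ ≤ δ / 2 + ‖c‖ := by
      rw [hbc]
      refine (norm_add_le _ _).trans ?_
      rw [norm_smul, he, mul_one, Real.norm_of_nonneg (by positivity)]
    have hsb : ‖s • b‖ ≤ ‖b‖ := by
      rw [norm_smul, Real.norm_of_nonneg hs.1]
      exact mul_le_of_le_one_left (norm_nonneg _) hs.2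
    have hx1 : ‖x - x₀‖ < δ := by
      rw [← dist_eq_norm]
      exact hx.1
    have hxU' : x ∈ U := hrU (by
      rw [Metric.mem_ball, dist_eq_norm]
      linarith)
    have hxbU : x + s • b ∈ U := hrU (by
      rw [Metric.mem_ball, dist_eq_norm, add_sub_right_comm]
      nlinarith [norm_add_le (x - x₀) (s • b)])
    rw [hiff _ hxbU]
    have h1 := (hiff x hxU').1 hx.2
    have h2 := hγ.dist_le_mul (x + s • b - ⟪x + s • b, e⟫ • e) (x - ⟪x, e⟫ • e)
    have h3 : x + s • b - ⟪x + s • b, e⟫ • e - (x - ⟪x, e⟫ • e) = s • (b - ⟪b, e⟫ • e) := by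
      rw [inner_add_left, real_inner_smul_left, add_smul, smul_sub, smul_smul]
      abel
    rw [Real.dist_eq, dist_eq_norm, h3, norm_smul, Real.norm_of_nonneg hs.1] at h2
    have h7 : ⟪x + s • b, e⟫ = ⟪x, e⟫ + s * ⟪b, e⟫ := by
      rw [inner_add_left, real_inner_smul_left]
    have h4 := (abs_le.1 h2).2
    -- Along `b` the height grows at least as fast as the Lipschitz graph can, so the strict
    -- epigraph is not left.
    have h5 : (L : ℝ) * ‖b - ⟪b, e⟫ • e‖ ≤ ⟪b, e⟫ := by
      have : (L : ℝ) * ‖b - ⟪b, e⟫ • e‖ ≤ L * (2 * ‖c‖) := by gcongr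
      have := (abs_le.1 hce).1
      nlinarith
    have h6 := mul_le_mul_of_nonneg_left h5 hs.1
    linarith

/-- A function on a bounded Lipschitz domain with gradient in `L^q`, `q > d`, is controlled
pointwise by finitely many of its moments and a small multiple of its Sobolev norm. -/
theorem IsBoundedLipschitzDomain.exists_kernels (hΩ : IsBoundedLipschitzDomain Ω) {q : ℝ≥0∞}
    (hq1 : 1 ≤ q) (hdq : (d : ℝ≥0∞) < q) (hq : q ≠ ⊤) {ε : ℝ} (hε : 0 < ε) :
    ∃ K : Finset (Vec d → ℝ), (∀ κ ∈ K, Continuous κ ∧ HasCompactSupport κ) ∧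
      ∀ (u : Vec d → ℝ) (G : Vec d → Vec d), Integrable u volume → Measurable G →
        MemLp G q volume → IsScalarWeakGrad Ω u G → ∀ᵐ x, x ∈ Ω →
          |u x| ≤ ε * ((eLpNorm G q volume).toReal + ∫ y, |u y|) + ∑ κ ∈ K, |∫ y, κ y * u y| := by
  classical
  have main : ∃ K : Finset (Vec d → ℝ), (∀ κ ∈ K, Continuous κ ∧ HasCompactSupport κ) ∧
      ∀ (u : Vec d → ℝ) (G : Vec d → Vec d), Integrable u volume → Measurable G →
        MemLp G q volume → IsScalarWeakGrad Ω u G → ∀ᵐ x, x ∈ closure Ω ∩ Ω →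
          |u x| ≤ ε * ((eLpNorm G q volume).toReal + ∫ y, |u y|) +
            ∑ κ ∈ K, |∫ y, κ y * u y| := by
    -- The closure is covered by finitely many balls with a cone each. Uniting the sets of kernels
    -- only increases the sum of moments, so the estimate is stable under unions.
    refine IsCompact.induction_on (hΩ.2.2.1.isCompact_closure) (p := fun S =>
      ∃ K : Finset (Vec d → ℝ), (∀ κ ∈ K, Continuous κ ∧ HasCompactSupport κ) ∧
      ∀ (u : Vec d → ℝ) (G : Vec d → Vec d), Integrable u volume → Measurable G →
        MemLp G q volume → IsScalarWeakGrad Ω u G → ∀ᵐ x, x ∈ S ∩ Ω →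
          |u x| ≤ ε * ((eLpNorm G q volume).toReal + ∫ y, |u y|) +
            ∑ κ ∈ K, |∫ y, κ y * u y|) ?_ ?_ ?_ ?_
    · exact ⟨∅, by simp, fun u G _ _ _ _ => Eventually.of_forall fun x hx => hx.1.elim⟩
    · rintro s t hst ⟨K, hK, h⟩
      refine ⟨K, hK, fun u G h1 h2 h3 h4 => ?_⟩
      filter_upwards [h u G h1 h2 h3 h4] with x hx hxs
      exact hx ⟨hst hxs.1, hxs.2⟩
    · rintro s t ⟨K, hK, h⟩ ⟨K', hK', h'⟩
      refine ⟨K ∪ K', fun κ hκ => (Finset.mem_union.1 hκ).elim (hK κ) (hK' κ),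
        fun u G h1 h2 h3 h4 => ?_⟩
      filter_upwards [h u G h1 h2 h3 h4, h' u G h1 h2 h3 h4] with x hx hx' hxs
      have e1 : ∑ κ ∈ K, |∫ y, κ y * u y| ≤ ∑ κ ∈ K ∪ K', |∫ y, κ y * u y| :=
        Finset.sum_le_sum_of_subset_of_nonneg Finset.subset_union_left fun _ _ _ => abs_nonneg _
      have e2 : ∑ κ ∈ K', |∫ y, κ y * u y| ≤ ∑ κ ∈ K ∪ K', |∫ y, κ y * u y| :=
        Finset.sum_le_sum_of_subset_of_nonneg Finset.subset_union_right fun _ _ _ => abs_nonneg _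
      rcases hxs.1 with hxs1 | hxs1
      · linarith [hx ⟨hxs1, hxs.2⟩]
      · linarith [hx' ⟨hxs1, hxs.2⟩]
    · intro x₀ hx₀
      obtain ⟨δ, z, ρ, hδ, hρ, hc⟩ := hΩ.exists_cone hx₀
      refine ⟨Metric.ball x₀ δ, nhdsWithin_le_nhds (Metric.ball_mem_nhds x₀ hδ), ?_⟩
      exact exists_kernels_local hq1 hdq hq (Metric.isOpen_ball.inter hΩ.1)
        (hΩ.2.2.1.subset inter_subset_right) hρ hc hε
  obtain ⟨K, hK, h⟩ := main
  refine ⟨K, hK, fun u G h1 h2 h3 h4 => ?_⟩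
  filter_upwards [h u G h1 h2 h3 h4] with x hx hxs
  exact hx ⟨subset_closure hxs, hxs⟩

theorem sum_smul_basisVec (b : Vec d) : ∑ j : Fin d, b j • basisVec d j = b := by
  ext i
  simp [basisVec, Finset.sum_apply, Pi.single_apply]

theorem norm_le_sum_abs {ι : Type*} [Fintype ι] (x : EuclideanSpace ℝ ι) :
    ‖x‖ ≤ ∑ i, |x i| := by
  classical
  have : x = ∑ i, EuclideanSpace.single i (x i) := by
    ext j
    simp [Finset.sum_apply]
  conv_lhs => rw [this]
  refine (norm_sum_le _ _).trans (le_of_eq ?_)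
  simp

theorem abs_coord_le_norm {ι : Type*} [Fintype ι] (x : EuclideanSpace ℝ ι) (i : ι) :
    |x i| ≤ ‖x‖ := by
  simpa using PiLp.norm_apply_le x i

/-- Extension by zero turns a component into a function on the whole space. No differentiability
across the boundary is claimed, as test functions stay inside `Ω`. -/
theorem IsWeakGrad.exists_scalar (hΩ : IsOpen Ω) {ι : Type*} [Fintype ι] {q : ℝ≥0∞}
    {U : Vec d → EuclideanSpace ℝ ι} {H : Vec d → EuclideanSpace ℝ (ι × Fin d)}
    (hU : Integrable U (volume.restrict Ω))
    (hHi : Integrable H (volume.restrict Ω))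
    (hH : MemLp H q (volume.restrict Ω)) (h : IsWeakGrad Ω U H) (i : ι) :
    ∃ (G : Vec d → Vec d), Measurable G ∧ MemLp G q volume ∧
      eLpNorm G q volume ≤ eLpNorm H q (volume.restrict Ω) ∧
      IsScalarWeakGrad Ω (Ω.indicator fun x => U x i) G := by
  have hmΩ := hΩ.measurableSet
  set H₀ : Vec d → Vec d := fun x => WithLp.toLp 2 fun j => H x (i, j) with hH₀
  have hle : ∀ x, ‖H₀ x‖ ≤ ‖H x‖ := by
    intro x
    refine le_of_sq_le_sq ?_ (norm_nonneg _)
    rw [EuclideanSpace.norm_sq_eq, EuclideanSpace.norm_sq_eq, Fintype.sum_prod_type]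
    exact Finset.single_le_sum (f := fun i => ∑ j, ‖H x (i, j)‖ ^ 2)
      (fun i _ => Finset.sum_nonneg fun j _ => sq_nonneg _) (Finset.mem_univ i)
  have hmeas : AEStronglyMeasurable H₀ (volume.restrict Ω) := by
    have hc : Continuous fun y : EuclideanSpace ℝ (ι × Fin d) =>
        (WithLp.toLp 2 fun j => y (i, j) : Vec d) :=
      (PiLp.continuous_toLp 2 _).comp (continuous_pi fun j =>
        (EuclideanSpace.proj (𝕜 := ℝ) (i, j)).continuous)
    exact hc.comp_aestronglyMeasurable hH.1
  have hm0 : MemLp H₀ q (volume.restrict Ω) :=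
    hH.of_le hmeas (Eventually.of_forall hle)
  have hi0 : Integrable H₀ (volume.restrict Ω) :=
    hHi.mono hmeas (Eventually.of_forall hle)
  set G : Vec d → Vec d := Ω.indicator (hmeas.mk H₀) with hG
  have hae : H₀ =ᵐ[volume.restrict Ω] hmeas.mk H₀ := hmeas.ae_eq_mk
  have eN : eLpNorm G q volume = eLpNorm H₀ q (volume.restrict Ω) := by
    rw [hG, eLpNorm_indicator_eq_eLpNorm_restrict hmΩ]
    exact (eLpNorm_congr_ae hae).symm
  have hGm : Measurable G := hmeas.stronglyMeasurable_mk.measurable.indicator hmΩ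
  refine ⟨G, hGm, ⟨hGm.aestronglyMeasurable, ?_⟩, ?_, ?_⟩
  · rw [eN]
    exact hm0.2
  · rw [eN]
    exact eLpNorm_mono hle
  · intro φ h1 h2 h3 b
    obtain ⟨C, hC⟩ := h1.continuous.bounded_above_of_compact_support h2
    have hfs : ∀ j, Integrable (fun x => fderiv ℝ φ x (basisVec d j) * U x i)
        (volume.restrict Ω) := by
      intro j
      obtain ⟨C', hC'⟩ := (continuous_partial h1 j).bounded_above_of_compact_support
        (hasCompactSupport_partial h2 j)
      exact (integrable_coord hU i).bdd_mul (continuous_partial h1 j).aestronglyMeasurable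
        (Eventually.of_forall hC')
    have hgs : ∀ j, Integrable (fun x => φ x * H x (i, j)) (volume.restrict Ω) := fun j =>
      (integrable_coord hHi (i, j)).bdd_mul h1.continuous.aestronglyMeasurable
        (Eventually.of_forall hC)
    have e1 : ∫ x, fderiv ℝ φ x b * Ω.indicator (fun x => U x i) x =
        ∑ j : Fin d, b j * ∫ x in Ω, fderiv ℝ φ x (basisVec d j) * U x i := by
      simp only [← integral_const_mul]
      rw [← integral_finsetSum _ fun j _ => (hfs j).const_mul _, ← integral_indicator hmΩ]
      refine integral_congr_ae (Eventually.of_forall fun x => ?_)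
      by_cases hx : x ∈ Ω
      · simp only [indicator_of_mem hx]
        conv_lhs => rw [← sum_smul_basisVec b, map_sum, Finset.sum_mul]
        exact Finset.sum_congr rfl fun j _ => by
          rw [map_smul, smul_eq_mul, mul_assoc]
      · simp [indicator_of_notMem hx]
    have e2 : ∫ x, φ x * ⟪G x, b⟫ = ∑ j : Fin d, b j * ∫ x in Ω, φ x * H x (i, j) := by
      simp only [← integral_const_mul]
      rw [← integral_finsetSum _ fun j _ => (hgs j).const_mul _, ← integral_indicator hmΩ]
      refine integral_congr_ae ?_
      filter_upwards [(ae_restrict_iff' hmΩ).1 hae] with x hx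
      by_cases hxΩ : x ∈ Ω
      · simp only [hG, indicator_of_mem hxΩ]
        rw [← hx hxΩ, PiLp.inner_apply, Finset.mul_sum]
        exact Finset.sum_congr rfl fun j _ => by
          simp [hH₀]
          ring
      · simp [hG, indicator_of_notMem hxΩ]
    rw [e1, e2, ← Finset.sum_neg_distrib]
    refine Finset.sum_congr rfl fun j _ => ?_
    rw [h φ h1 h2 h3 i j]
    ring

/-- The vector-valued form of the embedding. -/
theorem IsBoundedLipschitzDomain.exists_kernels_vector (hΩ : IsBoundedLipschitzDomain Ω)
    (ι : Type*) [Fintype ι] {q : ℝ≥0∞}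
    (hq1 : 1 ≤ q) (hdq : (d : ℝ≥0∞) < q) (hq : q ≠ ⊤) {ε : ℝ} (hε : 0 < ε) :
    ∃ K : Finset (Vec d → ℝ), (∀ κ ∈ K, Continuous κ ∧ HasCompactSupport κ) ∧
      ∀ (U : Vec d → EuclideanSpace ℝ ι) (H : Vec d → EuclideanSpace ℝ (ι × Fin d)),
        MemLp U q (volume.restrict Ω) → MemLp H q (volume.restrict Ω) → IsWeakGrad Ω U H →
        ∀ᵐ x ∂volume.restrict Ω, ‖U x‖ ≤ ε * ((eLpNorm H q (volume.restrict Ω)).toReal +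
          ∫ y in Ω, ‖U y‖) + ∑ i, ∑ κ ∈ K, |∫ y in Ω, κ y * U y i| := by
  have := isFiniteMeasure_restrict hΩ
  have hmΩ := hΩ.1.measurableSet
  -- Summation over the coordinates multiplies the small factor by their number; adding one keeps
  -- `n` positive for empty `ι`.
  set n : ℝ := (Fintype.card ι : ℝ) + 1 with hn
  have hn0 : 0 < n := by positivity
  obtain ⟨K, hK, hKb⟩ := hΩ.exists_kernels hq1 hdq hq (div_pos hε hn0)
  refine ⟨K, hK, fun U H hU hH h => ?_⟩
  have hUi : Integrable U (volume.restrict Ω) := hU.integrable hq1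
  have hHi : Integrable H (volume.restrict Ω) := hH.integrable hq1
  set N := (eLpNorm H q (volume.restrict Ω)).toReal + ∫ y in Ω, ‖U y‖ with hN
  have key : ∀ i : ι, ∀ᵐ x ∂volume.restrict Ω,
      |U x i| ≤ ε / n * N + ∑ κ ∈ K, |∫ y in Ω, κ y * U y i| := by
    intro i
    obtain ⟨G, hGm, hG, hGH, hw⟩ := h.exists_scalar hΩ.1 hUi hHi hH i
    have hui : Integrable (Ω.indicator fun x => U x i) volume :=
      (integrable_indicator_iff hmΩ).2 (integrable_coord hUi i)
    rw [ae_restrict_iff' hmΩ]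
    filter_upwards [hKb _ G hui hGm hG hw] with x hx hxΩ
    have h1 := hx hxΩ
    rw [indicator_of_mem hxΩ] at h1
    refine h1.trans (add_le_add ?_ (Finset.sum_le_sum fun κ _ => le_of_eq ?_))
    · refine mul_le_mul_of_nonneg_left (add_le_add
        (ENNReal.toReal_mono hH.eLpNorm_ne_top hGH) ?_) (by positivity)
      · rw [← integral_indicator hmΩ]
        refine integral_mono hui.abs ((integrable_indicator_iff hmΩ).2 hUi.norm) fun y => ?_
        by_cases hy : y ∈ Ω
        · simp only [indicator_of_mem hy]
          exact abs_coord_le_norm _ _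
        · simp [indicator_of_notMem hy]
    · rw [← integral_indicator hmΩ]
      congr 1
      refine integral_congr_ae (Eventually.of_forall fun y => ?_)
      by_cases hy : y ∈ Ω
      · simp [indicator_of_mem hy]
      · simp [indicator_of_notMem hy]
  have hN0 : 0 ≤ N := add_nonneg ENNReal.toReal_nonneg (integral_nonneg fun _ => norm_nonneg _)
  filter_upwards [eventually_countable_forall.2 key] with x hx
  refine (norm_le_sum_abs _).trans ((Finset.sum_le_sum fun i _ => hx i).trans ?_)
  rw [Finset.sum_add_distrib, Finset.sum_const, Finset.card_univ, nsmul_eq_mul]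
  refine add_le_add_left ?_ _
  have : (Fintype.card ι : ℝ) * (ε / n * N) = (Fintype.card ι : ℝ) / n * (ε * N) := by ring
  rw [this]
  refine mul_le_of_le_one_left (by positivity) ?_
  rw [div_le_one hn0]
  linarith

end MorreyGlobal

/-! ### The space `H^1_{0,σ} ∩ W^{2,p}` -/

section VSpace

variable {d : ℕ} {Ω : Set (Vec d)} {p : ℝ≥0∞}

theorem toReal_eLpNorm_le [IsFiniteMeasure ((volume : Measure (Vec d)).restrict Ω)] {F : Type}
    [NormedAddCommGroup F] {q : ℝ≥0∞} (hq : 1 ≤ q) (hqp : q ≤ p) (f : LpΩ Ω F p) :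
    (eLpNorm f q (volume.restrict Ω)).toReal ≤
      ((volume.restrict Ω) (univ : Set (Vec d)) ^ (1 / q.toReal - 1 / p.toReal)).toReal * ‖f‖ := by
  have h := eLpNorm_le_eLpNorm_mul_rpow_measure_univ (μ := volume.restrict Ω) hqp (Lp.memLp f).1
  have hexp : 0 ≤ 1 / q.toReal - 1 / p.toReal := by
    rcases eq_or_ne p ⊤ with rfl | hp
    · simp
    · have hq1 : 1 ≤ q.toReal := by
        have := ENNReal.toReal_mono (ne_top_of_le_ne_top hp hqp) hq
        simpa using this
      have := ENNReal.toReal_mono hp hqp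
      exact sub_nonneg.2 (one_div_le_one_div_of_le (by linarith) this)
  have hfin : (volume.restrict Ω) (univ : Set (Vec d)) ^ (1 / q.toReal - 1 / p.toReal) ≠ ⊤ :=
    ENNReal.rpow_ne_top_of_nonneg hexp (measure_ne_top _ _)
  have h2 := ENNReal.toReal_mono (ENNReal.mul_ne_top (Lp.memLp f).eLpNorm_ne_top hfin) h
  rw [ENNReal.toReal_mul, mul_comm, ← Lp.norm_def] at h2
  exact h2

/-- The moment `f ↦ ∫ κ f_i` as a functional on `L^p`. -/
theorem exists_moment [IsFiniteMeasure ((volume : Measure (Vec d)).restrict Ω)] {ι : Type}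
    [Fintype ι] [hp : Fact (1 ≤ p)] {κ : Vec d → ℝ} (hκ : Continuous κ)
    (hκc : HasCompactSupport κ) (i : ι) :
    ∃ Λ : LpΩ Ω (EuclideanSpace ℝ ι) p →L[ℝ] ℝ, ∀ f, Λ f = ∫ y in Ω, κ y * f y i := by
  obtain ⟨C, hC⟩ := hκ.bounded_above_of_compact_support hκc
  have hC0 : 0 ≤ C := (norm_nonneg _).trans (hC 0)
  have hint := fun f : LpΩ Ω (EuclideanSpace ℝ ι) p => integrable_mul_coord hp.out f hκ hκc i
  refine ⟨LinearMap.mkContinuous ⟨⟨fun f => ∫ y in Ω, κ y * f y i, fun f g => ?_⟩, fun c f => ?_⟩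
    (C * ((volume.restrict Ω) (univ : Set (Vec d)) ^
      (1 / (1 : ℝ≥0∞).toReal - 1 / p.toReal)).toReal) fun f => ?_, fun f => rfl⟩
  · rw [← integral_add (hint f) (hint g)]
    refine integral_congr_ae ?_
    filter_upwards [Lp.coeFn_add f g] with y hy
    rw [hy, Pi.add_apply, PiLp.add_apply, mul_add]
  · rw [RingHom.id_apply, smul_eq_mul, ← integral_const_mul]
    refine integral_congr_ae ?_
    filter_upwards [Lp.coeFn_smul c f] with y hy
    rw [hy, Pi.smul_apply, PiLp.smul_apply, smul_eq_mul]
    ring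
  · change ‖∫ y in Ω, κ y * f y i‖ ≤ _
    have hf : Integrable f (volume.restrict Ω) := integrable_of_Lp hp.out f
    calc _ ≤ ∫ y in Ω, C * ‖f y‖ := by
          refine (norm_integral_le_integral_norm _).trans (integral_mono (hint f).norm
            (hf.norm.const_mul C) fun y => ?_)
          rw [norm_mul]
          gcongr
          · exact hC y
          · exact PiLp.norm_apply_le _ _
      _ = C * (eLpNorm f 1 (volume.restrict Ω)).toReal := by
          rw [integral_const_mul, integral_norm_eq_lintegral_enorm hf.1,
            eLpNorm_one_eq_lintegral_enorm]
      _ ≤ _ := by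
          rw [mul_assoc]
          exact mul_le_mul_of_nonneg_left (toReal_eLpNorm_le le_rfl hp.out f) hC0

/-- The Morrey estimate is scaled with a finite exponent, whereas `p = ∞` is allowed; on a bounded
domain the exponent may be lowered. -/
theorem exists_exponent (hp1 : 1 ≤ p) (hp : (d : ℝ≥0∞) < p) :
    ∃ q : ℝ≥0∞, 1 ≤ q ∧ (d : ℝ≥0∞) < q ∧ q ≠ ⊤ ∧ q ≤ p := by
  refine ⟨min p (d + 1), le_min hp1 le_add_self, lt_min hp ?_, ?_, min_le_left _ _⟩
  · exact ENNReal.lt_add_right (by simp) one_ne_zero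
  · exact ne_top_of_le_ne_top (by simp) (min_le_right _ _)

/-- On a set of finite measure the `L^q` and `L¹` norms are bounded by the `L^p` norm, and the
moments against the kernels are continuous on `L^p`; dividing `ε` by the embedding constants
restores it. -/
theorem exists_functionals (hΩ : IsBoundedLipschitzDomain Ω) {ι : Type} [Fintype ι]
    [hp1 : Fact (1 ≤ p)] (hp : (d : ℝ≥0∞) < p) {ε : ℝ} (hε : 0 < ε) :
    ∃ (m : Type) (_ : Fintype m) (Λ : m → LpΩ Ω (EuclideanSpace ℝ ι) p →L[ℝ] ℝ),
      ∀ (f : LpΩ Ω (EuclideanSpace ℝ ι) p) (g : LpΩ Ω (EuclideanSpace ℝ (ι × Fin d)) p),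
        IsWeakGrad Ω f g → ∀ᵐ x ∂volume.restrict Ω, ‖f x‖ ≤ ε * (‖f‖ + ‖g‖) + ∑ k, |Λ k f| := by
  classical
  have := isFiniteMeasure_restrict hΩ
  obtain ⟨q, hq1, hdq, hq, hqp⟩ := exists_exponent hp1.out hp
  set c1 := ((volume.restrict Ω) (univ : Set (Vec d)) ^ (1 / q.toReal - 1 / p.toReal)).toReal
  set c2 := ((volume.restrict Ω) (univ : Set (Vec d)) ^
    (1 / (1 : ℝ≥0∞).toReal - 1 / p.toReal)).toReal
  set c := max c1 c2 + 1 with hc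
  have hc1 : 0 ≤ c1 := ENNReal.toReal_nonneg
  have hc0 : 0 < c := by linarith [le_max_left c1 c2]
  obtain ⟨K, hK, hKb⟩ := hΩ.exists_kernels_vector ι hq1 hdq hq (div_pos hε hc0)
  choose Λ hΛ using fun (κ : K) (i : ι) =>
    exists_moment (Ω := Ω) (p := p) (hK κ.1 κ.2).1 (hK κ.1 κ.2).2 i
  refine ⟨ι × K, inferInstance, fun r => Λ r.2 r.1, fun f g hfg => ?_⟩
  have hf := (Lp.memLp f).mono_exponent hqp
  have hg := (Lp.memLp g).mono_exponent hqp
  filter_upwards [hKb f g hf hg hfg] with x hx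
  refine hx.trans (add_le_add ?_ ?_)
  · have hfi : Integrable f (volume.restrict Ω) := integrable_of_Lp hp1.out f
    have h1 := toReal_eLpNorm_le hq1 hqp g
    have h2 := toReal_eLpNorm_le le_rfl hp1.out f
    have h3 : ∫ y in Ω, ‖f y‖ = (eLpNorm f 1 (volume.restrict Ω)).toReal := by
      rw [integral_norm_eq_lintegral_enorm hfi.1, eLpNorm_one_eq_lintegral_enorm]
    have h4 : c1 * ‖g‖ ≤ c * ‖g‖ := by
      gcongr
      linarith [le_max_left c1 c2]
    have h5 : c2 * ‖f‖ ≤ c * ‖f‖ := by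
      gcongr
      linarith [le_max_right c1 c2]
    rw [h3]
    calc _ ≤ ε / c * (c * ‖g‖ + c * ‖f‖) := by
          refine mul_le_mul_of_nonneg_left ?_ (div_pos hε hc0).le
          linarith
      _ = _ := by
          field_simp
          ring
  · rw [Fintype.sum_prod_type]
    refine Finset.sum_le_sum fun i _ => ?_
    rw [← Finset.sum_coe_sort K]
    exact le_of_eq (Finset.sum_congr rfl fun κ _ => by rw [hΛ κ i])

/-- The essential supremum of the gradient. -/
def VSpace.gradSup [Fact (1 ≤ p)] (x : VSpace Ω p) : ℝ :=
  (eLpNorm (x : (LpΩ Ω (Vec d) 2 × LpΩ Ω (Mat d) 2) × (LpΩ Ω (Vec d) p × LpΩ Ω (Mat d) p ×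
    LpΩ Ω (Ten d) p)).2.2.1 ∞ (volume.restrict Ω)).toReal

/-- The quantity that controls the action of the momentum equation on `x`. -/
def VSpace.size [Fact (1 ≤ p)] (x : VSpace Ω p) : ℝ :=
  ‖(x : (LpΩ Ω (Vec d) 2 × LpΩ Ω (Mat d) 2) × (LpΩ Ω (Vec d) p × LpΩ Ω (Mat d) p ×
    LpΩ Ω (Ten d) p)).1‖ + VSpace.gradSup x

theorem VSpace.grad_ae_eq (hΩ : IsBoundedLipschitzDomain Ω) [hp1 : Fact (1 ≤ p)]
    (x : VSpace Ω p) : x.1.1.2 =ᵐ[volume.restrict Ω] x.1.2.2.1 := by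
  have := isFiniteMeasure_restrict hΩ
  have h1 : IsWeakGrad Ω x.1.1.1 x.1.1.2 := H10_le_W1 (H10sigma_le_H10 x.2.1)
  have h2 : IsWeakGrad Ω x.1.2.1 x.1.2.2.1 := x.2.2.1.1
  exact h1.unique hΩ.1 (h2.congr x.2.2.2.symm (EventuallyEq.refl _ _))
    (integrable_of_Lp (by norm_num) _) (integrable_of_Lp hp1.out _)

/-- The inclusion into `L^p`. -/
def VSpace.toLp [Fact (1 ≤ p)] : VSpace Ω p →L[ℝ] LpΩ Ω (Vec d) p :=
  (ContinuousLinearMap.fst ℝ _ _).comp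
    ((ContinuousLinearMap.snd ℝ _ _).comp (VSpace Ω p).subtypeL)

/-- The gradient, as an element of `L^p`. -/
def VSpace.gradLp [Fact (1 ≤ p)] : VSpace Ω p →L[ℝ] LpΩ Ω (Mat d) p :=
  (ContinuousLinearMap.fst ℝ _ _).comp ((ContinuousLinearMap.snd ℝ _ _).comp
    ((ContinuousLinearMap.snd ℝ _ _).comp (VSpace Ω p).subtypeL))

theorem VSpace.size_le_of_bound (hΩ : IsBoundedLipschitzDomain Ω) [hp1 : Fact (1 ≤ p)]
    (x : VSpace Ω p) {A B : ℝ} (hA0 : 0 ≤ A) (hB0 : 0 ≤ B)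
    (b1 : ∀ᵐ y ∂volume.restrict Ω, ‖x.1.2.1 y‖ ≤ A)
    (b2 : ∀ᵐ y ∂volume.restrict Ω, ‖x.1.2.2.1 y‖ ≤ B) :
    VSpace.size x ≤ ((measureUnivNNReal ((volume : Measure (Vec d)).restrict Ω) : ℝ) ^
      ((2 : ℝ≥0∞).toReal)⁻¹ + 1) * (A + B) := by
  have := isFiniteMeasure_restrict hΩ
  set s : ℝ := (measureUnivNNReal ((volume : Measure (Vec d)).restrict Ω) : ℝ) ^
    ((2 : ℝ≥0∞).toReal)⁻¹ with hs
  have hs0 : 0 ≤ s := by positivity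
  have c1 : ‖x.1.1.1‖ ≤ s * A := by
    refine Lp.norm_le_of_ae_bound hA0 ?_
    filter_upwards [b1, x.2.2.2] with y h1 h2
    rw [h2]
    exact h1
  have c2 : ‖x.1.1.2‖ ≤ s * B := by
    refine Lp.norm_le_of_ae_bound hB0 ?_
    filter_upwards [b2, VSpace.grad_ae_eq hΩ x] with y h1 h2
    rw [h2]
    exact h1
  have c3 : VSpace.gradSup x ≤ B := by
    rw [VSpace.gradSup, eLpNorm_exponent_top]
    refine ENNReal.toReal_le_of_le_ofReal hB0 ?_
    exact eLpNormEssSup_le_of_ae_bound b2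
  have c4 : ‖x.1.1‖ ≤ s * A + s * B := by
    rw [Prod.norm_def]
    have := mul_nonneg hs0 hA0
    have := mul_nonneg hs0 hB0
    exact max_le (c1.trans (by linarith)) (c2.trans (by linarith))
  rw [VSpace.size]
  have d5 : (s + 1) * (A + B) = s * A + s * B + A + B := by ring
  linarith

theorem exists_sum_functionals {E F₁ F₂ : Type*} [NormedAddCommGroup E] [NormedSpace ℝ E]
    [NormedAddCommGroup F₁] [NormedSpace ℝ F₁] [NormedAddCommGroup F₂] [NormedSpace ℝ F₂]
    (π₁ : E →L[ℝ] F₁) (π₂ : E →L[ℝ] F₂) {m₁ m₂ : Type} [Fintype m₁] [Fintype m₂]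
    (Λ₁ : m₁ → F₁ →L[ℝ] ℝ) (Λ₂ : m₂ → F₂ →L[ℝ] ℝ) {c : ℝ} (hc : 0 ≤ c) :
    ∃ (m : Type) (_ : Fintype m) (Λ : m → StrongDual ℝ E),
      ∀ x, ∑ k, |Λ k x| = c * (∑ k, |Λ₁ k (π₁ x)| + ∑ k, |Λ₂ k (π₂ x)|) := by
  refine ⟨m₁ ⊕ m₂, inferInstance, Sum.elim (fun k => c • (Λ₁ k).comp π₁)
    (fun k => c • (Λ₂ k).comp π₂), fun x => ?_⟩
  rw [Fintype.sum_sum_type]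
  simp [abs_mul, abs_of_nonneg hc, ← Finset.mul_sum, mul_add]

theorem quarter_sum_le {F₀ F₁ F₂ F₃ : Type*} [NormedAddCommGroup F₀] [NormedAddCommGroup F₁]
    [NormedAddCommGroup F₂] [NormedAddCommGroup F₃] (x : F₀ × F₁ × F₂ × F₃) {ε c S₁ S₂ : ℝ}
    (hε : 0 < ε) (hc : 0 ≤ c) :
    c * (ε / 4 * (‖x.2.1‖ + ‖x.2.2.1‖) + S₁ + (ε / 4 * (‖x.2.2.1‖ + ‖x.2.2.2‖) + S₂)) ≤
      c * (ε * ‖x‖) + c * (S₁ + S₂) := by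
  have n1 : ‖x.2‖ ≤ ‖x‖ := le_max_right _ _
  have n2 : ‖x.2.1‖ ≤ ‖x‖ := (le_max_left _ _).trans n1
  have n3 : ‖x.2.2‖ ≤ ‖x‖ := (le_max_right _ _).trans n1
  have n4 : ‖x.2.2.1‖ ≤ ‖x‖ := (le_max_left _ _).trans n3
  have n5 : ‖x.2.2.2‖ ≤ ‖x‖ := (le_max_right _ _).trans n3
  rw [← mul_add]
  refine mul_le_mul_of_nonneg_left ?_ hc
  have e1 := mul_le_mul_of_nonneg_left (add_le_add n2 n4) (by positivity : 0 ≤ ε / 4)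
  have e2 := mul_le_mul_of_nonneg_left (add_le_add n4 n5) (by positivity : 0 ≤ ε / 4)
  linarith

theorem quarter_nonneg {ε a b : ℝ} (hε : 0 < ε) (ha : 0 ≤ a) (hb : 0 ≤ b) {m : Type} [Fintype m]
    (f : m → ℝ) : 0 ≤ ε / 4 * (a + b) + ∑ k, |f k| :=
  add_nonneg (by positivity) (Finset.sum_nonneg fun _ _ => abs_nonneg _)

/-- The embedding is used for `(u, ∇u)` and again for `(∇u, ∇²u)`. The bounds `A` and `B` are kept
as witnesses because they serve both the Ehrling inequality and the membership in `W^{1,∞}`; the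
factor `c` is absorbed into the functionals. -/
theorem VSpace.exists_bound (hΩ : IsBoundedLipschitzDomain Ω) [hp1 : Fact (1 ≤ p)]
    (hp : (d : ℝ≥0∞) < p) {ε : ℝ} (hε : 0 < ε) {c : ℝ} (hc : 0 ≤ c) :
    ∃ (m : Type) (_ : Fintype m) (Λ : m → StrongDual ℝ (VSpace Ω p)),
      ∀ x : VSpace Ω p, ∃ A B : ℝ, 0 ≤ A ∧ 0 ≤ B ∧
        (∀ᵐ y ∂volume.restrict Ω, ‖x.1.2.1 y‖ ≤ A) ∧
        (∀ᵐ y ∂volume.restrict Ω, ‖x.1.2.2.1 y‖ ≤ B) ∧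
        c * (A + B) ≤ c * (ε * ‖x‖) + ∑ k, |Λ k x| := by
  have hε4 : 0 < ε / 4 := by positivity
  refine (exists_functionals hΩ (ι := Fin d) hp hε4).elim fun m₁ h => h.elim fun i₁ h =>
    h.elim fun Λ₁ h₁ => ?_
  refine (exists_functionals hΩ (ι := Fin d × Fin d) hp hε4).elim fun m₂ h => h.elim fun i₂ h =>
    h.elim fun Λ₂ h₂ => ?_
  refine (exists_sum_functionals (VSpace.toLp (Ω := Ω) (p := p)) VSpace.gradLp Λ₁ Λ₂ hc).elim
    fun m h => h.elim fun i h => h.elim fun Λ hΛ => ?_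
  refine ⟨m, i, Λ, fun x => ⟨ε / 4 * (‖x.1.2.1‖ + ‖x.1.2.2.1‖) + ∑ k, |Λ₁ k x.1.2.1|,
    ε / 4 * (‖x.1.2.2.1‖ + ‖x.1.2.2.2‖) + ∑ k, |Λ₂ k x.1.2.2.1|,
    quarter_nonneg hε (norm_nonneg _) (norm_nonneg _) _,
    quarter_nonneg hε (norm_nonneg _) (norm_nonneg _) _,
    h₁ x.1.2.1 x.1.2.2.1 x.2.2.1.1, h₂ x.1.2.2.1 x.1.2.2.2 x.2.2.1.2, ?_⟩⟩
  exact (quarter_sum_le x.1 hε hc).trans_eq (congrArg _ (hΛ x).symm)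

/-- An Ehrling inequality, the quantitative form of the compact embedding of `W^{2,p}` into
`W^{1,∞}` for `p > d`. The `H^1` part of `size` is bounded by sup norms because `Ω` has finite
volume. -/
theorem VSpace.size_le (hΩ : IsBoundedLipschitzDomain Ω) [hp1 : Fact (1 ≤ p)]
    (hp : (d : ℝ≥0∞) < p) {ε : ℝ} (hε : 0 < ε) :
    ∃ (m : Type) (_ : Fintype m) (Λ : m → StrongDual ℝ (VSpace Ω p)),
      ∀ x : VSpace Ω p, VSpace.size x ≤ ε * ‖x‖ + ∑ k, |Λ k x| := by
  have key : ∀ s : ℝ, 0 < s → (∀ (x : VSpace Ω p) (A B : ℝ), 0 ≤ A → 0 ≤ B →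
      (∀ᵐ y ∂volume.restrict Ω, ‖x.1.2.1 y‖ ≤ A) → (∀ᵐ y ∂volume.restrict Ω, ‖x.1.2.2.1 y‖ ≤ B) →
      VSpace.size x ≤ s * (A + B)) →
      ∃ (m : Type) (_ : Fintype m) (Λ : m → StrongDual ℝ (VSpace Ω p)),
        ∀ x : VSpace Ω p, VSpace.size x ≤ ε * ‖x‖ + ∑ k, |Λ k x| := by
    intro s hs hsize
    have cancel : ∀ N S : ℝ, s * (ε / s * N) + S = ε * N + S := fun N S => by
      rw [← mul_assoc, mul_div_cancel₀ _ hs.ne']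
    refine (VSpace.exists_bound hΩ hp (div_pos hε hs) hs.le).elim fun m h =>
      h.elim fun i h => h.elim fun Λ h => ⟨m, i, Λ, fun x => ?_⟩
    refine (h x).elim fun A h => h.elim fun B h => ?_
    exact ((hsize x A B h.1 h.2.1 h.2.2.1 h.2.2.2.1).trans h.2.2.2.2).trans_eq
      (cancel ‖x‖ _)
  exact key _ (by positivity) fun x A B hA hB h1 h2 => VSpace.size_le_of_bound hΩ x hA hB h1 h2

/-- The functions of `H^1_{0,σ} ∩ W^{2,p}` belong to `W^{1,∞}`. -/
theorem VSpace.exists_bounded (hΩ : IsBoundedLipschitzDomain Ω) [hp1 : Fact (1 ≤ p)]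
    (hp : (d : ℝ≥0∞) < p) (x : VSpace Ω p) :
    ∃ (c : LpΩ Ω (Vec d) ∞) (G : LpΩ Ω (Mat d) ∞), IsWeakGrad Ω c G ∧
      x.1.1.1 =ᵐ[volume.restrict Ω] c ∧ x.1.1.2 =ᵐ[volume.restrict Ω] G ∧
      ‖G‖ = VSpace.gradSup x := by
  obtain ⟨m, _, Λ, h⟩ := VSpace.exists_bound hΩ hp one_pos zero_le_one
  obtain ⟨A, B, -, -, b1, b2, -⟩ := h x
  have h1 : MemLp x.1.2.1 ∞ (volume.restrict Ω) := memLp_top_of_bound (Lp.memLp _).1 _ b1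
  have h2 : MemLp x.1.2.2.1 ∞ (volume.restrict Ω) := memLp_top_of_bound (Lp.memLp _).1 _ b2
  refine ⟨h1.toLp _, h2.toLp _, ?_, ?_, ?_, ?_⟩
  · exact x.2.2.1.1.congr h1.coeFn_toLp.symm h2.coeFn_toLp.symm
  · exact x.2.2.2.trans h1.coeFn_toLp.symm
  · exact (VSpace.grad_ae_eq hΩ x).trans h2.coeFn_toLp.symm
  · rw [Lp.norm_toLp, VSpace.gradSup]

/-- Constant test paths must be in `L²(0,T; H²)` if `ν > 0`; here `p > d ≥ 2` enters. -/
theorem VSpace.exists_W2_two (hΩ : IsBoundedLipschitzDomain Ω) [hp1 : Fact (1 ≤ p)]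
    (hp : 2 ≤ p) (x : VSpace Ω p) : ∃ h : W2 Ω 2, h.1.1 = x.1.1.1 := by
  have := isFiniteMeasure_restrict hΩ
  have h1 := (Lp.memLp x.1.2.1).mono_exponent hp
  have h2 := (Lp.memLp x.1.2.2.1).mono_exponent hp
  have h3 := (Lp.memLp x.1.2.2.2).mono_exponent hp
  refine ⟨⟨(h1.toLp _, h2.toLp _, h3.toLp _), ?_, ?_⟩, ?_⟩
  · exact x.2.2.1.1.congr h1.coeFn_toLp.symm h2.coeFn_toLp.symm
  · exact x.2.2.1.2.congr h2.coeFn_toLp.symm h3.coeFn_toLp.symm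
  · exact Lp.ext (h1.coeFn_toLp.trans x.2.2.2.symm)

end VSpace

/-! ### Weak time derivatives of paths in a dual space -/

section DualPath

variable {V : Type*} [NormedAddCommGroup V] [NormedSpace ℝ V] {T : ℝ}

theorem intervalIntegrable_of_timeMeasure {E : Type*} [NormedAddCommGroup E] {γ : ℝ → E}
    (hγ : Integrable γ (timeMeasure T)) {s t : ℝ} (hs : 0 ≤ s) (hst : s ≤ t) (ht : t ≤ T) :
    IntervalIntegrable γ volume s t := by
  rw [intervalIntegrable_iff_integrableOn_Ioo_of_le hst]
  exact IntegrableOn.mono_set hγ (Ioo_subset_Ioo hs ht)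

/-- The increments are dominated by those of the primitive of `γ`, which is absolutely continuous.
-/
theorem absolutelyContinuousOnInterval_of_le_integral (hT : 0 ≤ T) {f γ : ℝ → ℝ} {c : ℝ}
    (hγ : Integrable γ (timeMeasure T))
    (h : ∀ s t, 0 ≤ s → s ≤ t → t ≤ T → |f t - f s| ≤ c * ∫ r in s..t, γ r) :
    AbsolutelyContinuousOnInterval f 0 T := by
  have hi := intervalIntegrable_of_timeMeasure hγ le_rfl hT le_rfl
  have hΓ := (hi.absolutelyContinuousOnInterval_intervalIntegral (c := 0) (by simp)).const_mul c
  have key : ∀ s ∈ Icc 0 T, ∀ t ∈ Icc 0 T, dist (f s) (f t) ≤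
      dist (c * ∫ r in (0 : ℝ)..s, γ r) (c * ∫ r in (0 : ℝ)..t, γ r) := by
    have main : ∀ s ∈ Icc 0 T, ∀ t ∈ Icc 0 T, s ≤ t → dist (f s) (f t) ≤
        dist (c * ∫ r in (0 : ℝ)..s, γ r) (c * ∫ r in (0 : ℝ)..t, γ r) := by
      intro s hs t ht hst
      rw [dist_comm, dist_comm (c * _), Real.dist_eq, Real.dist_eq, ← mul_sub,
        intervalIntegral.integral_interval_sub_left
          (intervalIntegrable_of_timeMeasure hγ le_rfl ht.1 ht.2)
          (intervalIntegrable_of_timeMeasure hγ le_rfl hs.1 hs.2)]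
      exact (h s t hs.1 hst ht.2).trans (le_abs_self _)
    intro s hs t ht
    rcases le_total s t with hst | hst
    · exact main s hs t ht hst
    · rw [dist_comm, dist_comm (c * _)]
      exact main t ht s hs hst
  refine squeeze_zero' (Eventually.of_forall fun E => Finset.sum_nonneg fun _ _ => dist_nonneg)
    ?_ hΓ
  filter_upwards [mem_inf_of_right (mem_principal_self _)] with E hE
  refine Finset.sum_le_sum fun i hi => ?_
  have := hE.1 i hi
  rw [uIcc_of_le hT] at this
  exact key _ this.1 _ this.2

/-- An Ehrling inequality makes the unit ball totally bounded for `size`. -/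
theorem exists_finite_net {size : V → ℝ}
    (hE : ∀ ε > 0, ∃ (m : Type) (_ : Fintype m) (Λ : m → StrongDual ℝ V),
      ∀ x, size x ≤ ε * ‖x‖ + ∑ k, |Λ k x|) {ε : ℝ} (hε : 0 < ε) :
    ∃ N : Set V, N.Finite ∧ ∀ x, ‖x‖ ≤ 1 → ∃ y ∈ N, size (x - y) ≤ ε := by
  obtain ⟨m, _, Λ, h⟩ := hE (ε / 4) (by positivity)
  set π : V →L[ℝ] (m → ℝ) := ContinuousLinearMap.pi Λ with hπ
  have hb : Bornology.IsBounded (π '' Metric.closedBall 0 1) :=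
    π.lipschitz.isBounded_image Metric.isBounded_closedBall
  have htb : TotallyBounded (π '' Metric.closedBall 0 1) :=
    hb.isCompact_closure.totallyBounded.subset subset_closure
  -- Two points of the unit ball are at distance at most `2`, so the norm term uses `ε / 2`; the
  -- functionals together use at most the other half.
  set δ : ℝ := ε / (2 * (Fintype.card m + 1)) with hδ
  obtain ⟨N', hN', hfin, hcov⟩ := Metric.finite_approx_of_totallyBounded htb δ (by positivity)
  choose! g hg using fun z (hz : z ∈ N') => hN' hz
  refine ⟨g '' N', hfin.image g, fun x hx => ?_⟩
  have hx' : x ∈ Metric.closedBall (0 : V) 1 := by simpa using hx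
  obtain ⟨z, hz, hxz⟩ := mem_iUnion₂.1 (hcov (mem_image_of_mem π hx'))
  refine ⟨g z, mem_image_of_mem g hz, (h _).trans ?_⟩
  have hgz : ‖g z‖ ≤ 1 := by simpa using (hg z hz).1
  have hn : ‖x - g z‖ ≤ 2 := (norm_sub_le _ _).trans (by linarith)
  have hsum : ∑ k, |Λ k (x - g z)| ≤ ∑ _k : m, δ := by
    refine Finset.sum_le_sum fun k _ => ?_
    have h1 : dist (π x k) (z k) ≤ dist (π x) z := dist_le_pi_dist _ _ _
    rw [← (hg z hz).2, Real.dist_eq] at h1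
    have h2 : dist (π x) (π (g z)) < δ := by rw [(hg z hz).2]; exact hxz
    rw [map_sub]
    exact h1.trans h2.le
  have hcard : ∑ _k : m, δ ≤ ε / 2 := by
    rw [Finset.sum_const, Finset.card_univ, nsmul_eq_mul, hδ, mul_div_assoc',
      div_le_div_iff₀ (by positivity) (by norm_num)]
    nlinarith
  nlinarith

/-- The functionals are equicontinuous for `size`, with constants `a k ≤ A`, and the unit ball has
finite nets for `size`. Convergence at the net points is therefore uniform on the ball, which is
convergence in the dual norm. -/
theorem cauchySeq_of_net {size : V → ℝ} {N : ℕ → Set V} (hfin : ∀ n, (N n).Finite)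
    (hN : ∀ n x, ‖x‖ ≤ 1 → ∃ y ∈ N n, size (x - y) ≤ 1 / ((n : ℝ) + 1))
    {q : ℕ → StrongDual ℝ V} {a : ℕ → ℝ} {A : ℝ} (ha0 : ∀ k, 0 ≤ a k) (hA : ∀ k, a k ≤ A)
    (hq : ∀ k x, |q k x| ≤ size x * a k)
    (hc : ∀ n, ∀ y ∈ N n, CauchySeq fun k => q k y) : CauchySeq q := by
  have hA0 : 0 ≤ A := (ha0 0).trans (hA 0)
  rw [Metric.cauchySeq_iff]
  intro ε hε
  obtain ⟨n, hn⟩ := exists_nat_one_div_lt (show 0 < ε / (8 * (A + 1)) by positivity)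
  have hev : ∀ y ∈ N n, ∃ K, ∀ j ≥ K, ∀ k ≥ K, dist (q j y) (q k y) < ε / 4 := fun y hy =>
    Metric.cauchySeq_iff.1 (hc n y hy) (ε / 4) (by positivity)
  choose! K hK using hev
  obtain ⟨K₀, hK₀⟩ := ((hfin n).image K).bddAbove
  refine ⟨K₀, fun j hj k hk => ?_⟩
  rw [dist_eq_norm]
  refine lt_of_le_of_lt (ContinuousLinearMap.opNorm_le_of_unit_norm (C := ε / 2) (by positivity)
    fun x hx => ?_) (by linarith)
  obtain ⟨y, hy, hxy⟩ := hN n x hx.le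
  have hKy : K y ≤ K₀ := hK₀ (mem_image_of_mem K hy)
  have h1 := hK y hy j (hKy.trans hj) k (hKy.trans hk)
  rw [Real.dist_eq] at h1
  have h2 : ∀ k, |q k (x - y)| ≤ ε / 8 := fun k => by
    refine (hq k _).trans ?_
    calc size (x - y) * a k ≤ 1 / ((n : ℝ) + 1) * A :=
          mul_le_mul hxy (hA k) (ha0 k) (by positivity)
      _ ≤ ε / (8 * (A + 1)) * (A + 1) := by gcongr; linarith
      _ = ε / 8 := by field_simp
  have e : (q j - q k) x = q j (x - y) - q k (x - y) + (q j y - q k y) := by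
    simp only [sub_apply, map_sub]
    ring
  rw [e, Real.norm_eq_abs]
  have := abs_add_le (q j (x - y) - q k (x - y)) (q j y - q k y)
  have := abs_sub (q j (x - y)) (q k (x - y))
  linarith [h2 j, h2 k]

theorem tendsto_forward_slope {f : ℝ → ℝ} {f' t : ℝ} (h : HasDerivAt f f' t) :
    Tendsto (fun k : ℕ => ((k : ℝ) + 1) * (f (t + 1 / ((k : ℝ) + 1)) - f t)) atTop (𝓝 f') := by
  have h1 := h.tendsto_slope_zero
  have h2 : Tendsto (fun k : ℕ => 1 / ((k : ℝ) + 1)) atTop (𝓝[≠] 0) :=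
    tendsto_nhdsWithin_iff.2 ⟨tendsto_one_div_add_atTop_nhds_zero_nat,
      Eventually.of_forall fun k => by simp; positivity⟩
  refine (h1.comp h2).congr fun k => ?_
  simp

theorem integral_smul_eq_of_absolutelyContinuous (hT : 0 ≤ T) {f f' : ℝ → ℝ}
    (hf : AbsolutelyContinuousOnInterval f 0 T) (hf' : ∀ᵐ t ∂timeMeasure T, HasDerivAt f (f' t) t)
    {φ : ℝ → ℝ} (hφ : ContDiff ℝ ∞ φ) (hφT : tsupport φ ⊆ Ioo 0 T) :
    ∫ t, deriv φ t * f t ∂timeMeasure T = -∫ t, φ t * f' t ∂timeMeasure T := by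
  have hφ1 : ContDiff ℝ 1 φ := hφ.of_le (by exact_mod_cast le_top)
  have hg : AbsolutelyContinuousOnInterval φ 0 T :=
    hφ1.contDiffOn.absolutelyContinuousOnInterval
  have hz : ∀ t, t ∉ Ioo 0 T → φ t = 0 := fun t ht => image_eq_zero_of_notMem_tsupport
    fun h => ht (hφT h)
  have h := hf.integral_mul_deriv_eq_deriv_mul hg
  rw [hz T (by simp), hz 0 (by simp), intervalIntegral.integral_of_le hT,
    intervalIntegral.integral_of_le hT, integral_Ioc_eq_integral_Ioo,
    integral_Ioc_eq_integral_Ioo] at h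
  have e1 : ∫ t, deriv φ t * f t ∂timeMeasure T = ∫ t in Ioo 0 T, f t * deriv φ t :=
    integral_congr_ae (Eventually.of_forall fun t => mul_comm _ _)
  have e2 : ∫ t, φ t * f' t ∂timeMeasure T = ∫ t in Ioo 0 T, deriv f t * φ t := by
    refine integral_congr_ae ?_
    filter_upwards [hf'] with t ht
    rw [ht.deriv, mul_comm]
  rw [e1, e2, h]
  simp

/-- A path in a dual space whose increments are controlled by a seminorm that satisfies an Ehrling
inequality has a weak time derivative. -/
theorem exists_hasWeakTimeDeriv (hT : 0 < T) {size : V → ℝ}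
    (hE : ∀ ε > 0, ∃ (m : Type) (_ : Fintype m) (Λ : m → StrongDual ℝ V),
      ∀ x, size x ≤ ε * ‖x‖ + ∑ k, |Λ k x|)
    {c : ℝ} (hc : 0 ≤ c) (hsize : ∀ x, size x ≤ c * ‖x‖) {γ : ℝ → ℝ} (hγ0 : ∀ t, 0 ≤ γ t)
    (hγ : Integrable γ (timeMeasure T)) {u : ℝ → StrongDual ℝ V}
    (hu : ∀ s t, 0 ≤ s → s ≤ t → t ≤ T → ∀ x, |(u t - u s) x| ≤ size x * ∫ r in s..t, γ r) :
    ∃ u' : ℝ → StrongDual ℝ V, HasWeakTimeDeriv T u u' ∧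
      AEStronglyMeasurable u' (timeMeasure T) ∧ ∀ᵐ t ∂timeMeasure T, ‖u' t‖ ≤ c * γ t := by
  have hint : ∀ {s t : ℝ}, 0 ≤ s → s ≤ t → t ≤ T → IntervalIntegrable γ volume s t :=
    fun hs hst ht => intervalIntegrable_of_timeMeasure hγ hs hst ht
  have hnorm : ∀ s t, 0 ≤ s → s ≤ t → t ≤ T → ‖u t - u s‖ ≤ c * ∫ r in s..t, γ r := by
    intro s t hs hst ht
    have h0 : 0 ≤ ∫ r in s..t, γ r := intervalIntegral.integral_nonneg hst fun r _ => hγ0 r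
    refine ContinuousLinearMap.opNorm_le_bound _ (mul_nonneg hc h0) fun x => ?_
    calc _ ≤ _ := hu s t hs hst ht x
      _ ≤ (c * ‖x‖) * ∫ r in s..t, γ r := mul_le_mul_of_nonneg_right (hsize x) h0
      _ = _ := by ring
  set Γ : ℝ → ℝ := fun t => ∫ r in (0 : ℝ)..t, γ r with hΓ
  have hΓc : ContinuousOn Γ (Icc 0 T) := by
    have := intervalIntegral.continuousOn_primitive_interval' (hint le_rfl hT.le le_rfl)
      (left_mem_uIcc)
    rwa [uIcc_of_le hT.le] at this
  have hΓsub : ∀ {s t}, 0 ≤ s → s ≤ t → t ≤ T → ∫ r in s..t, γ r = Γ t - Γ s :=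
    fun {s t} hs hst ht => (intervalIntegral.integral_interval_sub_left
      (hint le_rfl (hs.trans hst) ht) (hint le_rfl hs (hst.trans ht))).symm
  have hdist : ∀ s ∈ Icc 0 T, ∀ t ∈ Icc 0 T, dist (u s) (u t) ≤ c * |Γ s - Γ t| := by
    intro s hs t ht
    rcases le_total s t with hst | hst
    · rw [dist_comm, dist_eq_norm, abs_sub_comm]
      refine (hnorm s t hs.1 hst ht.2).trans ?_
      rw [hΓsub hs.1 hst ht.2]
      gcongr
      exact le_abs_self _
    · rw [dist_eq_norm]
      refine (hnorm t s ht.1 hst hs.2).trans ?_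
      rw [hΓsub ht.1 hst hs.2]
      gcongr
      exact le_abs_self _
  have hucont : ContinuousOn u (Icc 0 T) := by
    intro t ht
    rw [ContinuousWithinAt, tendsto_iff_dist_tendsto_zero]
    have h1 : Tendsto (fun s => c * |Γ s - Γ t|) (𝓝[Icc 0 T] t) (𝓝 (c * |Γ t - Γ t|)) :=
      (((hΓc t ht).sub tendsto_const_nhds).abs).const_mul c
    rw [sub_self, abs_zero, mul_zero] at h1
    refine squeeze_zero' (Eventually.of_forall fun s => dist_nonneg) ?_ h1
    filter_upwards [self_mem_nhdsWithin] with s hs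
    exact hdist s hs t ht
  -- Freezing the path outside `[0, T]` makes the forward difference quotients continuous on the
  -- whole line, hence measurable.
  set U : ℝ → StrongDual ℝ V := fun t => u (projIcc 0 T hT.le t) with hU
  have hUcont : Continuous U :=
    hucont.comp_continuous (continuous_subtype_val.comp continuous_projIcc)
      fun t => (projIcc 0 T hT.le t).2
  have hUeq : ∀ t ∈ Icc 0 T, U t = u t := fun t ht => by
    simp only [hU, projIcc_of_mem hT.le ht]
  have hac : ∀ x, AbsolutelyContinuousOnInterval (fun t => U t x) 0 T := fun x =>
    absolutelyContinuousOnInterval_of_le_integral hT.le hγ fun s t hs hst ht => by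
      rw [hUeq s ⟨hs, hst.trans ht⟩, hUeq t ⟨hs.trans hst, ht⟩]
      exact hu s t hs hst ht x
  have hdiff : ∀ x, ∀ᵐ t ∂timeMeasure T, DifferentiableAt ℝ (fun t => U t x) t := by
    intro x
    rw [ae_timeMeasure_iff]
    filter_upwards [(hac x).ae_differentiableAt] with t ht h0
    exact ht (by rw [uIcc_of_le hT.le]; exact Ioo_subset_Icc_self h0)
  set Q : ℕ → ℝ → StrongDual ℝ V := fun k t =>
    ((k : ℝ) + 1) • (U (t + 1 / ((k : ℝ) + 1)) - U t) with hQ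
  have hQc : ∀ k, Continuous (Q k) := fun k => by
    simp only [hQ]
    fun_prop
  have hΓd : ∀ᵐ t ∂timeMeasure T, HasDerivAt Γ (γ t) t := by
    rw [ae_timeMeasure_iff]
    filter_upwards [(hint le_rfl hT.le le_rfl).ae_hasDerivAt_integral] with t ht h0
    exact ht (by rw [uIcc_of_le hT.le]; exact Ioo_subset_Icc_self h0) 0 left_mem_uIcc
  set a : ℝ → ℕ → ℝ := fun t k => ((k : ℝ) + 1) * (Γ (t + 1 / ((k : ℝ) + 1)) - Γ t) with ha
  have hQa : ∀ t ∈ Ioo 0 T, ∀ᶠ k in atTop, 0 ≤ a t k ∧ ∀ x, |Q k t x| ≤ size x * a t k := by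
    intro t ht
    have h1 : Tendsto (fun k : ℕ => 1 / ((k : ℝ) + 1)) atTop (𝓝 0) :=
      tendsto_one_div_add_atTop_nhds_zero_nat
    filter_upwards [h1.eventually (gt_mem_nhds (sub_pos.2 ht.2))] with k hk
    have hk0 : 0 < 1 / ((k : ℝ) + 1) := by positivity
    have hle : t ≤ t + 1 / ((k : ℝ) + 1) := by linarith
    have hleT : t + 1 / ((k : ℝ) + 1) ≤ T := by linarith
    have e := hΓsub ht.1.le hle hleT
    refine ⟨mul_nonneg (by positivity) ?_, fun x => ?_⟩
    · rw [← e]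
      exact intervalIntegral.integral_nonneg hle fun r _ => hγ0 r
    · have h2 := hu t _ ht.1.le hle hleT x
      rw [e] at h2
      have e2 : Q k t x = ((k : ℝ) + 1) * (u (t + 1 / ((k : ℝ) + 1)) - u t) x := by
        simp only [hQ]
        rw [hUeq t (Ioo_subset_Icc_self ht), hUeq _ ⟨ht.1.le.trans hle, hleT⟩]
        rfl
      rw [e2, abs_mul, abs_of_nonneg (by positivity : 0 ≤ (k : ℝ) + 1)]
      calc _ ≤ ((k : ℝ) + 1) * _ := mul_le_mul_of_nonneg_left h2 (by positivity)
        _ = _ := by simp only [ha]; ring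
  -- The union of these nets is countable, so one null set of times covers the differentiability of
  -- all the scalar paths that are needed.
  choose N hNfin hN using fun n : ℕ => exists_finite_net hE (show 0 < 1 / ((n : ℝ) + 1) by
    positivity)
  have hdiffN : ∀ᵐ t ∂timeMeasure T, ∀ n, ∀ y ∈ N n, DifferentiableAt ℝ (fun t => U t y) t :=
    ae_all_iff.2 fun n => (ae_ball_iff (hNfin n).countable).2 fun y _ => hdiff y
  have hslope : ∀ x t, DifferentiableAt ℝ (fun t => U t x) t →
      Tendsto (fun k => Q k t x) atTop (𝓝 (deriv (fun t => U t x) t)) := fun x t h =>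
    tendsto_forward_slope h.hasDerivAt
  have hlim : ∀ᵐ t ∂timeMeasure T, ∃ l, Tendsto (fun k => Q k t) atTop (𝓝 l) := by
    filter_upwards [hdiffN, hΓd, ae_restrict_mem measurableSet_Ioo] with t h1 h2 h3
    have hat : Tendsto (a t) atTop (𝓝 (γ t)) := tendsto_forward_slope h2
    obtain ⟨A, hA⟩ := hat.bddAbove_range
    obtain ⟨K, hK⟩ := eventually_atTop.1 (hQa t h3)
    have hsh : Tendsto (fun k : ℕ => k + K) atTop atTop := tendsto_add_atTop_nat K
    have hcs : CauchySeq fun k => Q (k + K) t :=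
      cauchySeq_of_net hNfin hN (a := fun k => a t (k + K)) (A := A)
        (fun k => (hK _ le_add_self).1) (fun k => hA (mem_range_self _))
        (fun k => (hK _ le_add_self).2)
        fun n y hy => ((hslope y t (h1 n y hy)).comp hsh).cauchySeq
    obtain ⟨l, hl⟩ := cauchySeq_tendsto_of_complete hcs
    exact ⟨l, (tendsto_add_atTop_iff_nat K).1 hl⟩
  -- Convergence in norm, not only pointwise on `V`, is what yields strong measurability of the
  -- derivative.
  obtain ⟨u', hu'm, hu'⟩ := exists_stronglyMeasurable_limit_of_tendsto_ae
    (fun k => (hQc k).aestronglyMeasurable) hlim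
  have hbound : ∀ᵐ t ∂timeMeasure T, ‖u' t‖ ≤ c * γ t := by
    filter_upwards [hu', hΓd, ae_restrict_mem measurableSet_Ioo] with t h1 h2 h3
    have hat : Tendsto (a t) atTop (𝓝 (γ t)) := tendsto_forward_slope h2
    refine le_of_tendsto_of_tendsto h1.norm (hat.const_mul c) ?_
    filter_upwards [hQa t h3] with k hk
    refine ContinuousLinearMap.opNorm_le_bound _ (mul_nonneg hc hk.1) fun x => ?_
    calc _ ≤ _ := hk.2 x
      _ ≤ (c * ‖x‖) * a t k := mul_le_mul_of_nonneg_right (hsize x) hk.1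
      _ = _ := by ring
  refine ⟨u', fun φ hφ hφc hφT => ?_, hu'm.aestronglyMeasurable, hbound⟩
  have hu'i : Integrable u' (timeMeasure T) :=
    (hγ.const_mul c).mono' hu'm.aestronglyMeasurable hbound
  have hφ'c : Continuous (deriv φ) := hφ.continuous_deriv (by simp)
  have i1 : Integrable (fun t => deriv φ t • U t) (timeMeasure T) :=
    ((hφ'c.smul hUcont).continuousOn.integrableOn_compact (isCompact_Icc (a := (0 : ℝ))
      (b := T))).mono_set Ioo_subset_Icc_self
  have i2 : Integrable (fun t => φ t • u' t) (timeMeasure T) := by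
    obtain ⟨C, hC⟩ := hφ.continuous.bounded_above_of_compact_support hφc
    exact hu'i.bdd_smul C hφ.continuous.aestronglyMeasurable (Eventually.of_forall hC)
  have e0 : ∫ t, deriv φ t • u t ∂timeMeasure T = ∫ t, deriv φ t • U t ∂timeMeasure T := by
    refine integral_congr_ae ?_
    filter_upwards [ae_restrict_mem measurableSet_Ioo] with t ht
    rw [hUeq t (Ioo_subset_Icc_self ht)]
  rw [e0]
  ext x
  rw [neg_apply, ContinuousLinearMap.integral_apply i1, ContinuousLinearMap.integral_apply i2]
  refine integral_smul_eq_of_absolutelyContinuous hT.le (hac x) ?_ hφ hφT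
  filter_upwards [hu', hdiff x] with t h1 h2
  have h3 : Tendsto (fun k => Q k t x) atTop (𝓝 (u' t x)) :=
    ((ContinuousLinearMap.apply ℝ ℝ x).continuous.tendsto _).comp h1
  exact h2.hasDerivAt.congr_deriv (tendsto_nhds_unique (hslope x t h2) h3)

end DualPath

/-! ### Weakly continuous representatives -/

section WeakExtension

variable {H : Type*} [NormedAddCommGroup H] [InnerProductSpace ℝ H]

/-- The uniform bound carries the Cauchy property from the dense set `D`, where continuity of `Γ`
provides it, to every `φ`. -/
theorem exists_tendsto_inner {L : Set ℝ} {v : ℝ → H} {M : ℝ} (hM : ∀ t ∈ L, ‖v t‖ ≤ M)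
    {D : Set H} (hD : Dense D) {Γ : ℝ → ℝ} {t : ℝ} (hne : (𝓝[L] t).NeBot)
    (hΓ : ContinuousWithinAt Γ L t)
    (h : ∀ y ∈ D, ∃ c, ∀ s ∈ L, ∀ r ∈ L, |⟪v r - v s, y⟫| ≤ c * |Γ r - Γ s|) (φ : H) :
    ∃ l, Tendsto (fun s => ⟪v s, φ⟫) (𝓝[L] t) (𝓝 l) := by
  obtain ⟨s₀, hs₀⟩ := hne.nonempty_of_mem self_mem_nhdsWithin
  have hM0 : 0 ≤ M := (norm_nonneg _).trans (hM s₀ hs₀)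
  refine cauchy_map_iff_exists_tendsto.1 (Metric.cauchy_iff.2 ⟨hne.map _, fun ε hε => ?_⟩)
  obtain ⟨y, hy, hφy⟩ := Metric.dense_iff.1 hD φ (ε / (4 * (M + 1))) (by positivity)
  obtain ⟨c, hc⟩ := h _ hφy
  have hφ : ‖φ - y‖ < ε / (4 * (M + 1)) := by
    rw [← dist_eq_norm, dist_comm]; exact hy
  have hU : ∀ᶠ s in 𝓝[L] t, dist (Γ s) (Γ t) < ε / (8 * (|c| + 1)) :=
    Metric.tendsto_nhds.1 hΓ _ (by positivity)
  refine ⟨_, image_mem_map (inter_mem hU self_mem_nhdsWithin), ?_⟩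
  rintro _ ⟨s, ⟨hs, hsL⟩, rfl⟩ _ ⟨r, ⟨hr, hrL⟩, rfl⟩
  rw [Real.dist_eq]
  have e : ⟪v s, φ⟫ - ⟪v r, φ⟫ = ⟪v s - v r, y⟫ + ⟪v s - v r, φ - y⟫ := by
    simp only [inner_sub_left, inner_sub_right]
    ring
  have h1 : |⟪v s - v r, y⟫| ≤ ε / 4 := by
    refine (hc r hrL s hsL).trans ?_
    have h2 : |Γ s - Γ r| ≤ 2 * (ε / (8 * (|c| + 1))) := by
      have := dist_triangle_right (Γ s) (Γ r) (Γ t)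
      rw [← Real.dist_eq]
      have hs' : dist (Γ s) (Γ t) < _ := hs
      have hr' : dist (Γ r) (Γ t) < _ := hr
      linarith
    calc c * |Γ s - Γ r| ≤ (|c| + 1) * (2 * (ε / (8 * (|c| + 1)))) :=
          mul_le_mul (by linarith [le_abs_self c]) h2 (abs_nonneg _) (by positivity)
      _ = ε / 4 := by field_simp; ring
  have h3 : |⟪v s - v r, φ - y⟫| ≤ ε / 2 := by
    refine (abs_real_inner_le_norm _ _).trans ?_
    have h4 : ‖v s - v r‖ ≤ 2 * (M + 1) := by
      refine (norm_sub_le _ _).trans ?_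
      linarith [hM s hsL, hM r hrL]
    calc _ ≤ 2 * (M + 1) * (ε / (4 * (M + 1))) := mul_le_mul h4 hφ.le (norm_nonneg _)
          (by positivity)
      _ = ε / 2 := by field_simp; ring
  rw [e]
  have := abs_add_le ⟪v s - v r, y⟫ ⟪v s - v r, φ - y⟫
  linarith

/-- The limits of `⟪v s, φ⟫` along `L` are linear in `φ` and bounded by `M ‖φ‖`, so by Riesz they
are pairings with a vector. -/
theorem exists_weak_extension [CompleteSpace H] {I L : Set ℝ} (hLI : L ⊆ I) (hIL : I ⊆ closure L)
    {v : ℝ → H} {M : ℝ} (hM0 : 0 ≤ M) (hM : ∀ t ∈ L, ‖v t‖ ≤ M) {D : Set H} (hD : Dense D)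
    {Γ : ℝ → ℝ} (hΓ : ContinuousOn Γ I)
    (h : ∀ y ∈ D, ∃ c, ∀ s ∈ L, ∀ r ∈ L, |⟪v r - v s, y⟫| ≤ c * |Γ r - Γ s|) :
    ∃ w : ℝ → H, EqOn w v L ∧ (∀ t ∈ I, ‖w t‖ ≤ M) ∧
      ∀ φ, ContinuousOn (fun t => ⟪w t, φ⟫) I := by
  classical
  have hne : ∀ t ∈ I, (𝓝[L] t).NeBot := fun t ht => mem_closure_iff_nhdsWithin_neBot.1 (hIL ht)
  have hlim : ∀ φ, ∀ t ∈ I, ∃ l, Tendsto (fun s => ⟪v s, φ⟫) (𝓝[L] t) (𝓝 l) := fun φ t ht =>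
    exists_tendsto_inner hM hD (hne t ht) ((hΓ t ht).mono hLI) h φ
  set g : H → ℝ → ℝ := fun φ => extendFrom L fun s => ⟪v s, φ⟫ with hg
  have hgt : ∀ φ, ∀ t ∈ I, Tendsto (fun s => ⟪v s, φ⟫) (𝓝[L] t) (𝓝 (g φ t)) := fun φ t ht =>
    tendsto_extendFrom (hlim φ t ht)
  have hex : ∀ t ∈ I, ∃ z : H, ‖z‖ ≤ M ∧ ∀ φ, ⟪z, φ⟫ = g φ t := by
    intro t ht
    have := hne t ht
    have hadd : ∀ φ ψ, g (φ + ψ) t = g φ t + g ψ t := fun φ ψ =>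
      tendsto_nhds_unique (hgt _ t ht) (((hgt φ t ht).add (hgt ψ t ht)).congr fun s =>
        (inner_add_right _ _ _).symm)
    have hsmul : ∀ (c : ℝ) φ, g (c • φ) t = c * g φ t := fun c φ =>
      tendsto_nhds_unique (hgt _ t ht) (((hgt φ t ht).const_mul c).congr fun s =>
        (real_inner_smul_right _ _ _).symm)
    have hbd : ∀ φ, ‖g φ t‖ ≤ M * ‖φ‖ := fun φ => by
      refine le_of_tendsto (hgt φ t ht).norm ?_
      filter_upwards [self_mem_nhdsWithin] with s hs
      exact (norm_inner_le_norm _ _).trans (mul_le_mul_of_nonneg_right (hM s hs) (norm_nonneg _))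
    set ℓ : StrongDual ℝ H := LinearMap.mkContinuous ⟨⟨fun φ => g φ t, hadd⟩, hsmul⟩ M hbd with hℓ
    refine ⟨(InnerProductSpace.toDual ℝ H).symm ℓ, ?_, fun φ => ?_⟩
    · rw [LinearIsometryEquiv.norm_map]
      exact LinearMap.mkContinuous_norm_le _ hM0 _
    · rw [InnerProductSpace.toDual_symm_apply]
      rfl
  choose! w hwM hw using hex
  refine ⟨w, fun t ht => ?_, hwM, fun φ => ?_⟩
  · refine ext_inner_right ℝ fun φ => ?_
    rw [hw t (hLI ht)]
    exact (tendsto_nhds_unique (tendsto_pure_nhds (fun s => ⟪v s, φ⟫) t)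
      ((hgt φ t (hLI ht)).mono_left (pure_le_nhdsWithin ht))).symm
  · exact (continuousOn_extendFrom hIL (hlim φ)).congr fun t ht => hw t ht φ

/-- A bounded path whose increments are controlled weakly has a weakly continuous
representative. -/
theorem exists_weaklyContinuous_representative [CompleteSpace H]
    [TopologicalSpace.SeparableSpace H] {T : ℝ} (hT : 0 < T) {v : ℝ → H} {v₀ : H} {M : ℝ}
    (hvm : AEStronglyMeasurable v (timeMeasure T)) (hM : ∀ᵐ t ∂timeMeasure T, ‖v t‖ ≤ M)
    (hM₀ : ‖v₀‖ ≤ M) {X : Type*} {j : X → H} (hj : DenseRange j) {size : X → ℝ} {Γ : ℝ → ℝ}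
    (hΓ : ContinuousOn Γ (Icc 0 T))
    (h : ∀ x, ∀ᵐ s ∂timeMeasure T, ∀ᵐ t ∂timeMeasure T, s < t →
      |⟪v t - v s, j x⟫| ≤ size x * (Γ t - Γ s))
    (h0 : ∀ x, ∀ᵐ t ∂timeMeasure T, |⟪v t - v₀, j x⟫| ≤ size x * (Γ t - Γ 0)) :
    ∃ w : ℝ → H, w 0 = v₀ ∧ w =ᵐ[timeMeasure T] v ∧ (∀ t ∈ Icc 0 T, ‖w t‖ ≤ M) ∧
      (∀ φ, ContinuousOn (fun t => ⟪w t, φ⟫) (Icc 0 T)) ∧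
      ∀ x s t, 0 ≤ s → s ≤ t → t ≤ T → |⟪w t - w s, j x⟫| ≤ size x * (Γ t - Γ s) := by
  have hM0 : 0 ≤ M := (norm_nonneg _).trans hM₀
  have : SecondCountableTopology H :=
    UniformSpace.secondCountable_of_separable H
  have hΓi : Integrable Γ (timeMeasure T) :=
    (hΓ.integrableOn_compact isCompact_Icc).mono_set Ioo_subset_Icc_self
  have hvi : ∀ y : H, Integrable (fun t => ⟪v t, y⟫) (timeMeasure T) := fun y =>
    (integrable_const (M * ‖y‖)).mono' (hvm.inner_const) (by
      filter_upwards [hM] with t ht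
      exact (norm_inner_le_norm _ _).trans (mul_le_mul_of_nonneg_right ht (norm_nonneg _)))
  -- The two-sided bound says that `±⟪v, j x⟫ - size x * Γ` both decrease; the exceptional set still
  -- depends on `x`.
  have hpair : ∀ x, ∃ L ⊆ Ioo 0 T, (∀ᵐ t ∂timeMeasure T, t ∈ L) ∧
      ∀ s ∈ L, ∀ t ∈ L, s ≤ t → |⟪v t - v s, j x⟫| ≤ size x * (Γ t - Γ s) := by
    intro x
    obtain ⟨L₁, h10, h1, h1'⟩ := exists_antitoneOn_of_ae
      (f := fun t => ⟪v t, j x⟫ - size x * Γ t) ((hvi _).sub (hΓi.const_mul _)) (by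
        filter_upwards [h x] with s hs
        filter_upwards [hs] with t ht hst
        have := (abs_le.1 (ht hst)).2
        rw [inner_sub_left] at this
        linarith)
    obtain ⟨L₂, h20, h2, h2'⟩ := exists_antitoneOn_of_ae
      (f := fun t => -⟪v t, j x⟫ - size x * Γ t) ((hvi _).neg.sub (hΓi.const_mul _)) (by
        filter_upwards [h x] with s hs
        filter_upwards [hs] with t ht hst
        have := (abs_le.1 (ht hst)).1
        rw [inner_sub_left] at this
        linarith)
    refine ⟨L₁ ∩ L₂, inter_subset_left.trans h10, h1.and h2, fun s hs t ht hst => ?_⟩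
    have a1 := h1' hs.1 ht.1 hst
    have a2 := h2' hs.2 ht.2 hst
    simp only at a1 a2
    rw [abs_le, inner_sub_left]
    constructor <;> linarith
  choose L hL0 hL hLb using hpair
  obtain ⟨D, hDc, hDd⟩ := TopologicalSpace.exists_countable_dense (range j)
  choose g hg using fun y : range j => y.2
  set S : Set X := g '' D with hS
  have hSc : S.Countable := hDc.image g
  have hSd : Dense (j '' S) := by
    have e : j '' S = Subtype.val '' D := by
      rw [hS, image_image]
      exact image_congr fun y _ => hg y
    rw [e]
    exact (Dense.denseRange_val hj).dense_image continuous_subtype_val hDd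
  -- Only the countable set `S`, with dense image, is used here, so that `A` keeps full measure. The
  -- time `0` is adjoined with the value `v₀`, which makes the extension continuous up to the
  -- initial value.
  set A : Set ℝ := insert 0 {t | t ∈ Ioo 0 T ∧ ‖v t‖ ≤ M ∧ ∀ x ∈ S, t ∈ L x ∧
    |⟪v t - v₀, j x⟫| ≤ size x * (Γ t - Γ 0)} with hA
  have hAae : ∀ᵐ t ∂timeMeasure T, t ∈ A ∧ t ∈ Ioo 0 T := by
    filter_upwards [hM, ae_restrict_mem measurableSet_Ioo, (ae_ball_iff hSc).2 fun x _ => hL x,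
      (ae_ball_iff hSc).2 fun x _ => h0 x] with t h1 h2 h3 h4
    exact ⟨Or.inr ⟨h2, h1, fun x hx => ⟨h3 x hx, h4 x hx⟩⟩, h2⟩
  have hAI : A ⊆ Icc 0 T := by
    rintro t (rfl | ht)
    · exact left_mem_Icc.2 hT.le
    · exact Ioo_subset_Icc_self ht.1
  have hIA : Icc 0 T ⊆ closure A := fun t ht => mem_closure_iff_nhdsWithin_neBot.2
    (neBot_nhdsWithin_Icc hT (hAae.mono fun t h => h.1) ht)
  set v' : ℝ → H := Function.update v 0 v₀ with hv'
  have hv'0 : v' 0 = v₀ := Function.update_self _ _ _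
  have hv'e : ∀ t, 0 < t → v' t = v t := fun t ht => Function.update_of_ne ht.ne' _ _
  have hle : ∀ x ∈ S, ∀ s ∈ A, ∀ t ∈ A, s ≤ t →
      |⟪v' t - v' s, j x⟫| ≤ size x * (Γ t - Γ s) := by
    rintro x hx s (rfl | hs) t (rfl | ht) hst
    · simp
    · rw [hv'0, hv'e t ht.1.1]
      exact (ht.2.2 x hx).2
    · exact absurd hs.1.1 (not_lt.2 hst)
    · rw [hv'e t ht.1.1, hv'e s hs.1.1]
      exact hLb x s (hs.2.2 x hx).1 t (ht.2.2 x hx).1 hst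
  obtain ⟨w, hwA, hwM, hwc⟩ := exists_weak_extension hAI hIA hM0 (v := v') (M := M) (by
    rintro t (rfl | ht)
    · rw [hv'0]; exact hM₀
    · rw [hv'e t ht.1.1]; exact ht.2.1) hSd hΓ (by
    rintro _ ⟨x, hx, rfl⟩
    refine ⟨|size x|, fun s hs t ht => ?_⟩
    rcases le_total s t with hst | hst
    · refine (hle x hx s hs t ht hst).trans ((le_abs_self _).trans_eq (abs_mul _ _))
    · rw [← neg_sub (v' s), inner_neg_left, abs_neg, abs_sub_comm (Γ t)]
      refine (hle x hx t ht s hs hst).trans ((le_abs_self _).trans_eq (abs_mul _ _)))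
  have hwv : w =ᵐ[timeMeasure T] v := by
    filter_upwards [hAae] with t ht
    rw [hwA ht.1, hv'e t ht.2.1]
  refine ⟨w, by rw [hwA (mem_insert _ _), hv'0], hwv, hwM, hwc, fun x s t hs hst ht => ?_⟩
  -- For arbitrary `x`, in `S` or not, the bound at all times follows from the almost everywhere one
  -- by continuity of `w` against `j x`.
  have m1 : AntitoneOn (fun t => ⟪w t, j x⟫ - size x * Γ t) (Icc 0 T) :=
    antitoneOn_Icc_of_ae hT ((hwc _).sub (hΓ.const_mul _)) (by
      filter_upwards [h x, hwv] with s hs es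
      filter_upwards [hs, hwv] with t ht et hst
      have := (abs_le.1 (ht hst)).2
      rw [inner_sub_left] at this
      rw [es, et]
      linarith)
  have m2 : AntitoneOn (fun t => -⟪w t, j x⟫ - size x * Γ t) (Icc 0 T) :=
    antitoneOn_Icc_of_ae hT ((hwc _).neg.sub (hΓ.const_mul _)) (by
      filter_upwards [h x, hwv] with s hs es
      filter_upwards [hs, hwv] with t ht et hst
      have := (abs_le.1 (ht hst)).1
      rw [inner_sub_left] at this
      rw [es, et]
      linarith)
  have a1 := m1 ⟨hs, hst.trans ht⟩ ⟨hs.trans hst, ht⟩ hst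
  have a2 := m2 ⟨hs, hst.trans ht⟩ ⟨hs.trans hst, ht⟩ hst
  simp only at a1 a2
  rw [abs_le, inner_sub_left]
  constructor <;> linarith

end WeakExtension

/-! ### Completeness and separability of `L²_σ` -/

section

variable {d : ℕ} {Ω : Set (Vec d)}

instance : CompleteSpace (L2sigma Ω) :=
  (Submodule.isClosed_topologicalClosure _).completeSpace_coe

instance : TopologicalSpace.SeparableSpace (L2sigma Ω) :=
  have : Fact ((2 : ℝ≥0∞) ≠ ⊤) := ⟨by simp⟩
  have : SecondCountableTopology (LpΩ Ω (Vec d) 2) := inferInstance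
  inferInstance

end

/-! ### Smooth paths -/

section SmoothPath

variable {d : ℕ} {Ω : Set (Vec d)} {T ν : ℝ}

theorem wgrad_ae_eq (hΩ : IsBoundedLipschitzDomain Ω) {u : LpΩ Ω (Vec d) 2}
    {c : LpΩ Ω (Vec d) ∞} {G : LpΩ Ω (Mat d) ∞} (h : IsWeakGrad Ω c G)
    (hu : u =ᵐ[volume.restrict Ω] c) : wgrad u =ᵐ[volume.restrict Ω] G := by
  have := isFiniteMeasure_restrict hΩ
  have hG : MemLp G 2 (volume.restrict Ω) := (Lp.memLp G).mono_exponent le_top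
  rw [wgrad_eq hΩ.1 (G := hG.toLp _) (h.congr hu.symm hG.coeFn_toLp.symm)]
  exact hG.coeFn_toLp

/-- Uniform continuity on `[0, T] × S` gives continuity in the sup norm, hence in every `L^q` over a
set of finite measure. -/
theorem continuousOn_Lp_of_continuousOn [IsFiniteMeasure ((volume : Measure (Vec d)).restrict Ω)]
    {E : Type} [NormedAddCommGroup E] {q : ℝ≥0∞} [Fact (1 ≤ q)] {F : ℝ → Vec d → E}
    (hF : ContinuousOn (fun z : ℝ × Vec d => F z.1 z.2) (Icc 0 T ×ˢ univ)) {S : Set (Vec d)}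
    (hS : IsCompact S) (hFS : ∀ t ∈ Icc 0 T, ∀ x ∉ S, F t x = 0) {u : ℝ → LpΩ Ω E q}
    (hu : ∀ t ∈ Icc 0 T, u t =ᵐ[volume.restrict Ω] F t) : ContinuousOn u (Icc 0 T) := by
  have huc := ((isCompact_Icc (a := (0 : ℝ)) (b := T)).prod hS).uniformContinuousOn_of_continuous
    (hF.mono (prod_mono subset_rfl (subset_univ _)))
  rw [Metric.uniformContinuousOn_iff] at huc
  set m : ℝ := (measureUnivNNReal ((volume : Measure (Vec d)).restrict Ω) : ℝ) ^ (q.toReal)⁻¹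
    with hm
  have hm0 : 0 ≤ m := by positivity
  rw [Metric.continuousOn_iff]
  intro t ht ε hε
  obtain ⟨δ, hδ, h⟩ := huc (ε / (2 * (m + 1))) (by positivity)
  refine ⟨δ, hδ, fun s hs hst => ?_⟩
  have key : ∀ x, ‖F s x - F t x‖ ≤ ε / (2 * (m + 1)) := fun x => by
    by_cases hx : x ∈ S
    · rw [← dist_eq_norm]
      refine (h (s, x) ⟨hs, hx⟩ (t, x) ⟨ht, hx⟩ ?_).le
      rw [Prod.dist_eq, dist_self, max_eq_left dist_nonneg]
      exact hst
    · rw [hFS s hs x hx, hFS t ht x hx, sub_zero, norm_zero]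
      positivity
  rw [dist_eq_norm]
  have hb : ‖u s - u t‖ ≤ m * (ε / (2 * (m + 1))) := by
    refine Lp.norm_le_of_ae_bound (by positivity) ?_
    filter_upwards [Lp.coeFn_sub (u s) (u t), hu s hs, hu t ht] with x h1 h2 h3
    rw [h1, Pi.sub_apply, h2, h3]
    exact key x
  refine hb.trans_lt ?_
  calc m * (ε / (2 * (m + 1))) ≤ (m + 1) * (ε / (2 * (m + 1))) := by gcongr; linarith
    _ = ε / 2 := by field_simp
    _ < ε := by linarith

theorem continuousOn_classicalGrad_path {Φ : ℝ → Vec d → Vec d}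
    (h : ContinuousOn (fun q : ℝ × Vec d => iteratedFDeriv ℝ 1 (Φ q.1) q.2)
      (Icc 0 T ×ˢ univ)) :
    ContinuousOn (fun q : ℝ × Vec d => classicalGrad (Φ q.1) q.2) (Icc 0 T ×ˢ univ) := by
  refine (PiLp.continuous_toLp 2 _).comp_continuousOn (continuousOn_pi.2 fun ij => ?_)
  have h2 := (EuclideanSpace.proj ij.1 : Vec d →L[ℝ] ℝ).continuous.comp_continuousOn
    ((ContinuousMultilinearMap.apply ℝ (fun _ : Fin 1 => Vec d) (Vec d)
      (fun _ => basisVec d ij.2)).continuous.comp_continuousOn h)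
  refine h2.congr fun q _ => ?_
  simp [iteratedFDeriv_one_apply]

theorem continuousOn_path {Φ : ℝ → Vec d → Vec d}
    (h : ContinuousOn (fun q : ℝ × Vec d => iteratedFDeriv ℝ 0 (Φ q.1) q.2)
      (Icc 0 T ×ˢ univ)) :
    ContinuousOn (fun q : ℝ × Vec d => Φ q.1 q.2) (Icc 0 T ×ˢ univ) := by
  refine ((ContinuousMultilinearMap.apply ℝ (fun _ : Fin 0 => Vec d) (Vec d)
      (fun _ => 0)).continuous.comp_continuousOn h).congr fun q _ => ?_
  simp

theorem memLp_of_continuousOn {E : Type*} [NormedAddCommGroup E] {u : ℝ → E}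
    (h : ContinuousOn u (Icc 0 T)) (q : ℝ≥0∞) : MemLp u q (timeMeasure T) := by
  have h1 : AEStronglyMeasurable u (timeMeasure T) :=
    (h.mono Ioo_subset_Icc_self).aestronglyMeasurable measurableSet_Ioo
  obtain ⟨C, hC⟩ := isCompact_Icc.exists_bound_of_continuousOn h
  refine MemLp.of_bound h1 C ?_
  filter_upwards [ae_restrict_mem measurableSet_Ioo] with t ht
  exact hC t (Ioo_subset_Icc_self ht)

theorem memLp_classicalGrad {φ : Vec d → Vec d} (h : IsTestField Ω φ) (q : ℝ≥0∞) :
    MemLp (classicalGrad φ) q (volume.restrict Ω) :=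
  ((continuous_classicalGrad h.1).memLp_of_hasCompactSupport
    h.hasCompactSupport_classicalGrad).restrict _

theorem memLp_testField {φ : Vec d → Vec d} (h : IsTestField Ω φ) (q : ℝ≥0∞) :
    MemLp φ q (volume.restrict Ω) :=
  (h.1.continuous.memLp_of_hasCompactSupport h.2.1).restrict _

/-- A test field with its gradient, as an element of `H^1_{0,σ}`. -/
theorem mem_H10sigma {φ : Vec d → Vec d} (h : IsSolTestField Ω φ)
    {u : LpΩ Ω (Vec d) 2 × LpΩ Ω (Mat d) 2} (h1 : u.1 =ᵐ[volume.restrict Ω] φ)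
    (h2 : u.2 =ᵐ[volume.restrict Ω] classicalGrad φ) : u ∈ H10sigma Ω :=
  Submodule.le_topologicalClosure _ (Submodule.subset_span ⟨φ, h, h1, h2⟩)

theorem mem_L2sigma {φ : Vec d → Vec d} (h : IsSolTestField Ω φ)
    {u : LpΩ Ω (Vec d) 2} (h1 : u =ᵐ[volume.restrict Ω] φ) : u ∈ L2sigma Ω :=
  Submodule.le_topologicalClosure _ (Submodule.subset_span ⟨φ, h, h1⟩)

theorem IsSmoothPath.exists_grad (hΩ : IsBoundedLipschitzDomain Ω) {v : ℝ → L2sigma Ω}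
    (hv : IsSmoothPath Ω T v) :
    ContinuousOn v (Icc 0 T) ∧
    (∃ w : ℝ → H10sigma Ω, ContinuousOn w (Icc 0 T) ∧ ∀ t ∈ Icc 0 T,
      (w t : LpΩ Ω (Vec d) 2 × LpΩ Ω (Mat d) 2).1 = v t) ∧
    ∃ G : ℝ → LpΩ Ω (Mat d) ∞, ContinuousOn G (Icc 0 T) ∧
      ∀ t ∈ Icc 0 T, wgrad (v t : LpΩ Ω (Vec d) 2) =ᵐ[volume.restrict Ω] G t := by
  classical
  have := isFiniteMeasure_restrict hΩ
  obtain ⟨Φ, Ψ, S, hS, hSΩ, hΦ, hcΦ, hcΨ, hder, hvΦ⟩ := hv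
  have c0 := continuousOn_path (hcΦ 0)
  have c1 := continuousOn_classicalGrad_path (hcΦ 1)
  have z0 : ∀ t ∈ Icc 0 T, ∀ x ∉ S, Φ t x = 0 := fun t ht x hx =>
    image_eq_zero_of_notMem_tsupport fun h => hx ((hΦ t ht).2.1 h)
  have z1 : ∀ t ∈ Icc 0 T, ∀ x ∉ S, classicalGrad (Φ t) x = 0 := fun t ht x hx =>
    image_eq_zero_of_notMem_tsupport fun h =>
      hx ((hΦ t ht).2.1 (tsupport_classicalGrad_subset _ h))
  have hvc : ContinuousOn (fun t => (v t : LpΩ Ω (Vec d) 2)) (Icc 0 T) :=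
    continuousOn_Lp_of_continuousOn c0 hS z0 hvΦ
  -- The exponent is kept free because the gradient is needed in `L²` for the energy space and in
  -- `L^∞` for the regularity measure.
  set g : (q : ℝ≥0∞) → ℝ → LpΩ Ω (Mat d) q := fun q t =>
    if h : t ∈ Icc 0 T then (memLp_classicalGrad (hΦ t h).1.1 q).toLp _ else 0 with hg
  have hge : ∀ q, ∀ t ∈ Icc 0 T, g q t =ᵐ[volume.restrict Ω] classicalGrad (Φ t) :=
    fun q t ht => by
      rw [hg]
      simp only [dif_pos ht]
      exact MemLp.coeFn_toLp _
  have hmem : ∀ t, ((if t ∈ Icc 0 T then (v t : LpΩ Ω (Vec d) 2) else 0, g 2 t) :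
      LpΩ Ω (Vec d) 2 × LpΩ Ω (Mat d) 2) ∈ H10sigma Ω := fun t => by
    by_cases ht : t ∈ Icc 0 T
    · rw [if_pos ht]
      exact mem_H10sigma (hΦ t ht).1 (hvΦ t ht) (hge 2 t ht)
    · have : g 2 t = 0 := by simp only [hg, dif_neg ht]
      rw [if_neg ht, this]
      exact zero_mem _
  have hgc : ∀ q, [Fact (1 ≤ q)] → ContinuousOn (g q) (Icc 0 T) := fun q _ =>
    continuousOn_Lp_of_continuousOn c1 hS z1 (hge q)
  refine ⟨IsInducing.subtypeVal.continuousOn_iff.2 hvc, ⟨fun t => ⟨_, hmem t⟩, ?_, ?_⟩,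
    g ∞, hgc ∞, ?_⟩
  · refine IsInducing.subtypeVal.continuousOn_iff.2 (ContinuousOn.prodMk ?_ (hgc 2))
    exact hvc.congr fun t ht => if_pos ht
  · exact fun t ht => if_pos ht
  · intro t ht
    have h2 := wgrad_eq_of_mem_H10 hΩ.1 (H10sigma_le_H10 (hmem t))
    simp only [if_pos ht] at h2
    rw [h2]
    exact (hge 2 t ht).trans (hge ∞ t ht).symm

theorem IsSmoothPath.inX (hΩ : IsBoundedLipschitzDomain Ω) {v : ℝ → L2sigma Ω}
    (hv : IsSmoothPath Ω T v) : InX Ω T ν v := by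
  obtain ⟨h1, ⟨w, hw, hwv⟩, -⟩ := hv.exists_grad hΩ
  refine ⟨memLp_of_continuousOn h1 _, fun _ => ⟨w, memLp_of_continuousOn hw _, ?_⟩⟩
  filter_upwards [ae_restrict_mem measurableSet_Ioo] with t ht
  exact hwv t (Ioo_subset_Icc_self ht)

/-- The paths `t ↦ P(t) ψ` with a polynomial `P`. -/
theorem isSmoothPath_polynomial (P : Polynomial ℝ) {ψ : Vec d → Vec d} (hψ : IsSolTestField Ω ψ)
    {u : L2sigma Ω} (hu : (u : LpΩ Ω (Vec d) 2) =ᵐ[volume.restrict Ω] ψ) :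
    IsSmoothPath Ω T fun t => P.eval t • u := by
  have hsol : ∀ c : ℝ, IsSolTestField Ω (fun x => c • ψ x) ∧
      tsupport (fun x => c • ψ x) ⊆ tsupport ψ := fun c => by
    have hs : tsupport (fun x => c • ψ x) ⊆ tsupport ψ := tsupport_smul_subset_right _ _
    refine ⟨⟨⟨hψ.1.1.const_smul c, hψ.1.2.1.of_isClosed_subset (isClosed_tsupport _) hs,
      hs.trans hψ.1.2.2⟩, fun x => ?_⟩, hs⟩
    have e : fderiv ℝ (fun x => c • ψ x) x = c • fderiv ℝ ψ x :=
      fderiv_fun_const_smul (hψ.1.1.differentiable (by simp) x) c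
    simp only [e, smul_apply, PiLp.smul_apply, smul_eq_mul]
    rw [← Finset.mul_sum, hψ.2 x, mul_zero]
  have hcont : ∀ (Q : Polynomial ℝ) (n : ℕ), ContinuousOn (fun q : ℝ × Vec d =>
      iteratedFDeriv ℝ n (fun x => Q.eval q.1 • ψ x) q.2) (Icc 0 T ×ˢ univ) := fun Q n => by
    have e : (fun q : ℝ × Vec d => iteratedFDeriv ℝ n (fun x => Q.eval q.1 • ψ x) q.2) =
        fun q => Q.eval q.1 • iteratedFDeriv ℝ n ψ q.2 := by
      funext q
      exact iteratedFDeriv_const_smul_apply' (hψ.1.1.contDiffAt.of_le (by exact_mod_cast le_top))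
    rw [e]
    exact ((Q.continuous.comp continuous_fst).smul
      ((hψ.1.1.continuous_iteratedFDeriv (by exact_mod_cast le_top)).comp
        continuous_snd)).continuousOn
  refine ⟨fun t x => P.eval t • ψ x, fun t x => P.derivative.eval t • ψ x, tsupport ψ, hψ.1.2.1,
    hψ.1.2.2, fun t _ => ⟨(hsol _).1, (hsol _).2, (hsol _).1, (hsol _).2⟩, hcont P,
    hcont P.derivative, fun t _ x => ?_, fun t _ => ?_⟩
  · exact ((P.hasDerivAt t).hasDerivWithinAt).smul_const (ψ x)
  · exact (Lp.coeFn_smul _ _).trans (hu.const_smul (P.eval t))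

end SmoothPath

/-! ### The regularity measure `2 ‖∇u‖_{L^∞}` -/

section GradSup

variable {d : ℕ} {Ω : Set (Vec d)} {T ν : ℝ}

/-- The regularity measure `2 ‖∇u‖_{L^∞}`. -/
def gradMeasure (Ω : Set (Vec d)) (u : L2sigma Ω) : ℝ≥0∞ :=
  2 * eLpNorm (wgrad (u : LpΩ Ω (Vec d) 2)) ∞ (volume.restrict Ω)

theorem gradMeasure_eq {u : L2sigma Ω} {G : LpΩ Ω (Mat d) ∞}
    (h : wgrad (u : LpΩ Ω (Vec d) 2) =ᵐ[volume.restrict Ω] G) :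
    gradMeasure Ω u = 2 * ‖G‖ₑ := by
  rw [gradMeasure, eLpNorm_congr_ae h, Lp.enorm_def]

theorem toReal_gradMeasure_eq {u : L2sigma Ω} {G : LpΩ Ω (Mat d) ∞}
    (h : wgrad (u : LpΩ Ω (Vec d) 2) =ᵐ[volume.restrict Ω] G) :
    (gradMeasure Ω u).toReal = 2 * ‖G‖ := by
  rw [gradMeasure_eq h, ENNReal.toReal_mul, toReal_enorm]
  simp

theorem gradMeasure_zero (hΩ : IsBoundedLipschitzDomain Ω) : gradMeasure Ω 0 = 0 := by
  have := isFiniteMeasure_restrict hΩ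
  rw [gradMeasure, ZeroMemClass.coe_zero, wgrad_zero hΩ.1, eLpNorm_congr_ae (Lp.coeFn_zero _ _ _),
    eLpNorm_zero, mul_zero]

theorem IsSmoothPath.mem_KDomain (hΩ : IsBoundedLipschitzDomain Ω) {v : ℝ → L2sigma Ω}
    (hv : IsSmoothPath Ω T v) : v ∈ KDomain Ω T ν (gradMeasure Ω) := by
  obtain ⟨-, -, G, hG, hGv⟩ := hv.exists_grad hΩ
  have e : (fun t => gradMeasure Ω (v t)) =ᵐ[timeMeasure T] fun t => 2 * ‖G t‖ₑ := by
    filter_upwards [ae_restrict_mem measurableSet_Ioo] with t ht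
    exact gradMeasure_eq (hGv t (Ioo_subset_Icc_self ht))
  have hGm := memLp_of_continuousOn hG 1
  refine ⟨hv.inX hΩ, (hGm.1.enorm.const_mul 2).congr e.symm, ?_⟩
  rw [lintegral_congr_ae e, lintegral_const_mul' _ _ (by simp)]
  refine ENNReal.mul_ne_top (by simp) ?_
  have := hGm.2
  rw [eLpNorm_one_eq_lintegral_enorm] at this
  exact this.ne

/-- A field with vanishing gradient is constant, and it vanishes somewhere because the space is not
compact; this is where `d > 0` matters. -/
theorem eq_zero_of_classicalGrad_ae_eq_zero (hd : 0 < d) (hΩ : IsOpen Ω) {ψ : Vec d → Vec d}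
    (hψ : IsTestField Ω ψ) (h : classicalGrad ψ =ᵐ[volume.restrict Ω] 0) : ψ = 0 := by
  have hcont := continuous_classicalGrad hψ.1
  have h1 : EqOn (classicalGrad ψ) 0 Ω :=
    Measure.eqOn_open_of_ae_eq h hΩ hcont.continuousOn continuousOn_const
  have h2 : ∀ x, classicalGrad ψ x = 0 := fun x => by
    by_cases hx : x ∈ Ω
    · exact h1 hx
    · exact image_eq_zero_of_notMem_tsupport fun h =>
        hx (hψ.2.2 (tsupport_classicalGrad_subset _ h))
  have h3 : ∀ x, fderiv ℝ ψ x = 0 := fun x => by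
    refine ContinuousLinearMap.coe_injective ((EuclideanSpace.basisFun (Fin d)
      ℝ).toBasis.ext fun j => ?_)
    ext i
    have := congrArg (fun M : Mat d => M (i, j)) (h2 x)
    simpa [classicalGrad, basisVec] using this
  have hne : Nonempty (Fin d) := ⟨⟨0, hd⟩⟩
  have hx : ∃ x, x ∉ tsupport ψ := by
    by_contra! hc
    exact noncompact_univ (Vec d) ((eq_univ_of_forall hc) ▸ hψ.2.1)
  obtain ⟨x₀, hx₀⟩ := hx
  funext x
  rw [is_const_of_fderiv_eq_zero (hψ.1.differentiable (by simp)) h3 x x₀]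
  exact image_eq_zero_of_notMem_tsupport hx₀

/-- If all solenoidal test fields vanished, so would their closure. The field serves as the
direction of the approximating smooth paths, and its gradient norm is divided by. -/
theorem exists_isSolTestField_of_ne (hd : 0 < d) (hΩ : IsBoundedLipschitzDomain Ω)
    (h : ∃ u : L2sigma Ω, u ≠ 0) : ∃ (ψ : Vec d → Vec d) (u : L2sigma Ω) (G : LpΩ Ω (Mat d) ∞),
      IsSolTestField Ω ψ ∧ (u : LpΩ Ω (Vec d) 2) =ᵐ[volume.restrict Ω] ψ ∧
      wgrad (u : LpΩ Ω (Vec d) 2) =ᵐ[volume.restrict Ω] G ∧ 0 < ‖G‖ := by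
  have hψ : ∃ ψ, IsSolTestField Ω ψ ∧ ψ ≠ 0 := by
    by_contra! hc
    obtain ⟨u, hu⟩ := h
    apply hu
    have h0 : L2sigma Ω ≤ ⊥ := by
      refine Submodule.topologicalClosure_minimal _ (Submodule.span_le.2 ?_) isClosed_singleton
      rintro w ⟨ψ, hψ, hw⟩
      rw [hc ψ hψ] at hw
      exact Lp.ext (hw.trans (Lp.coeFn_zero _ _ _).symm)
    exact Subtype.ext (h0 u.2)
  obtain ⟨ψ, hψ, hψ0⟩ := hψ
  have m0 := memLp_testField hψ.1 2
  have m1 := memLp_testField hψ.1 ∞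
  have m2 := memLp_classicalGrad hψ.1 ∞
  refine ⟨ψ, ⟨m0.toLp _, mem_L2sigma hψ m0.coeFn_toLp⟩, m2.toLp _, hψ, m0.coeFn_toLp, ?_, ?_⟩
  · exact wgrad_ae_eq hΩ ((isWeakGrad_classicalGrad hψ.1.1).congr m1.coeFn_toLp.symm
      m2.coeFn_toLp.symm) (m0.coeFn_toLp.trans m1.coeFn_toLp.symm)
  · rw [norm_pos_iff]
    intro h0
    refine hψ0 (eq_zero_of_classicalGrad_ae_eq_zero hd hΩ.1 hψ.1 ?_)
    exact m2.coeFn_toLp.symm.trans (h0 ▸ Lp.coeFn_zero _ _ _)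

/-- Continuous functions are dense in `L¹`, and polynomials are uniformly dense among them by
Weierstrass. -/
theorem exists_polynomial_integral_sub_le {a : ℝ → ℝ} (ha : Integrable a (timeMeasure T)) {ε : ℝ}
    (hε : 0 < ε) : ∃ P : Polynomial ℝ, ∫ t, |P.eval t - a t| ∂timeMeasure T < ε := by
  have : (timeMeasure T).Regular := by
    rw [timeMeasure]
    infer_instance
  obtain ⟨g, -, hg, hgc, hgi⟩ := ha.exists_hasCompactSupport_integral_sub_le (half_pos hε)
  set m : ℝ := (timeMeasure T).real univ with hm
  have hm0 : 0 ≤ m := measureReal_nonneg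
  obtain ⟨P, hP⟩ := exists_polynomial_near_of_continuousOn 0 T g hgc.continuousOn
    (ε / (2 * (m + 1))) (by positivity)
  have hPi : Integrable (fun t => P.eval t) (timeMeasure T) :=
    (P.continuous.continuousOn.integrableOn_compact (isCompact_Icc (a := (0 : ℝ))
      (b := T))).mono_set Ioo_subset_Icc_self
  refine ⟨P, ?_⟩
  have h1 : ∫ t, |P.eval t - g t| ∂timeMeasure T ≤ m * (ε / (2 * (m + 1))) := by
    have := norm_integral_le_of_norm_le_const (μ := timeMeasure T)
      (f := fun t => |P.eval t - g t|) (C := ε / (2 * (m + 1))) (by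
        filter_upwards [ae_restrict_mem measurableSet_Ioo] with t ht
        rw [Real.norm_eq_abs, abs_abs]
        exact (hP t (Ioo_subset_Icc_self ht)).le)
    rw [mul_comm]
    exact (le_abs_self _).trans this
  have h2 : ∫ t, |P.eval t - a t| ∂timeMeasure T ≤
      ∫ t, |P.eval t - g t| ∂timeMeasure T + ∫ t, ‖a t - g t‖ ∂timeMeasure T := by
    have i1 : Integrable (fun t => |P.eval t - g t|) (timeMeasure T) := (hPi.sub hgi).abs
    have i2 : Integrable (fun t => ‖a t - g t‖) (timeMeasure T) := (ha.sub hgi).norm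
    rw [← integral_add i1 i2]
    refine integral_mono (hPi.sub ha).abs ((hPi.sub hgi).abs.add (ha.sub hgi).norm) fun t => ?_
    have := abs_sub_le (P.eval t) (g t) (a t)
    rw [abs_sub_comm (g t)] at this
    exact this
  have h3 : m * (ε / (2 * (m + 1))) < ε / 2 := by
    rw [mul_div_assoc', div_lt_div_iff₀ (by positivity) (by norm_num)]
    nlinarith
  linarith

theorem isTestPath_exists_grad {v' : ℝ → L2sigma Ω} {g : ℝ → StrongDual ℝ (L2sigma Ω)}
    (hΩ : IsBoundedLipschitzDomain Ω) (h : IsTestPath Ω T ν v' g) :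
    ∃ k : ℝ → W1 Ω ∞, MemLp k 1 (timeMeasure T) ∧ ∀ᵐ t ∂timeMeasure T,
      IsWeakGrad Ω (k t).1.1 (k t).1.2 ∧ (v' t : LpΩ Ω (Vec d) 2) =ᵐ[volume.restrict Ω] (k t).1.1 ∧
      wgrad (v' t : LpΩ Ω (Vec d) 2) =ᵐ[volume.restrict Ω] (k t).1.2 := by
  obtain ⟨k, hk, hkv⟩ := h.inW1inf
  refine ⟨k, hk, ?_⟩
  filter_upwards [hkv] with t ht
  exact ⟨(k t).2, ht.symm, wgrad_ae_eq hΩ (k t).2 ht.symm⟩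

/-- Differences of paths in the energy space are in `H^1_{0,σ}` at almost all times. -/
theorem InX.exists_sub_mem {v v' : ℝ → L2sigma Ω} (hν : 0 < ν) (h : InX Ω T ν v)
    (h' : InX Ω T ν v') : ∀ᵐ t ∂timeMeasure T, ∃ u ∈ H10sigma Ω,
      u.1 = ((v t - v' t : L2sigma Ω) : LpΩ Ω (Vec d) 2) := by
  obtain ⟨w, -, hw⟩ := h.2 hν
  obtain ⟨w', -, hw'⟩ := h'.2 hν
  filter_upwards [hw, hw'] with t h1 h2
  refine ⟨(w t - w' t : H10sigma Ω), (w t - w' t).2, ?_⟩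
  rw [Submodule.coe_sub, Submodule.coe_sub, Prod.fst_sub, h1, h2]

/-- Integration by parts for `ν > 0` and symmetry of the quadratic form for `ν = 0` bring both
definitions to one formula, so later arguments need no distinction of cases. -/
theorem relForm_eq_triForm (hΩ : IsBoundedLipschitzDomain Ω) (hν : 0 ≤ ν) {u u' : L2sigma Ω}
    {k : ℝ} {c : LpΩ Ω (Vec d) ∞} {G : LpΩ Ω (Mat d) ∞} (h : IsWeakGrad Ω c G)
    (hu' : (u' : LpΩ Ω (Vec d) 2) =ᵐ[volume.restrict Ω] c)
    (hu : 0 < ν → ∃ w ∈ H10sigma Ω, w.1 = ((u - u' : L2sigma Ω) : LpΩ Ω (Vec d) 2)) :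
    relForm ν u u' k = ν * ‖wgrad (u : LpΩ Ω (Vec d) 2) - wgrad (u' : LpΩ Ω (Vec d) 2)‖ ^ 2 +
      triForm G (u - u' : L2sigma Ω) (u - u' : L2sigma Ω) + k * relEnergy u u' := by
  have := isFiniteMeasure_restrict hΩ
  rw [relForm]
  split_ifs with h0
  · rw [convForm_self_eq_neg_triForm hΩ.1 (hu h0) h hu', sub_neg_eq_add]
  · have : ν = 0 := le_antisymm (not_lt.1 h0) hν
    rw [symForm_eq_triForm (wgrad_ae_eq hΩ h hu'), this, zero_mul, zero_add]

theorem edist_KMap {K : L2sigma Ω → ℝ≥0∞} (v v' : KDomain Ω T ν K) :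
    edist (KMap K v) (KMap K v') =
      ENNReal.ofReal (∫ t, |(K (v.1 t)).toReal - (K (v'.1 t)).toReal| ∂timeMeasure T) := by
  have hi : Integrable (fun t => |(K (v.1 t)).toReal - (K (v'.1 t)).toReal|) (timeMeasure T) :=
    ((integrable_K v).sub (integrable_K v')).abs
  rw [KMap, KMap, Integrable.edist_toL1_toL1,
    ofReal_integral_eq_lintegral_ofReal hi (Eventually.of_forall fun t => abs_nonneg _)]
  simp only [edist_dist, Real.dist_eq]

theorem toReal_gradMeasure_smul {u : L2sigma Ω} (hΩ : IsBoundedLipschitzDomain Ω)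
    {ψ : Vec d → Vec d} (hψ : IsTestField Ω ψ) {G : LpΩ Ω (Mat d) ∞}
    (hu : (u : LpΩ Ω (Vec d) 2) =ᵐ[volume.restrict Ω] ψ)
    (hG : wgrad (u : LpΩ Ω (Vec d) 2) =ᵐ[volume.restrict Ω] G) (r : ℝ) :
    (gradMeasure Ω (r • u)).toReal = |r| * (2 * ‖G‖) := by
  have m1 := memLp_testField hψ ∞
  have m2 := memLp_classicalGrad hψ ∞
  have e := wgrad_ae_eq hΩ ((isWeakGrad_classicalGrad hψ.1).congr m1.coeFn_toLp.symm
    m2.coeFn_toLp.symm) (hu.trans m1.coeFn_toLp.symm)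
  have w1 : IsWeakGrad Ω (m1.toLp _) G := (isWeakGrad_classicalGrad hψ.1).congr
    m1.coeFn_toLp.symm (m2.coeFn_toLp.symm.trans (e.symm.trans hG))
  have hG' : wgrad ((r • u : L2sigma Ω) : LpΩ Ω (Vec d) 2)
      =ᵐ[volume.restrict Ω] (r • G : LpΩ Ω (Mat d) ∞) := by
    refine wgrad_ae_eq hΩ (isWeakGrad_smul r w1) ?_
    rw [Submodule.coe_smul]
    exact (Lp.coeFn_smul _ _).trans (((hu.trans m1.coeFn_toLp.symm).const_smul _).trans
      (Lp.coeFn_smul _ _).symm)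
  rw [toReal_gradMeasure_eq hG', norm_smul, Real.norm_eq_abs]
  ring

/-- Closeness is measured only through `K`, so the approximating path may point in one fixed
direction `u` with amplitude adapted to `K(v(t))`. -/
theorem exists_isSmoothPath_edist_lt (hd : 0 < d) (hΩ : IsBoundedLipschitzDomain Ω)
    (v : KDomain Ω T ν (gradMeasure Ω)) {ε : ℝ≥0∞} (hε : 0 < ε) :
    ∃ v' : KDomain Ω T ν (gradMeasure Ω), IsSmoothPath Ω T v'.1 ∧
      edist (KMap (gradMeasure Ω) v) (KMap (gradMeasure Ω) v') < ε := by
  by_cases htriv : ∃ u : L2sigma Ω, u ≠ 0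
  · obtain ⟨ψ, u, G, hψ, hu, hG, hG0⟩ := exists_isSolTestField_of_ne hd hΩ htriv
    obtain ⟨δ, hδ, hδε⟩ : ∃ δ : ℝ, 0 < δ ∧ ENNReal.ofReal δ ≤ ε := by
      rcases eq_or_ne ε ⊤ with rfl | hεt
      · exact ⟨1, one_pos, le_top⟩
      · exact ⟨ε.toReal, ENNReal.toReal_pos hε.ne' hεt, ENNReal.ofReal_toReal_le⟩
    obtain ⟨P, hP⟩ := exists_polynomial_integral_sub_le (integrable_K v) hδ
    -- With this normalisation `K(Q(t) u) = |P(t)|`. The absolute value does no harm, since the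
    -- function approximated by `P` is nonnegative.
    set Q : Polynomial ℝ := Polynomial.C (1 / (2 * ‖G‖)) * P with hQ
    have hsm : IsSmoothPath Ω T fun t => Q.eval t • u := isSmoothPath_polynomial Q hψ hu
    refine ⟨⟨_, hsm.mem_KDomain hΩ⟩, hsm, lt_of_lt_of_le ?_ hδε⟩
    have hK : ∀ t, (gradMeasure Ω (Q.eval t • u)).toReal = |P.eval t| := fun t => by
      rw [toReal_gradMeasure_smul hΩ hψ.1 hu hG, hQ, Polynomial.eval_mul, Polynomial.eval_C,
        abs_mul, abs_of_pos (by positivity)]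
      field_simp
    have hPi : Integrable (fun t => P.eval t) (timeMeasure T) :=
      (P.continuous.continuousOn.integrableOn_compact (isCompact_Icc (a := (0 : ℝ))
        (b := T))).mono_set Ioo_subset_Icc_self
    have hPv : Integrable (fun t => |P.eval t - (gradMeasure Ω (v.1 t)).toReal|)
      (timeMeasure T) := (hPi.sub (integrable_K v)).abs
    rw [edist_KMap]
    refine (ENNReal.ofReal_lt_ofReal_iff hδ).2 (lt_of_le_of_lt
      (integral_mono_of_nonneg (Eventually.of_forall fun t => abs_nonneg _) hPv
        (Eventually.of_forall fun t => ?_)) hP)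
    simp only [hK]
    have := abs_abs_sub_abs_le (P.eval t) (gradMeasure Ω (v.1 t)).toReal
    rw [abs_of_nonneg (ENNReal.toReal_nonneg (a := gradMeasure Ω (v.1 t)))] at this
    rwa [abs_sub_comm]
  -- In the trivial space `L²_σ = 0` the only path is zero, which is smooth.
  · push Not at htriv
    have hψ : IsSolTestField Ω (fun _ : Vec d => (0 : Vec d)) := by
      refine ⟨⟨contDiff_const, HasCompactSupport.zero, ?_⟩, fun x => ?_⟩
      · simp [tsupport]
      · simp
    have hsm : IsSmoothPath Ω T fun t => (0 : Polynomial ℝ).eval t • (0 : L2sigma Ω) :=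
      isSmoothPath_polynomial 0 hψ (Lp.coeFn_zero _ _ _)
    refine ⟨⟨_, hsm.mem_KDomain hΩ⟩, hsm, ?_⟩
    have e : (⟨_, hsm.mem_KDomain hΩ⟩ : KDomain Ω T ν (gradMeasure Ω)) = v :=
      Subtype.ext (funext fun t => by rw [htriv (v.1 t)]; exact smul_zero _)
    rw [e, edist_self]
    exact hε

/-- The topology induced by `K` is the coarsest for which `K` is continuous, and it makes density
weakest. The factor `2` in `gradMeasure` compensates the `½` of the relative energy in `|∫ w · G w|
≤ ‖G‖ ‖w‖²`. -/
theorem isAdmissible_gradMeasure (hd : 0 < d) (hΩ : IsBoundedLipschitzDomain Ω) (hν : 0 ≤ ν) :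
    IsAdmissible Ω T ν (gradMeasure Ω) where
  zero := gradMeasure_zero hΩ
  smooth_mem v hv := hv.mem_KDomain hΩ
  topology := by
    refine ⟨TopologicalSpace.induced (KMap (gradMeasure Ω)) inferInstance,
      continuous_induced_dom, ?_⟩
    let _ : TopologicalSpace (KDomain Ω T ν (gradMeasure Ω)) :=
      TopologicalSpace.induced (KMap (gradMeasure Ω)) inferInstance
    have hind : IsInducing (KMap (T := T) (ν := ν) (gradMeasure Ω)) := ⟨rfl⟩
    refine hind.dense_iff.2 fun v => EMetric.mem_closure_iff.2 fun ε hε => ?_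
    obtain ⟨v', h1, h2⟩ := exists_isSmoothPath_edist_lt hd hΩ v hε
    exact ⟨_, mem_image_of_mem _ h1, h2⟩
  nonneg v v' g hv hv' _ := by
    obtain ⟨k, -, hk⟩ := isTestPath_exists_grad hΩ hv'
    have hsub : ∀ᵐ t ∂timeMeasure T, 0 < ν → ∃ w ∈ H10sigma Ω,
        w.1 = ((v t - v' t : L2sigma Ω) : LpΩ Ω (Vec d) 2) := by
      rcases hν.eq_or_lt with h0 | h0
      · exact Eventually.of_forall fun t h => absurd h h0.symm.not_gt
      · filter_upwards [hv.exists_sub_mem h0 hv'.inX] with t ht _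
        exact ht
    filter_upwards [hk, hsub] with t ht hs
    rw [relForm_eq_triForm hΩ hν ht.1 ht.2.1 hs, toReal_gradMeasure_eq ht.2.2, relEnergy]
    have h1 := abs_triForm_le (k t).1.2 (v t - v' t : L2sigma Ω) (v t - v' t : L2sigma Ω)
    have h2 := (abs_le.1 h1).1
    have h3 : ‖((v t - v' t : L2sigma Ω) : LpΩ Ω (Vec d) 2)‖ = ‖v t - v' t‖ := rfl
    rw [h3] at h2
    have h4 : 0 ≤ ν * ‖wgrad (v t : LpΩ Ω (Vec d) 2) - wgrad (v' t : LpΩ Ω (Vec d) 2)‖ ^ 2 := by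
      positivity
    nlinarith

end GradSup

/-! ### The integrand of the relative energy inequality -/

section Integrand

variable {d : ℕ} {Ω : Set (Vec d)} {T ν : ℝ}

theorem memLp_coe {E : Type*} [NormedAddCommGroup E] [NormedSpace ℝ E]
    {S : Submodule ℝ E} {u : ℝ → S} {q : ℝ≥0∞} (h : MemLp u q (timeMeasure T)) :
    MemLp (fun t => (u t : E)) q (timeMeasure T) :=
  ⟨continuous_subtype_val.comp_aestronglyMeasurable h.1,
    (eLpNorm_congr_norm_ae (Eventually.of_forall fun _ => rfl)).trans_lt h.2⟩

theorem memLp_snd {E F : Type*} [NormedAddCommGroup E] [NormedSpace ℝ E] [NormedAddCommGroup F]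
    [NormedSpace ℝ F] {S : Submodule ℝ (E × F)} {u : ℝ → S} {q : ℝ≥0∞}
    (h : MemLp u q (timeMeasure T)) : MemLp (fun t => (u t).1.2) q (timeMeasure T) :=
  (ContinuousLinearMap.snd ℝ E F).comp_memLp' (memLp_coe h)

theorem memLp_inclusion {E : Type*} [NormedAddCommGroup E] [NormedSpace ℝ E]
    {S S' : Submodule ℝ E} (hS : S ≤ S') {u : ℝ → S} {q : ℝ≥0∞} (h : MemLp u q (timeMeasure T)) :
    MemLp (fun t => (⟨u t, hS (u t).2⟩ : S')) q (timeMeasure T) :=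
  ⟨(continuous_subtype_val.subtype_mk fun x : S => hS x.2).comp_aestronglyMeasurable h.1,
    (eLpNorm_congr_norm_ae (Eventually.of_forall fun _ => rfl)).trans_lt h.2⟩

/-- `W` represents `u` as an element of `H^1_{0,σ}`, if `ν > 0`. -/
def IsLift (ν : ℝ) (u : L2sigma Ω) (W : H10 Ω) : Prop :=
  0 < ν → W.1 ∈ H10sigma Ω ∧ W.1.1 = (u : LpΩ Ω (Vec d) 2)

/-- `wgrad` and `liftH10` are chosen time by time without control of measurability; the lift
supplies measurable substitutes. For `ν = 0` the zero lift is enough, as every term containing it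
carries `ν` or `f₁ = 0`. -/
theorem InX.exists_lift {v : ℝ → L2sigma Ω} (h : InX Ω T ν v) :
    ∃ W : ℝ → H10 Ω, MemLp W 2 (timeMeasure T) ∧ ∀ᵐ t ∂timeMeasure T, IsLift ν (v t) (W t) := by
  by_cases hν : 0 < ν
  · obtain ⟨w, hw, hwv⟩ := h.2 hν
    refine ⟨fun t => ⟨(w t).1, H10sigma_le_H10 (w t).2⟩, memLp_inclusion H10sigma_le_H10 hw, ?_⟩
    filter_upwards [hwv] with t ht _
    exact ⟨(w t).2, ht⟩
  · exact ⟨fun _ => 0, memLp_const 0, Eventually.of_forall fun t h => absurd h hν⟩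

theorem IsLift.sub {u u' : L2sigma Ω} {W W' : H10 Ω} (h : IsLift ν u W) (h' : IsLift ν u' W') :
    IsLift ν (u - u') (W - W') := fun hν => by
  refine ⟨sub_mem (h hν).1 (h' hν).1, ?_⟩
  rw [Submodule.coe_sub, Prod.fst_sub, (h hν).2, (h' hν).2]
  rfl

theorem IsLift.wgrad_eq [IsFiniteMeasure ((volume : Measure (Vec d)).restrict Ω)]
    (hΩ : IsOpen Ω) {u : L2sigma Ω} {W : H10 Ω} (h : IsLift ν u W) (hν : 0 < ν) :
    wgrad (u : LpΩ Ω (Vec d) 2) = W.1.2 := by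
  rw [← (h hν).2, wgrad_eq_of_mem_H10 hΩ W.2]

theorem IsLift.apply_liftH10 [IsFiniteMeasure ((volume : Measure (Vec d)).restrict Ω)]
    (hΩ : IsOpen Ω) (hν0 : 0 ≤ ν) {u : L2sigma Ω} {W : H10 Ω} (h : IsLift ν u W)
    {f₁ : StrongDual ℝ (H10 Ω)} (hf₁ : ν = 0 → f₁ = 0) :
    f₁ (liftH10 (u : LpΩ Ω (Vec d) 2)) = f₁ W := by
  rcases hν0.eq_or_lt with h0 | h0
  · rw [hf₁ h0.symm]
    rfl
  · rw [← (h h0).2, liftH10_eq hΩ]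

theorem triForm_add_left (G : LpΩ Ω (Mat d) ∞) (a b c : LpΩ Ω (Vec d) 2) :
    triForm G (a + b) c = triForm G a c + triForm G b c := by
  simp only [triForm, map_add, inner_add_left]

theorem triForm_sub_right (G : LpΩ Ω (Mat d) ∞) (a b c : LpΩ Ω (Vec d) 2) :
    triForm G a (b - c) = triForm G a b - triForm G a c := by
  simp only [triForm, inner_sub_right]

theorem triForm_smul_right (G : LpΩ Ω (Mat d) ∞) (a c : LpΩ Ω (Vec d) 2) (r : ℝ) :
    triForm G a (r • c) = r * triForm G a c := by
  simp only [triForm, real_inner_smul_right]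

theorem triForm_smul (G : LpΩ Ω (Mat d) ∞) (a c : LpΩ Ω (Vec d) 2) (r : ℝ) :
    triForm (r • G) a c = r * triForm G a c := by
  simp only [triForm, map_smul, smul_apply, real_inner_smul_left]

theorem IsLift.dissipation_eq (hΩ : IsBoundedLipschitzDomain Ω) (hν : 0 ≤ ν) {u u' : L2sigma Ω}
    {W W' : H10 Ω} (hW : IsLift ν u W) (hW' : IsLift ν u' W') :
    ν * ‖wgrad (u : LpΩ Ω (Vec d) 2) - wgrad (u' : LpΩ Ω (Vec d) 2)‖ ^ 2 +
      ν * ⟪wgrad (u' : LpΩ Ω (Vec d) 2), wgrad ((u - u' : L2sigma Ω) : LpΩ Ω (Vec d) 2)⟫ =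
      ν * ⟪W.1.2, W.1.2 - W'.1.2⟫ := by
  have := isFiniteMeasure_restrict hΩ
  have key : ∀ a b : LpΩ Ω (Mat d) 2, ν * ‖a - b‖ ^ 2 + ν * ⟪b, a - b⟫ = ν * ⟪a, a - b⟫ := by
    intro a b
    rw [← mul_add, ← real_inner_self_eq_norm_sq, ← inner_add_left, sub_add_cancel]
  rcases hν.eq_or_lt with h0 | h0
  · rw [← h0]
    ring
  · have hs : wgrad ((u - u' : L2sigma Ω) : LpΩ Ω (Vec d) 2) = W.1.2 - W'.1.2 :=
      (hW.sub hW').wgrad_eq hΩ.1 h0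
    rw [hW.wgrad_eq hΩ.1 h0, hW'.wgrad_eq hΩ.1 h0, hs]
    exact key _ _

theorem triForm_sub_add (G : LpΩ Ω (Mat d) ∞) (u u' : L2sigma Ω) :
    triForm G (u - u' : L2sigma Ω) (u - u' : L2sigma Ω) + triForm G u' (u - u' : L2sigma Ω) =
      triForm G u (u - u' : L2sigma Ω) := by
  rw [← triForm_add_left, ← Submodule.coe_add, sub_add_cancel]

theorem cancel_integrand {n a t r b i l e k ξ n' t' : ℝ} (h1 : n + i = n') (h2 : a + t = t') :
    n + a + k * r + (b + t + i - (l + e)) - k * (r + ξ) = n' + t' + b - l - e - k * ξ := by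
  rw [← h1, ← h2]
  ring

set_option maxHeartbeats 1000000 in
/-- The integrand of the relative energy inequality, after cancellation. -/
theorem integrand_eq (hΩ : IsBoundedLipschitzDomain Ω) (hν : 0 ≤ ν) {u u' : L2sigma Ω}
    {W W' : H10 Ω} (hW : IsLift ν u W) (hW' : IsLift ν u' W') {f₁ : StrongDual ℝ (H10 Ω)}
    (hf₁ : ν = 0 → f₁ = 0) {f₂ : LpΩ Ω (Vec d) 2} {g : StrongDual ℝ (L2sigma Ω)}
    {c : LpΩ Ω (Vec d) ∞} {G : LpΩ Ω (Mat d) ∞} (h : IsWeakGrad Ω c G)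
    (hu' : (u' : LpΩ Ω (Vec d) 2) =ᵐ[volume.restrict Ω] c) (k ξ : ℝ) :
    relForm ν u u' k + systemOp ν f₁ f₂ g u' (u - u') - k * (relEnergy u u' + ξ) =
      ν * ⟪W.1.2, W.1.2 - W'.1.2⟫ + triForm G u (u - u' : L2sigma Ω) + g (u - u') - f₁ (W - W')
        - ⟪f₂, ((u - u' : L2sigma Ω) : LpΩ Ω (Vec d) 2)⟫ - k * ξ := by
  have := isFiniteMeasure_restrict hΩ
  have hs := hW.sub hW'
  rw [relForm_eq_triForm hΩ hν h hu' fun h0 => ⟨_, hs h0⟩, systemOp,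
    hs.apply_liftH10 hΩ.1 hν hf₁, convForm_eq_triForm (wgrad_ae_eq hΩ h hu')]
  exact cancel_integrand (hW.dissipation_eq hΩ hν hW') (triForm_sub_add G u u')

theorem integrable_inner_of_memLp {E : Type*} [NormedAddCommGroup E] [InnerProductSpace ℝ E]
    {a b : ℝ → E} {q r : ℝ≥0∞} [ENNReal.HolderTriple q r 1] (ha : MemLp a q (timeMeasure T))
    (hb : MemLp b r (timeMeasure T)) : Integrable (fun t => ⟪a t, b t⟫) (timeMeasure T) :=
  memLp_one_iff_integrable.1 ((innerSL ℝ).memLp_of_bilin 1 ha hb)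

theorem integrable_apply_of_memLp {E : Type*} [NormedAddCommGroup E] [NormedSpace ℝ E]
    {a : ℝ → StrongDual ℝ E} {b : ℝ → E} {q r : ℝ≥0∞} [ENNReal.HolderTriple q r 1]
    (ha : MemLp a q (timeMeasure T)) (hb : MemLp b r (timeMeasure T)) :
    Integrable (fun t => a t (b t)) (timeMeasure T) :=
  memLp_one_iff_integrable.1 ((ContinuousLinearMap.id ℝ (StrongDual ℝ E)).memLp_of_bilin 1 ha hb)

theorem integrable_triForm {G : ℝ → LpΩ Ω (Mat d) ∞} {a c : ℝ → LpΩ Ω (Vec d) 2}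
    (hG : MemLp G 1 (timeMeasure T)) (ha : MemLp a ∞ (timeMeasure T))
    (hc : MemLp c ∞ (timeMeasure T)) :
    Integrable (fun t => triForm (G t) (a t) (c t)) (timeMeasure T) :=
  integrable_inner_of_memLp
    (((matVec d).holderL (volume.restrict Ω) ∞ 2 2).memLp_of_bilin 1 hG ha) hc

/-- Each term is a Hölder pairing in time: `L²` with `L²` for the gradients and `f₁`, and `L¹` with
`L^∞` for `G`, `f₂` and `k`; for the derivative `g` in `L²`, the factor in `L^∞` is regarded as
being in `L²`. -/
theorem integrable_integrand {v v' : ℝ → L2sigma Ω} {W W' : ℝ → H10 Ω}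
    {f₁ : ℝ → StrongDual ℝ (H10 Ω)} {f₂ : ℝ → LpΩ Ω (Vec d) 2}
    {g : ℝ → StrongDual ℝ (L2sigma Ω)} {G : ℝ → LpΩ Ω (Mat d) ∞} {k ξ : ℝ → ℝ}
    (hW : MemLp W 2 (timeMeasure T)) (hW' : MemLp W' 2 (timeMeasure T))
    (hv : MemLp v ∞ (timeMeasure T)) (hv' : MemLp v' ∞ (timeMeasure T))
    (hf₁ : MemLp f₁ 2 (timeMeasure T)) (hf₂ : MemLp f₂ 1 (timeMeasure T))
    (hg : MemLp g 2 (timeMeasure T)) (hG : MemLp G 1 (timeMeasure T))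
    (hk : Integrable k (timeMeasure T)) (hξ : MemLp ξ ∞ (timeMeasure T)) :
    Integrable (fun t => ν * ⟪(W t).1.2, (W t).1.2 - (W' t).1.2⟫ +
      triForm (G t) (v t) (v t - v' t : L2sigma Ω) + g t (v t - v' t) - f₁ t (W t - W' t)
        - ⟪f₂ t, ((v t - v' t : L2sigma Ω) : LpΩ Ω (Vec d) 2)⟫ - k t * ξ t) (timeMeasure T) := by
  have h1 := memLp_snd hW
  have h2 := memLp_snd hW'
  have hs : MemLp (fun t => v t - v' t) ∞ (timeMeasure T) := hv.sub hv'
  have i1 := (integrable_inner_of_memLp h1 (h1.sub h2)).const_mul ν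
  have i2 := integrable_triForm hG (memLp_coe hv) (memLp_coe hs)
  have i3 := integrable_apply_of_memLp hg (hs.mono_exponent (q := ∞) (p := 2) le_top)
  have i4 := integrable_apply_of_memLp hf₁ (hW.sub hW')
  have i5 := integrable_inner_of_memLp hf₂ (memLp_coe hs)
  have i6 : Integrable (fun t => k t * ξ t) (timeMeasure T) :=
    memLp_one_iff_integrable.1 ((ContinuousLinearMap.mul ℝ ℝ).memLp_of_bilin 1
      (memLp_one_iff_integrable.2 hk) hξ)
  exact ((((i1.add i2).add i3).sub i4).sub i5).sub i6

end Integrand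

/-! ### Constant test paths -/

section ConstPath

variable {d : ℕ} {Ω : Set (Vec d)} {T ν : ℝ} {p : ℝ≥0∞} [hp1 : Fact (1 ≤ p)]

/-- An element of `H^1_{0,σ} ∩ W^{2,p}` as an element of `L²_σ`. -/
def VSpace.toSigma (x : VSpace Ω p) : L2sigma Ω := ⟨x.1.1.1, fst_mem_L2sigma x.2.1⟩

/-- An element of `H^1_{0,σ} ∩ W^{2,p}` as an element of `H^1_0`. -/
def VSpace.toH10 (x : VSpace Ω p) : H10 Ω := ⟨x.1.1, H10sigma_le_H10 x.2.1⟩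

theorem VSpace.isLift_smul (x : VSpace Ω p) (r : ℝ) :
    IsLift ν (r • VSpace.toSigma x) (r • VSpace.toH10 x) := fun _ =>
  ⟨Submodule.smul_mem _ r x.2.1, rfl⟩

theorem integral_deriv_eq_zero (hT : 0 ≤ T) {φ : ℝ → ℝ} (hφ : ContDiff ℝ ∞ φ)
    (hφT : tsupport φ ⊆ Ioo 0 T) : ∫ t, deriv φ t ∂timeMeasure T = 0 := by
  have hz : ∀ t, t ∉ Ioo 0 T → φ t = 0 := fun t ht => image_eq_zero_of_notMem_tsupport
    fun h => ht (hφT h)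
  have h := intervalIntegral.integral_deriv_eq_sub (a := 0) (b := T) (f := φ)
    (fun x _ => hφ.differentiable (by simp) x)
    ((hφ.continuous_deriv (by simp)).intervalIntegrable _ _)
  rw [hz T (by simp), hz 0 (by simp), sub_self, intervalIntegral.integral_of_le hT,
    integral_Ioc_eq_integral_Ioo] at h
  exact h

theorem hasWeakTimeDeriv_const {B : Type*} [NormedAddCommGroup B] [NormedSpace ℝ B]
    [CompleteSpace B] (hT : 0 ≤ T) (b : B) :
    HasWeakTimeDeriv T (fun _ => b) (fun _ => (0 : B)) := by
  intro φ hφ _ hφT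
  rw [integral_smul_const, integral_deriv_eq_zero hT hφ hφT]
  simp

theorem isTestPath_const (hT : 0 ≤ T) {u : L2sigma Ω} {w : H10sigma Ω}
    (hw : w.1.1 = (u : LpΩ Ω (Vec d) 2)) {h : W2 Ω 2} (hh : h.1.1 = (u : LpΩ Ω (Vec d) 2))
    {k : W1 Ω ∞} (hk : k.1.1 =ᵐ[volume.restrict Ω] (u : LpΩ Ω (Vec d) 2)) :
    IsTestPath Ω T ν (fun _ => u) (fun _ => 0) where
  continuousOn := continuousOn_const
  inX := ⟨memLp_const u, fun _ => ⟨fun _ => w, memLp_const w, Eventually.of_forall fun _ => hw⟩⟩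
  inH2 _ := ⟨fun _ => h, memLp_const h, Eventually.of_forall fun _ => hh⟩
  inW1inf := ⟨fun _ => k, memLp_const k, Eventually.of_forall fun _ => hk⟩
  deriv_memLp := memLp_const (0 : StrongDual ℝ (L2sigma Ω))
  deriv_weak := hasWeakTimeDeriv_const hT _

theorem const_mem_KDomain {u : L2sigma Ω} {w : H10sigma Ω}
    (hw : w.1.1 = (u : LpΩ Ω (Vec d) 2)) {G : LpΩ Ω (Mat d) ∞}
    (hG : wgrad (u : LpΩ Ω (Vec d) 2) =ᵐ[volume.restrict Ω] G) :
    (fun _ => u) ∈ KDomain Ω T ν (gradMeasure Ω) := by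
  refine ⟨⟨memLp_const u, fun _ => ⟨fun _ => w, memLp_const w,
    Eventually.of_forall fun _ => hw⟩⟩, aemeasurable_const, ?_⟩
  rw [lintegral_const, gradMeasure_eq hG]
  exact ENNReal.mul_ne_top (ENNReal.mul_ne_top (by simp) (by simp)) (measure_ne_top _ _)

theorem intervalIntegral_congr_timeMeasure {E : Type*} [NormedAddCommGroup E] [NormedSpace ℝ E]
    {f g : ℝ → E} (h : f =ᵐ[timeMeasure T] g) {s t : ℝ} (hs : 0 ≤ s) (hst : s ≤ t)
    (ht : t ≤ T) : ∫ r in s..t, f r = ∫ r in s..t, g r := by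
  rw [intervalIntegral.integral_of_le hst, intervalIntegral.integral_of_le hst,
    integral_Ioc_eq_integral_Ioo, integral_Ioc_eq_integral_Ioo]
  exact integral_congr_ae (ae_restrict_of_ae_restrict_of_subset (Ioo_subset_Ioo hs ht) h)

/-- The dissipation minus the power of the force. -/
def dissip (ν : ℝ) (v : ℝ → L2sigma Ω) (W : ℝ → H10 Ω) (f₁ : ℝ → StrongDual ℝ (H10 Ω))
    (f₂ : ℝ → LpΩ Ω (Vec d) 2) (t : ℝ) : ℝ :=
  ν * ‖(W t).1.2‖ ^ 2 - f₁ t (W t) - ⟪f₂ t, (v t : LpΩ Ω (Vec d) 2)⟫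

/-- The momentum equation tested with a fixed function, up to the sign. -/
def momentum (ν : ℝ) (v : ℝ → L2sigma Ω) (W : ℝ → H10 Ω) (f₁ : ℝ → StrongDual ℝ (H10 Ω))
    (f₂ : ℝ → LpΩ Ω (Vec d) 2) (G : LpΩ Ω (Mat d) ∞) (u : L2sigma Ω) (X : H10 Ω) (t : ℝ) : ℝ :=
  -(ν * ⟪(W t).1.2, X.1.2⟫) + triForm G (v t) (v t) + f₁ t X + ⟪f₂ t, (u : LpΩ Ω (Vec d) 2)⟫

/-- The density that controls the increments of the velocity. -/
def velDensity (ν : ℝ) (v : ℝ → L2sigma Ω) (ξ : ℝ → ℝ) (W : ℝ → H10 Ω)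
    (f₁ : ℝ → StrongDual ℝ (H10 Ω)) (f₂ : ℝ → LpΩ Ω (Vec d) 2) (t : ℝ) : ℝ :=
  ν * ‖(W t).1.2‖ + ‖v t‖ ^ 2 + ‖f₁ t‖ + ‖f₂ t‖ + 2 * |ξ t|

theorem velDensity_nonneg (hν : 0 ≤ ν) (v : ℝ → L2sigma Ω) (ξ : ℝ → ℝ) (W : ℝ → H10 Ω)
    (f₁ : ℝ → StrongDual ℝ (H10 Ω)) (f₂ : ℝ → LpΩ Ω (Vec d) 2) (t : ℝ) :
    0 ≤ velDensity ν v ξ W f₁ f₂ t := by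
  unfold velDensity
  positivity

theorem integrand_const_eq {E F : Type*} [NormedAddCommGroup E] [InnerProductSpace ℝ E]
    [NormedAddCommGroup F] [InnerProductSpace ℝ F] (ν r κ ξ b : ℝ) (a x : E) (f v u : F)
    {S : Type*} [NormedAddCommGroup S] [NormedSpace ℝ S] (f₁ : StrongDual ℝ S) (W X : S) :
    ν * ⟪a, a - r • x⟫ + (r * b) + 0 - f₁ (W - r • X) - ⟪f, v - r • u⟫ - |r| * (2 * κ) * ξ =
      (ν * ‖a‖ ^ 2 - f₁ W - ⟪f, v⟫) + r * (-(ν * ⟪a, x⟫) + b + f₁ X + ⟪f, u⟫) -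
        2 * |r| * κ * ξ := by
  rw [inner_sub_right, real_inner_smul_right, real_inner_self_eq_norm_sq, map_sub, map_smul,
    inner_sub_right, real_inner_smul_right, smul_eq_mul]
  ring

theorem triForm_const_eq {G : LpΩ Ω (Mat d) ∞} {v u : LpΩ Ω (Vec d) 2} (h : triForm G v u = 0)
    (r : ℝ) : triForm (r • G) v (v - r • u) = r * triForm G v v := by
  rw [triForm_smul, triForm_sub_right, triForm_smul_right, h]
  ring

variable {f₁ : ℝ → StrongDual ℝ (H10 Ω)} {f₂ : ℝ → LpΩ Ω (Vec d) 2} {v₀ : L2sigma Ω}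
  {v : ℝ → L2sigma Ω} {ξ : ℝ → ℝ} {W : ℝ → H10 Ω}

theorem VSpace.isTestPath_smul (hΩ : IsBoundedLipschitzDomain Ω) (hT : 0 ≤ T) (hp2 : 2 ≤ p)
    (x : VSpace Ω p) {c : LpΩ Ω (Vec d) ∞} {G : LpΩ Ω (Mat d) ∞} (hcG : IsWeakGrad Ω c G)
    (hc : x.1.1.1 =ᵐ[volume.restrict Ω] c) (r : ℝ) :
    IsTestPath Ω T ν (fun _ => r • VSpace.toSigma x) (fun _ => 0) := by
  obtain ⟨h, hh⟩ := VSpace.exists_W2_two hΩ hp2 x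
  refine isTestPath_const hT (w := r • ⟨x.1.1, x.2.1⟩) rfl (h := r • h) ?_
    (k := r • ⟨(c, G), hcG⟩) ?_
  · exact congrArg (fun y => r • y) hh
  · exact (Lp.coeFn_smul _ _).trans ((hc.symm.const_smul r).trans (Lp.coeFn_smul _ _).symm)

theorem VSpace.smul_ae_eq (x : VSpace Ω p) {c : LpΩ Ω (Vec d) ∞}
    (hc : x.1.1.1 =ᵐ[volume.restrict Ω] c) (r : ℝ) :
    ((r • VSpace.toSigma x : L2sigma Ω) : LpΩ Ω (Vec d) 2) =ᵐ[volume.restrict Ω]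
      (r • c : LpΩ Ω (Vec d) ∞) :=
  (Lp.coeFn_smul _ _).trans ((hc.const_smul r).trans (Lp.coeFn_smul _ _).symm)

theorem coe_sub_smul {E : Type*} [AddCommGroup E] [Module ℝ E] {S : Submodule ℝ E} (a b : S)
    (r : ℝ) : ((a - r • b : S) : E) = (a : E) - r • (b : E) := rfl

theorem snd_smul {E F : Type*} [AddCommGroup E] [Module ℝ E] [AddCommGroup F] [Module ℝ F]
    {S : Submodule ℝ (E × F)} (b : S) (r : ℝ) : (r • b : S).1.2 = r • b.1.2 := rfl

-- The test path `r x` enters the inequality linearly, except for `|r|` through `K`: the convective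
-- term quadratic in `r` is zero by `triForm_self_eq_zero`, and the derivative in time is zero.
set_option maxHeartbeats 1000000 in
theorem relEnergyIneq_const (hΩ : IsBoundedLipschitzDomain Ω) (hν : 0 ≤ ν)
    (hf : InZ Ω T ν f₁ f₂) (hW : ∀ᵐ t ∂timeMeasure T, IsLift ν (v t) (W t)) (x : VSpace Ω p)
    {c : LpΩ Ω (Vec d) ∞} {G : LpΩ Ω (Mat d) ∞} (hcG : IsWeakGrad Ω c G)
    (hc : x.1.1.1 =ᵐ[volume.restrict Ω] c) (hG : x.1.1.2 =ᵐ[volume.restrict Ω] G) (r : ℝ)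
    {s t : ℝ} (hs : 0 ≤ s) (hst : s ≤ t) (ht : t ≤ T)
    (h : RelEnergyIneq ν f₁ f₂ (gradMeasure Ω) v ξ (fun _ => r • VSpace.toSigma x)
      (fun _ => 0) s t) :
    relEnergy (v t) (r • VSpace.toSigma x) + ξ t + ∫ τ in s..t, (dissip ν v W f₁ f₂ τ +
      r * momentum ν v W f₁ f₂ G (VSpace.toSigma x) (VSpace.toH10 x) τ - 2 * |r| * ‖G‖ * ξ τ) ≤
      relEnergy (v s) (r • VSpace.toSigma x) + ξ s := by
  have hcG' := isWeakGrad_smul r hcG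
  have hc' := VSpace.smul_ae_eq x hc r
  have hk : (gradMeasure Ω (r • VSpace.toSigma x)).toReal = |r| * (2 * ‖G‖) := by
    rw [toReal_gradMeasure_eq (wgrad_ae_eq hΩ hcG' hc'), norm_smul, Real.norm_eq_abs]
    ring
  have e : (fun τ => dissip ν v W f₁ f₂ τ +
      r * momentum ν v W f₁ f₂ G (VSpace.toSigma x) (VSpace.toH10 x) τ - 2 * |r| * ‖G‖ * ξ τ)
      =ᵐ[timeMeasure T] fun τ => relForm ν (v τ) (r • VSpace.toSigma x)
        (gradMeasure Ω (r • VSpace.toSigma x)).toReal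
        + systemOp ν (f₁ τ) (f₂ τ) 0 (r • VSpace.toSigma x) (v τ - r • VSpace.toSigma x)
        - (gradMeasure Ω (r • VSpace.toSigma x)).toReal *
          (relEnergy (v τ) (r • VSpace.toSigma x) + ξ τ) := by
    filter_upwards [hW] with τ hτ
    have hz : triForm G (v τ) (VSpace.toSigma x : LpΩ Ω (Vec d) 2) = 0 :=
      triForm_self_eq_zero (v τ).2 (H10sigma_le_H10 x.2.1) hcG hc hG
    have e1 := integrand_eq hΩ hν (f₁ := f₁ τ) (f₂ := f₂ τ) (g := 0) hτ
      (VSpace.isLift_smul (ν := ν) x r) (fun h0 => by rw [hf.2.2 h0]; rfl) hcG' hc'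
      (|r| * (2 * ‖G‖)) (ξ τ)
    rw [hk, e1, coe_sub_smul, snd_smul, triForm_const_eq hz, zero_apply]
    exact (integrand_const_eq ν r ‖G‖ (ξ τ) _ _ _ _ _ _ _ _ _).symm
  rw [intervalIntegral_congr_timeMeasure e hs hst ht]
  exact h

/-- The gradient sup norm takes the convective and the defect term, the `H^1` norm takes viscosity
and force. `size` and `velDensity` are the sums of these factors, and mixed products are
nonnegative. -/
theorem abs_momentum_add_le (hν : 0 ≤ ν) (x : VSpace Ω p) {G : LpΩ Ω (Mat d) ∞}
    (hG : ‖G‖ = VSpace.gradSup x) (t : ℝ) :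
    |momentum ν v W f₁ f₂ G (VSpace.toSigma x) (VSpace.toH10 x) t| + 2 * ‖G‖ * |ξ t| ≤
      VSpace.size x * velDensity ν v ξ W f₁ f₂ t := by
  have key : ∀ {a b c e ν n g w q1 q2 z N X2 U : ℝ}, 0 ≤ ν → 0 ≤ n → 0 ≤ g → 0 ≤ w → 0 ≤ q1 →
      0 ≤ q2 → 0 ≤ z → 0 ≤ N → |a| ≤ n * X2 → X2 ≤ N → U ≤ N → |b| ≤ g * w * w → |c| ≤ q1 * N →
      |e| ≤ q2 * U →
      |-(ν * a) + b + c + e| + 2 * g * z ≤ (N + g) * (ν * n + w ^ 2 + q1 + q2 + 2 * z) := by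
    intro a b c e ν n g w q1 q2 z N X2 U hν hn hg hw hq1 hq2 hz hN h1 h2 h3 h4 h5 h6
    have t1 : |ν * a| ≤ ν * n * N := by
      rw [abs_mul, abs_of_nonneg hν, mul_assoc]
      exact mul_le_mul_of_nonneg_left (h1.trans (mul_le_mul_of_nonneg_left h2 hn)) hν
    have t2 : |-(ν * a) + b + c + e| ≤ |ν * a| + |b| + |c| + |e| := by
      have a1 := abs_add_le (-(ν * a) + b + c) e
      have a2 := abs_add_le (-(ν * a) + b) c
      have a3 := abs_add_le (-(ν * a)) b
      rw [abs_neg] at a3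
      linarith
    have t3 := h6.trans (mul_le_mul_of_nonneg_left h3 hq2)
    have m1 : 0 ≤ N * w ^ 2 := by positivity
    have m2 : 0 ≤ N * z := by positivity
    have m3 : 0 ≤ g * (ν * n) := by positivity
    have m4 : 0 ≤ g * q1 := by positivity
    have m5 : 0 ≤ g * q2 := by positivity
    nlinarith
  have hx2 : ‖(VSpace.toH10 x).1.2‖ ≤ ‖x.1.1‖ := le_max_right _ _
  have hx1 : ‖(VSpace.toSigma x : LpΩ Ω (Vec d) 2)‖ ≤ ‖x.1.1‖ := le_max_left _ _
  have h1 : |f₁ t (VSpace.toH10 x)| ≤ ‖f₁ t‖ * ‖x.1.1‖ := (f₁ t).le_opNorm _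
  have h2 : |triForm G (v t) (v t)| ≤ ‖G‖ * ‖v t‖ * ‖v t‖ := abs_triForm_le G (v t) (v t)
  have h3 := key hν (norm_nonneg (W t).1.2) (norm_nonneg G) (norm_nonneg (v t))
    (norm_nonneg (f₁ t)) (norm_nonneg (f₂ t)) (abs_nonneg (ξ t)) (norm_nonneg x.1.1)
    (abs_real_inner_le_norm (W t).1.2 (VSpace.toH10 x).1.2) hx2 hx1 h2 h1
    (abs_real_inner_le_norm (f₂ t) (VSpace.toSigma x : LpΩ Ω (Vec d) 2))
  rw [VSpace.size, ← hG]
  exact h3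

end ConstPath

/-! ### The energy inequality and a priori bounds -/

section Apriori

variable {d : ℕ} {Ω : Set (Vec d)} {T ν : ℝ} {p : ℝ≥0∞} [hp1 : Fact (1 ≤ p)]
  {f₁ : ℝ → StrongDual ℝ (H10 Ω)} {f₂ : ℝ → LpΩ Ω (Vec d) 2} {v₀ : L2sigma Ω}
  {v : ℝ → L2sigma Ω} {ξ : ℝ → ℝ} {W : ℝ → H10 Ω}

theorem integrable_sq_norm {E : Type*} [NormedAddCommGroup E] {a : ℝ → E}
    (h : MemLp a 2 (timeMeasure T)) : Integrable (fun t => ‖a t‖ ^ 2) (timeMeasure T) :=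
  (memLp_two_iff_integrable_sq_norm h.1).1 h

theorem integrable_of_memLp {E : Type*} [NormedAddCommGroup E] {a : ℝ → E} {q : ℝ≥0∞}
    (hq : 1 ≤ q) (h : MemLp a q (timeMeasure T)) : Integrable a (timeMeasure T) :=
  h.integrable hq

theorem integrable_dissip (hW : MemLp W 2 (timeMeasure T)) (hv : MemLp v ∞ (timeMeasure T))
    (hf : InZ Ω T ν f₁ f₂) : Integrable (dissip ν v W f₁ f₂) (timeMeasure T) :=
  (((integrable_sq_norm (memLp_snd hW)).const_mul ν).sub
    (integrable_apply_of_memLp hf.1 hW)).sub (integrable_inner_of_memLp hf.2.1 (memLp_coe hv))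

theorem integrable_momentum (hW : MemLp W 2 (timeMeasure T)) (hv : MemLp v ∞ (timeMeasure T))
    (hf : InZ Ω T ν f₁ f₂) (G : LpΩ Ω (Mat d) ∞) (u : L2sigma Ω) (X : H10 Ω) :
    Integrable (momentum ν v W f₁ f₂ G u X) (timeMeasure T) := by
  have i1 : Integrable (fun t => ⟪(W t).1.2, X.1.2⟫) (timeMeasure T) :=
    (integrable_of_memLp (by norm_num) (memLp_snd hW)).inner_const _
  have i2 : Integrable (fun t => triForm G (v t) (v t)) (timeMeasure T) :=
    integrable_triForm (memLp_const G) (memLp_coe hv) (memLp_coe hv)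
  have i3 : Integrable (fun t => f₁ t X) (timeMeasure T) :=
    (integrable_of_memLp (by norm_num) hf.1).apply_continuousLinearMap X
  have i4 : Integrable (fun t => ⟪f₂ t, (u : LpΩ Ω (Vec d) 2)⟫) (timeMeasure T) :=
    (integrable_of_memLp le_rfl hf.2.1).inner_const _
  exact (((i1.const_mul ν).neg.add i2).add i3).add i4

theorem integrable_density {E S G : Type*} [NormedAddCommGroup E] [NormedAddCommGroup S]
    [NormedSpace ℝ S] [NormedAddCommGroup G] (ν : ℝ) {a : ℝ → E} {n : ℝ → ℝ}
    {b : ℝ → StrongDual ℝ S} {c : ℝ → G} {z : ℝ → ℝ}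
    (ha : Integrable a (timeMeasure T)) (hn : Integrable n (timeMeasure T))
    (hb : MemLp b 2 (timeMeasure T)) (hc : Integrable c (timeMeasure T))
    (hz : Integrable z (timeMeasure T)) :
    Integrable (fun t => ν * ‖a t‖ + n t + ‖b t‖ + ‖c t‖ + 2 * |z t|) (timeMeasure T) :=
  ((((ha.norm.const_mul ν).add hn).add (integrable_of_memLp (by norm_num) hb).norm).add
    hc.norm).add (hz.abs.const_mul 2)

theorem integrable_velDensity (hW : MemLp W 2 (timeMeasure T)) (hv : MemLp v ∞ (timeMeasure T))
    (hξ : MemLp ξ ∞ (timeMeasure T)) (hf : InZ Ω T ν f₁ f₂) :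
    Integrable (velDensity ν v ξ W f₁ f₂) (timeMeasure T) := by
  have h2 : (1 : ℝ≥0∞) ≤ 2 := by norm_num
  have ha : Integrable (fun t => (W t).1.2) (timeMeasure T) := integrable_of_memLp h2 (memLp_snd hW)
  have hn : Integrable (fun t => ‖v t‖ ^ 2) (timeMeasure T) :=
    integrable_sq_norm (hv.mono_exponent le_top)
  have hc : Integrable f₂ (timeMeasure T) := integrable_of_memLp le_rfl hf.2.1
  have hz : Integrable ξ (timeMeasure T) := integrable_of_memLp le_top hξ
  exact integrable_density ν ha hn hf.1 hc hz

theorem half_norm_sub_smul_sq {E : Type*} [NormedAddCommGroup E] [InnerProductSpace ℝ E]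
    (w u : E) (r : ℝ) :
    1 / 2 * ‖w - r • u‖ ^ 2 = 1 / 2 * ‖w‖ ^ 2 - r * ⟪w, u⟫ + 1 / 2 * ‖r • u‖ ^ 2 := by
  rw [norm_sub_sq_real, real_inner_smul_right]
  ring

/-- A linear function of `|n|` that stays bounded above as `n → ±∞` has nonpositive slope; the two
signs of `n` give the absolute value. -/
theorem abs_sub_le_of_forall_int {a b F K c : ℝ}
    (h : ∀ n : ℤ, n * (F - (a - b)) - 2 * |(n : ℝ)| * K ≤ c) : |a - b - F| ≤ 2 * K := by
  by_contra! hc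
  obtain ⟨N, hN⟩ := exists_nat_gt (c / (|a - b - F| - 2 * K))
  rw [div_lt_iff₀ (by linarith)] at hN
  have h1 := h N
  have h2 := h (-N)
  push_cast at h1 h2
  rw [abs_neg, Nat.abs_cast] at h2
  rw [Nat.abs_cast] at h1
  rcases abs_cases (a - b - F) with ⟨h3, -⟩ | ⟨h3, -⟩ <;> rw [h3] at hN <;> linarith

/-- Expanding the squares, `½‖n u‖²` cancels between the two times. The value `n = 0` gives the
first claim, large `|n|` the second, with the energy loss as the constant that is outgrown. -/
theorem increment_of_forall_int {D F : ℝ → ℝ} {u : L2sigma Ω} {κ s t : ℝ}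
    (hD : IntervalIntegrable D volume s t) (hF : IntervalIntegrable F volume s t)
    (hξ : IntervalIntegrable ξ volume s t)
    (h : ∀ n : ℤ, relEnergy (v t) ((n : ℝ) • u) + ξ t +
      ∫ τ in s..t, (D τ + n * F τ - 2 * |(n : ℝ)| * κ * ξ τ) ≤
      relEnergy (v s) ((n : ℝ) • u) + ξ s) :
    energy v ξ t + ∫ τ in s..t, D τ ≤ energy v ξ s ∧
      |⟪v t - v s, u⟫ - ∫ τ in s..t, F τ| ≤ 2 * (κ * ∫ τ in s..t, ξ τ) := by
  have e : ∀ n : ℤ, ∫ τ in s..t, (D τ + n * F τ - 2 * |(n : ℝ)| * κ * ξ τ) =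
      (∫ τ in s..t, D τ) + n * (∫ τ in s..t, F τ) - 2 * |(n : ℝ)| * (κ * ∫ τ in s..t, ξ τ) := by
    intro n
    rw [intervalIntegral.integral_sub (hD.add (hF.const_mul _)) (hξ.const_mul _),
      intervalIntegral.integral_add hD (hF.const_mul _), intervalIntegral.integral_const_mul,
      intervalIntegral.integral_const_mul]
    ring
  have r : ∀ (w : L2sigma Ω) (n : ℤ), relEnergy w ((n : ℝ) • u) =
      1 / 2 * ‖w‖ ^ 2 - n * ⟪w, u⟫ + 1 / 2 * ‖(n : ℝ) • u‖ ^ 2 := by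
    intro w n
    exact half_norm_sub_smul_sq w u n
  simp only [e, r] at h
  constructor
  · have := h 0
    simp only [Int.cast_zero, zero_mul, zero_smul, norm_zero, abs_zero, mul_zero] at this
    unfold energy
    linarith
  · rw [inner_sub_left]
    refine abs_sub_le_of_forall_int (c := energy v ξ s - energy v ξ t - ∫ τ in s..t, D τ)
      fun n => ?_
    have := h n
    unfold energy
    linarith

/-- The energy inequality and the control of the increments of the velocity, between two times at
which the relative energy inequality holds for countably many constant test paths. -/
theorem energy_increment_of_relEnergyIneq (hΩ : IsBoundedLipschitzDomain Ω) (hν : 0 ≤ ν)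
    (hf : InZ Ω T ν f₁ f₂) (hWm : MemLp W 2 (timeMeasure T))
    (hW : ∀ᵐ t ∂timeMeasure T, IsLift ν (v t) (W t)) (hv : MemLp v ∞ (timeMeasure T))
    (hξ : MemLp ξ ∞ (timeMeasure T)) (x : VSpace Ω p) {c : LpΩ Ω (Vec d) ∞}
    {G : LpΩ Ω (Mat d) ∞} (hcG : IsWeakGrad Ω c G) (hc : x.1.1.1 =ᵐ[volume.restrict Ω] c)
    (hG : x.1.1.2 =ᵐ[volume.restrict Ω] G) (hGn : ‖G‖ = VSpace.gradSup x) {s t : ℝ} (hs : 0 ≤ s)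
    (hst : s ≤ t) (ht : t ≤ T)
    (h : ∀ n : ℤ, RelEnergyIneq ν f₁ f₂ (gradMeasure Ω) v ξ
      (fun _ => (n : ℝ) • VSpace.toSigma x) (fun _ => 0) s t) :
    energy v ξ t + ∫ τ in s..t, dissip ν v W f₁ f₂ τ ≤ energy v ξ s ∧
      |⟪v t - v s, VSpace.toSigma x⟫| ≤
        VSpace.size x * ∫ τ in s..t, velDensity ν v ξ W f₁ f₂ τ := by
  set F := momentum ν v W f₁ f₂ G (VSpace.toSigma x) (VSpace.toH10 x)
  have iD := intervalIntegrable_of_timeMeasure (integrable_dissip hWm hv hf) hs hst ht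
  have iF : IntervalIntegrable F volume s t :=
    intervalIntegrable_of_timeMeasure (integrable_momentum hWm hv hf _ _ _) hs hst ht
  have iξ := intervalIntegrable_of_timeMeasure
    (integrable_of_memLp (q := ∞) (by norm_num) hξ) hs hst ht
  have iγ := intervalIntegrable_of_timeMeasure (integrable_velDensity hWm hv hξ hf) hs hst ht
  obtain ⟨h1, h2⟩ := increment_of_forall_int iD iF iξ fun n =>
    relEnergyIneq_const hΩ hν hf hW x hcG hc hG n hs hst ht (h n)
  refine ⟨h1, ?_⟩
  have h3 : |∫ τ in s..t, F τ| ≤ ∫ τ in s..t, |F τ| :=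
    intervalIntegral.abs_integral_le_integral_abs hst
  have h4 : ∫ τ in s..t, ξ τ ≤ ∫ τ in s..t, |ξ τ| :=
    intervalIntegral.integral_mono_on hst iξ iξ.abs fun τ _ => le_abs_self _
  have h5 : ∫ τ in s..t, (|F τ| + 2 * ‖G‖ * |ξ τ|) ≤
      ∫ τ in s..t, VSpace.size x * velDensity ν v ξ W f₁ f₂ τ :=
    intervalIntegral.integral_mono_on hst (iF.abs.add (iξ.abs.const_mul _)) (iγ.const_mul _)
      fun τ _ => abs_momentum_add_le hν x hGn τ
  rw [intervalIntegral.integral_add iF.abs (iξ.abs.const_mul _),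
    intervalIntegral.integral_const_mul, intervalIntegral.integral_const_mul] at h5
  have h6 := mul_le_mul_of_nonneg_left h4 (norm_nonneg G)
  have h7 := abs_sub_abs_le_abs_sub ⟪v t - v s, VSpace.toSigma x⟫ (∫ τ in s..t, F τ)
  linarith

/-- The energy inequality and the control of the increments of the velocity, at almost all
times. -/
theorem IsEnergyVariationalSolution.energy_increment (hd : 0 < d)
    (hΩ : IsBoundedLipschitzDomain Ω) (hT : 0 ≤ T) (hν : 0 ≤ ν) (hp : (d : ℝ≥0∞) < p)
    (hp2 : 2 ≤ p) (hf : InZ Ω T ν f₁ f₂) (hWm : MemLp W 2 (timeMeasure T))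
    (hW : ∀ᵐ t ∂timeMeasure T, IsLift ν (v t) (W t))
    (h : IsEnergyVariationalSolution Ω T ν f₁ f₂ v₀ v ξ) (x : VSpace Ω p) :
    (∀ᵐ t ∂timeMeasure T,
      energy v ξ t + ∫ τ in (0 : ℝ)..t, dissip ν v W f₁ f₂ τ ≤ energy v ξ 0 ∧
      |⟪v t - v 0, VSpace.toSigma x⟫| ≤
        VSpace.size x * ∫ τ in (0 : ℝ)..t, velDensity ν v ξ W f₁ f₂ τ) ∧
    ∀ᵐ s ∂timeMeasure T, ∀ᵐ t ∂timeMeasure T, s < t →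
      energy v ξ t + ∫ τ in s..t, dissip ν v W f₁ f₂ τ ≤ energy v ξ s ∧
      |⟪v t - v s, VSpace.toSigma x⟫| ≤
        VSpace.size x * ∫ τ in s..t, velDensity ν v ξ W f₁ f₂ τ := by
  obtain ⟨c, G, hcG, hc, hG, hGn⟩ := VSpace.exists_bounded hΩ hp x
  have hadm := isAdmissible_gradMeasure (T := T) hd hΩ hν
  have htp : ∀ n : ℤ, IsTestPath Ω T ν (fun _ => (n : ℝ) • VSpace.toSigma x) (fun _ => 0) :=
    fun n => VSpace.isTestPath_smul hΩ hT hp2 x hcG hc n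
  have hK : ∀ n : ℤ, (fun _ => (n : ℝ) • VSpace.toSigma x) ∈
      KDomain Ω T ν (gradMeasure Ω) := fun n =>
    const_mem_KDomain (w := (n : ℝ) • ⟨x.1.1, x.2.1⟩) rfl
      (wgrad_ae_eq hΩ (isWeakGrad_smul (n : ℝ) hcG) (VSpace.smul_ae_eq x hc n))
  -- The exceptional null set depends on the test path; integer multiples are countably many, so all
  -- of them hold at a common time.
  have h0 : ∀ᵐ t ∂timeMeasure T, ∀ n : ℤ, RelEnergyIneq ν f₁ f₂ (gradMeasure Ω) v ξ
      (fun _ => (n : ℝ) • VSpace.toSigma x) (fun _ => 0) 0 t :=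
    ae_all_iff.2 fun n => h.ineq_zero _ hadm _ _ (htp n) (hK n)
  have h1 : ∀ᵐ s ∂timeMeasure T, ∀ n : ℤ, ∀ᵐ t ∂timeMeasure T, s < t →
      RelEnergyIneq ν f₁ f₂ (gradMeasure Ω) v ξ
        (fun _ => (n : ℝ) • VSpace.toSigma x) (fun _ => 0) s t :=
    ae_all_iff.2 fun n => h.ineq _ hadm _ _ (htp n) (hK n)
  have hIoo : ∀ᵐ t ∂timeMeasure T, t ∈ Ioo 0 T := ae_restrict_mem measurableSet_Ioo
  constructor
  · filter_upwards [h0, hIoo] with t ht htI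
    exact energy_increment_of_relEnergyIneq hΩ hν hf hWm hW h.inX.1 h.memLp_xi x hcG hc hG hGn
      le_rfl htI.1.le htI.2.le ht
  · filter_upwards [h1, hIoo] with s hs hsI
    filter_upwards [ae_all_iff.2 hs, hIoo] with t ht htI hst
    exact energy_increment_of_relEnergyIneq hΩ hν hf hWm hW h.inX.1 h.memLp_xi x hcG hc hG hGn
      hsI.1.le hst.le htI.2.le fun n => ht n hst

end Apriori

/-! ### Quantitative bounds -/

section Bounds

variable {T : ℝ}

theorem intervalIntegral_le_integral_timeMeasure {f : ℝ → ℝ} (hf : Integrable f (timeMeasure T))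
    (h0 : ∀ t, 0 ≤ f t) {s t : ℝ} (hs : 0 ≤ s) (hst : s ≤ t) (ht : t ≤ T) :
    ∫ τ in s..t, f τ ≤ ∫ τ, f τ ∂timeMeasure T := by
  rw [intervalIntegral.integral_of_le hst, integral_Ioc_eq_integral_Ioo]
  exact setIntegral_mono_set hf (Eventually.of_forall h0)
    (LE.le.eventuallyLE (Ioo_subset_Ioo hs ht))

theorem integral_timeMeasure_eq (hT : 0 ≤ T) (f : ℝ → ℝ) :
    ∫ τ, f τ ∂timeMeasure T = ∫ τ in (0 : ℝ)..T, f τ := by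
  rw [intervalIntegral.integral_of_le hT, integral_Ioc_eq_integral_Ioo, timeMeasure]

theorem intervalIntegral_mono_ae_timeMeasure {f g : ℝ → ℝ} (hf : Integrable f (timeMeasure T))
    (hg : Integrable g (timeMeasure T)) (h : ∀ᵐ t ∂timeMeasure T, f t ≤ g t) {s t : ℝ}
    (hs : 0 ≤ s) (hst : s ≤ t) (ht : t ≤ T) : ∫ τ in s..t, f τ ≤ ∫ τ in s..t, g τ := by
  rw [intervalIntegral.integral_of_le hst, intervalIntegral.integral_of_le hst,
    integral_Ioc_eq_integral_Ioo, integral_Ioc_eq_integral_Ioo]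
  exact integral_mono_ae (IntegrableOn.mono_set hf (Ioo_subset_Ioo hs ht))
    (IntegrableOn.mono_set hg (Ioo_subset_Ioo hs ht))
    (ae_restrict_of_ae_restrict_of_subset (Ioo_subset_Ioo hs ht) h)

/-- The bound for the velocity in terms of the data. -/
def velBound (e A B : ℝ) : ℝ := √(4 * |e| + 4 * A + 4 * B ^ 2)

/-- The bound for the energy in terms of the data. -/
def energyBound (e A B : ℝ) : ℝ := |e| + A + B * velBound e A B

/-- The velocity enters the lower bound for `D` only linearly, so its finite essential supremum
satisfies a quadratic inequality that bounds it. No Gronwall argument is required. -/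
theorem bounds_of_energy_ineq (hT : 0 < T) {n ξ D q a b : ℝ → ℝ} {e : ℝ}
    (hn : MemLp n ∞ (timeMeasure T)) (hn0 : ∀ t, 0 ≤ n t) (hξ0 : ∀ᵐ t ∂timeMeasure T, 0 ≤ ξ t)
    (hDi : Integrable D (timeMeasure T)) (hqi : Integrable q (timeMeasure T))
    (hai : Integrable a (timeMeasure T)) (hbi : Integrable b (timeMeasure T))
    (hq0 : ∀ t, 0 ≤ q t) (ha0 : ∀ t, 0 ≤ a t) (hb0 : ∀ t, 0 ≤ b t)
    (hD1 : ∀ᵐ t ∂timeMeasure T, q t - a t - b t * n t ≤ D t)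
    (hD2 : ∀ᵐ t ∂timeMeasure T, |D t| ≤ 3 * q t + a t + b t * n t)
    (hE : ∀ᵐ t ∂timeMeasure T, 1 / 2 * n t ^ 2 + ξ t + ∫ τ in (0 : ℝ)..t, D τ ≤ e) :
    (∀ᵐ t ∂timeMeasure T, n t ≤ velBound e (∫ τ, a τ ∂timeMeasure T) (∫ τ, b τ ∂timeMeasure T)) ∧
    (∀ᵐ t ∂timeMeasure T, 1 / 2 * n t ^ 2 + ξ t ≤
      energyBound e (∫ τ, a τ ∂timeMeasure T) (∫ τ, b τ ∂timeMeasure T)) ∧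
    ∫ τ, q τ ∂timeMeasure T ≤
      energyBound e (∫ τ, a τ ∂timeMeasure T) (∫ τ, b τ ∂timeMeasure T) ∧
    ∫ τ, |D τ| ∂timeMeasure T ≤
      4 * energyBound e (∫ τ, a τ ∂timeMeasure T) (∫ τ, b τ ∂timeMeasure T) := by
  set A := ∫ τ, a τ ∂timeMeasure T with hA
  set B := ∫ τ, b τ ∂timeMeasure T with hB
  have hA0 : 0 ≤ A := integral_nonneg ha0
  have hB0 : 0 ≤ B := integral_nonneg hb0
  have hIoo : ∀ᵐ t ∂timeMeasure T, t ∈ Ioo 0 T := ae_restrict_mem measurableSet_Ioo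
  -- Used twice: with the essential supremum of `n`, to bound that supremum by the data, and then
  -- with the bound so obtained.
  have step : ∀ m : ℝ, (∀ᵐ t ∂timeMeasure T, n t ≤ m) → ∀ᵐ t ∂timeMeasure T,
      1 / 2 * n t ^ 2 + ξ t + ∫ τ in (0 : ℝ)..t, q τ ≤ |e| + A + B * m := by
    intro m hm
    have hlow : ∀ᵐ t ∂timeMeasure T, q t - a t - m * b t ≤ D t := by
      filter_upwards [hm, hD1] with t h1 h2
      have := mul_le_mul_of_nonneg_left h1 (hb0 t)
      linarith
    have hm0 : 0 ≤ m := by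
      have hne : (ae (timeMeasure T)).NeBot := by
        rw [ae_neBot, timeMeasure, Ne, Measure.restrict_eq_zero, Real.volume_Ioo,
          ENNReal.ofReal_eq_zero]
        linarith
      obtain ⟨t, ht⟩ := hm.exists
      exact (hn0 t).trans ht
    filter_upwards [hE, hIoo] with t ht htI
    have hint : ∀ {f : ℝ → ℝ}, Integrable f (timeMeasure T) → IntervalIntegrable f volume 0 t :=
      fun hf => intervalIntegrable_of_timeMeasure hf le_rfl htI.1.le htI.2.le
    have h1 := intervalIntegral_mono_ae_timeMeasure ((hqi.sub hai).sub (hbi.const_mul m)) hDi hlow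
      le_rfl htI.1.le htI.2.le
    have h2 : ∫ τ in (0 : ℝ)..t, (q τ - a τ - m * b τ) = (∫ τ in (0 : ℝ)..t, q τ) -
        (∫ τ in (0 : ℝ)..t, a τ) - m * ∫ τ in (0 : ℝ)..t, b τ := by
      rw [intervalIntegral.integral_sub ((hint hqi).sub (hint hai)) ((hint hbi).const_mul m),
        intervalIntegral.integral_sub (hint hqi) (hint hai), intervalIntegral.integral_const_mul]
    have h3 := intervalIntegral_le_integral_timeMeasure hai ha0 le_rfl htI.1.le htI.2.le
    have h4 := intervalIntegral_le_integral_timeMeasure hbi hb0 le_rfl htI.1.le htI.2.le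
    have h5 := mul_le_mul_of_nonneg_left h4 hm0
    have h6 : (∫ τ in (0 : ℝ)..t, (q τ - a τ - m * b τ)) ≤ ∫ τ in (0 : ℝ)..t, D τ := h1
    rw [h2] at h6
    rw [← hA] at h3
    rw [← hB] at h5
    have := le_abs_self e
    linarith
  have hq_nonneg : ∀ t ∈ Ioo 0 T, 0 ≤ ∫ τ in (0 : ℝ)..t, q τ := fun t ht =>
    intervalIntegral.integral_nonneg ht.1.le fun τ _ => hq0 τ
  set m₀ : ℝ := (eLpNormEssSup n (timeMeasure T)).toReal with hm₀
  have hfin : eLpNormEssSup n (timeMeasure T) ≠ ⊤ := by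
    have := hn.2
    rw [eLpNorm_exponent_top] at this
    exact this.ne
  have hm₀0 : 0 ≤ m₀ := ENNReal.toReal_nonneg
  have hnm₀ : ∀ᵐ t ∂timeMeasure T, n t ≤ m₀ := by
    filter_upwards [ae_le_eLpNormEssSup (f := n) (μ := timeMeasure T)] with t ht
    have := ENNReal.toReal_mono hfin ht
    rw [toReal_enorm, Real.norm_eq_abs] at this
    exact (le_abs_self _).trans this
  have hm₀sq : m₀ ^ 2 ≤ 2 * (|e| + A + B * m₀) := by
    have h0 : 0 ≤ 2 * (|e| + A + B * m₀) := by positivity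
    have h1 : ∀ᵐ t ∂timeMeasure T, ‖n t‖ ≤ √(2 * (|e| + A + B * m₀)) := by
      filter_upwards [step m₀ hnm₀, hξ0, hIoo] with t h2 h3 h4
      rw [Real.norm_eq_abs, abs_of_nonneg (hn0 t)]
      refine Real.le_sqrt_of_sq_le ?_
      linarith [hq_nonneg t h4]
    have h2 := ENNReal.toReal_mono ENNReal.ofReal_ne_top (eLpNormEssSup_le_of_ae_bound h1)
    rw [ENNReal.toReal_ofReal (Real.sqrt_nonneg _)] at h2
    calc m₀ ^ 2 ≤ √(2 * (|e| + A + B * m₀)) ^ 2 := by gcongr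
      _ = _ := Real.sq_sqrt h0
  -- From `m₀² ≤ 2|e| + 2A + 2B m₀` and `2B m₀ ≤ ½ m₀² + 2B²`; these are the constants in
  -- `velBound`.
  have hM : m₀ ≤ velBound e A B := by
    refine Real.le_sqrt_of_sq_le ?_
    nlinarith [sq_nonneg (m₀ - 2 * B)]
  have hnM : ∀ᵐ t ∂timeMeasure T, n t ≤ velBound e A B := hnm₀.mono fun t h => h.trans hM
  have hS := step _ hnM
  -- The bound holds up to almost every time and extends to `T` by continuity of the primitive.
  have hqS : ∫ τ, q τ ∂timeMeasure T ≤ energyBound e A B := by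
    rw [integral_timeMeasure_eq hT.le]
    have hc : ContinuousOn (fun t => ∫ τ in (0 : ℝ)..t, q τ) (Icc 0 T) := by
      have := intervalIntegral.continuousOn_primitive_interval'
        (intervalIntegrable_of_timeMeasure hqi le_rfl hT.le le_rfl) left_mem_uIcc
      rwa [uIcc_of_le hT.le] at this
    have hL : ∀ᵐ t ∂timeMeasure T, t ∈ {t | t ∈ Ioo 0 T ∧
        ∫ τ in (0 : ℝ)..t, q τ ≤ energyBound e A B} := by
      filter_upwards [hS, hIoo, hξ0] with t h1 h2 h3
      refine ⟨h2, ?_⟩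
      have : 0 ≤ n t ^ 2 := sq_nonneg _
      unfold energyBound
      linarith
    have hT' : T ∈ Icc 0 T := right_mem_Icc.2 hT.le
    have := neBot_nhdsWithin_Icc hT hL hT'
    have hsub : {t | t ∈ Ioo 0 T ∧ ∫ τ in (0 : ℝ)..t, q τ ≤ energyBound e A B} ⊆ Icc 0 T :=
      fun t ht => Ioo_subset_Icc_self ht.1
    refine le_of_tendsto ((hc T hT').mono_left (nhdsWithin_mono T hsub)) ?_
    filter_upwards [self_mem_nhdsWithin] with t ht
    exact ht.2
  refine ⟨hnM, ?_, hqS, ?_⟩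
  · filter_upwards [hS, hIoo] with t h1 h2
    unfold energyBound
    linarith [hq_nonneg t h2]
  · have h1 : ∀ᵐ t ∂timeMeasure T, |D t| ≤ 3 * q t + a t + velBound e A B * b t := by
      filter_upwards [hD2, hnM] with t h2 h3
      have := mul_le_mul_of_nonneg_left h3 (hb0 t)
      linarith
    have i1 : Integrable (fun t => 3 * q t + a t) (timeMeasure T) := (hqi.const_mul 3).add hai
    have i2 := hbi.const_mul (velBound e A B)
    have h2 := integral_mono_ae hDi.abs (i1.add i2) h1
    have h3 : ∫ t, (3 * q t + a t + velBound e A B * b t) ∂timeMeasure T =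
        3 * ∫ t, q t ∂timeMeasure T + A + velBound e A B * B := by
      rw [integral_add i1 i2, integral_add (hqi.const_mul 3) hai, integral_const_mul,
        integral_const_mul]
    have h4 : ∫ t, |D t| ∂timeMeasure T ≤ ∫ t, (3 * q t + a t + velBound e A B * b t)
      ∂timeMeasure T := h2
    rw [h3] at h4
    have : A + velBound e A B * B ≤ energyBound e A B := by
      unfold energyBound
      have := abs_nonneg e
      linarith
    linarith

end Bounds

/-! ### Two-sided bounds for the dissipation minus the power of the force -/

section Dissip

variable {d : ℕ} {Ω : Set (Vec d)} {T ν : ℝ}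
  {f₁ : ℝ → StrongDual ℝ (H10 Ω)} {f₂ : ℝ → LpΩ Ω (Vec d) 2}
  {v : ℝ → L2sigma Ω} {W : ℝ → H10 Ω}

/-- Young's inequality `F₁ N ≤ ½ ν N² + F₁² / (2ν)`: half of the dissipation absorbs the gradient
part of the power of `f₁`. -/
theorem dissip_bounds_real {ν x y z N F1 F2 n : ℝ} (hν : 0 < ν) (hx : |y| ≤ F1 * (n + N))
    (hz : |z| ≤ F2 * n) (hxe : x = ν * N ^ 2) :
    x / 2 - 1 / (2 * ν) * F1 ^ 2 - (F1 + F2) * n ≤ x - y - z ∧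
      |x - y - z| ≤ 3 * (x / 2) + 1 / (2 * ν) * F1 ^ 2 + (F1 + F2) * n := by
  have h1 : F1 * N ≤ x / 2 + 1 / (2 * ν) * F1 ^ 2 := by
    have : 0 ≤ (ν * N - F1) ^ 2 / (2 * ν) := by positivity
    have e : (ν * N - F1) ^ 2 / (2 * ν) = x / 2 + 1 / (2 * ν) * F1 ^ 2 - F1 * N := by
      rw [hxe]
      field_simp
      ring
    linarith
  have hx0 : 0 ≤ x := by rw [hxe]; positivity
  obtain ⟨a1, a2⟩ := abs_le.1 hx
  obtain ⟨b1, b2⟩ := abs_le.1 hz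
  refine ⟨by nlinarith, abs_le.2 ⟨by nlinarith, by nlinarith⟩⟩

/-- The convention `1 / 0 = 0` gives the same formula a meaning for `ν = 0`, where `f₁` is absent.
-/
theorem dissip_bounds_zero {ν N y z F1 F2 n : ℝ} (hν : ν = 0) (hF1 : F1 = 0) (hy : y = 0)
    (hz : |z| ≤ F2 * n) :
    ν * N / 2 - 1 / (2 * ν) * F1 ^ 2 - (F1 + F2) * n ≤ ν * N - y - z ∧
      |ν * N - y - z| ≤ 3 * (ν * N / 2) + 1 / (2 * ν) * F1 ^ 2 + (F1 + F2) * n := by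
  obtain ⟨b1, b2⟩ := abs_le.1 hz
  subst hν hF1 hy
  simp only [zero_mul, zero_div, mul_zero, div_zero, sub_zero, zero_sub, zero_add, abs_neg]
  exact ⟨by linarith, hz⟩

theorem norm_eq_zero_of_eq_zero {S : Type*} [NormedAddCommGroup S] [NormedSpace ℝ S]
    {f : StrongDual ℝ S} (h : f = 0) : ‖f‖ = 0 := by
  rw [h, norm_zero]

theorem dissip_bounds (hν : 0 ≤ ν) (hf : InZ Ω T ν f₁ f₂) {t : ℝ} (hW : IsLift ν (v t) (W t)) :
    ν * ‖(W t).1.2‖ ^ 2 / 2 - 1 / (2 * ν) * ‖f₁ t‖ ^ 2 - (‖f₁ t‖ + ‖f₂ t‖) * ‖v t‖ ≤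
        dissip ν v W f₁ f₂ t ∧
      |dissip ν v W f₁ f₂ t| ≤ 3 * (ν * ‖(W t).1.2‖ ^ 2 / 2) + 1 / (2 * ν) * ‖f₁ t‖ ^ 2 +
        (‖f₁ t‖ + ‖f₂ t‖) * ‖v t‖ := by
  have hz : |⟪f₂ t, (v t : LpΩ Ω (Vec d) 2)⟫| ≤ ‖f₂ t‖ * ‖v t‖ := abs_real_inner_le_norm _ _
  rcases hν.eq_or_lt with h0 | h0
  · have hf0 : f₁ t = 0 := congrFun (hf.2.2 h0.symm) t
    exact dissip_bounds_zero h0.symm (norm_eq_zero_of_eq_zero hf0)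
      (DFunLike.congr_fun hf0 (W t)) hz
  · refine dissip_bounds_real h0 ?_ hz rfl
    refine ((f₁ t).le_opNorm (W t)).trans (mul_le_mul_of_nonneg_left ?_ (norm_nonneg _))
    have h1 : ‖(W t).1.1‖ = ‖v t‖ := congrArg norm (hW h0).2
    rw [← h1]
    exact max_le (le_add_of_nonneg_right (norm_nonneg _)) (le_add_of_nonneg_left (norm_nonneg _))

end Dissip

/-! ### The energy as a function of bounded variation -/

section EnergyRepresentative

variable {T : ℝ} {H : Type*} [NormedAddCommGroup H] [InnerProductSpace ℝ H]

theorem inner_sub_half_sq_le (a b : H) : ⟪a, b⟫ - 1 / 2 * ‖b‖ ^ 2 ≤ 1 / 2 * ‖a‖ ^ 2 := by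
  have h1 := norm_sub_sq_real a b
  nlinarith [sq_nonneg ‖a - b‖]

theorem continuousOn_primitive_timeMeasure (hT : 0 ≤ T) {D : ℝ → ℝ}
    (hD : Integrable D (timeMeasure T)) :
    ContinuousOn (fun t => ∫ τ in (0 : ℝ)..t, D τ) (Icc 0 T) := by
  have := intervalIntegral.continuousOn_primitive_interval'
    (intervalIntegrable_of_timeMeasure hD le_rfl hT le_rfl) left_mem_uIcc
  rwa [uIcc_of_le hT] at this

theorem intervalIntegral_sub_timeMeasure {D : ℝ → ℝ} (hD : Integrable D (timeMeasure T))
    {s t : ℝ} (hs : 0 ≤ s) (hst : s ≤ t) (ht : t ≤ T) :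
    (∫ τ in (0 : ℝ)..t, D τ) - ∫ τ in (0 : ℝ)..s, D τ = ∫ τ in s..t, D τ := by
  have h1 := intervalIntegral.integral_add_adjacent_intervals
    (intervalIntegrable_of_timeMeasure hD le_rfl hs (hst.trans ht))
    (intervalIntegrable_of_timeMeasure hD hs hst ht)
  linarith

theorem abs_intervalIntegral_le_timeMeasure {D : ℝ → ℝ} (hD : Integrable D (timeMeasure T))
    {s t : ℝ} (hs : 0 ≤ s) (hst : s ≤ t) (ht : t ≤ T) :
    |∫ τ in s..t, D τ| ≤ ∫ τ, |D τ| ∂timeMeasure T :=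
  (intervalIntegral.abs_integral_le_integral_abs hst).trans
    (intervalIntegral_le_integral_timeMeasure hD.abs (fun _ => abs_nonneg _) hs hst ht)

/-- The energy plus the primitive of `D` is antitone on a set of full measure. Its left-continuous
representative determines the energy, and the defect is whatever the weakly continuous velocity
leaves over. -/
theorem exists_energy_representative (hT : 0 < T) {v w : ℝ → H} (hw0 : w 0 = v 0)
    (hwv : w =ᵐ[timeMeasure T] v)
    (hwc : ∀ φ : H, ContinuousOn (fun t => ⟪w t, φ⟫) (Icc 0 T)) {ξ : ℝ → ℝ}
    (hξ : ∀ᵐ t ∂timeMeasure T, 0 ≤ ξ t) {D : ℝ → ℝ} (hD : Integrable D (timeMeasure T))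
    (hE : Integrable (fun t => 1 / 2 * ‖v t‖ ^ 2 + ξ t) (timeMeasure T)) {e : ℝ}
    (he : 1 / 2 * ‖v 0‖ ^ 2 + ξ 0 = e)
    (h0 : ∀ᵐ t ∂timeMeasure T, 1 / 2 * ‖v t‖ ^ 2 + ξ t + ∫ τ in (0 : ℝ)..t, D τ ≤ e)
    (h1 : ∀ᵐ s ∂timeMeasure T, ∀ᵐ t ∂timeMeasure T, s < t →
      1 / 2 * ‖v t‖ ^ 2 + ξ t + ∫ τ in s..t, D τ ≤ 1 / 2 * ‖v s‖ ^ 2 + ξ s) :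
    ∃ (η : ℝ → ℝ) (L : Set ℝ), L ⊆ Ioo 0 T ∧ (∀ᵐ t ∂timeMeasure T, t ∈ L) ∧
      η =ᵐ[timeMeasure T] ξ ∧ η 0 = ξ 0 ∧ (∀ t ∈ Icc 0 T, 0 ≤ η t) ∧
      eVariationOn (fun t => 1 / 2 * ‖w t‖ ^ 2 + η t) (Icc 0 T) ≤
        ENNReal.ofReal (e + 2 * ∫ τ, |D τ| ∂timeMeasure T) ∧
      (∀ t ∈ Icc 0 T, 1 / 2 * ‖w t‖ ^ 2 + η t ≤ e + ∫ τ, |D τ| ∂timeMeasure T) ∧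
      (∀ t ∈ L, v t = w t) ∧
      ∀ t ∈ Ioc 0 T, Tendsto (fun s => 1 / 2 * ‖v s‖ ^ 2 + ξ s) (𝓝[L ∩ Iio t] t)
        (𝓝 (1 / 2 * ‖w t‖ ^ 2 + η t)) := by
  set A := ∫ τ, |D τ| ∂timeMeasure T with hA
  set P : ℝ → ℝ := fun t => ∫ τ in (0 : ℝ)..t, D τ with hP
  have hPc : ContinuousOn P (Icc 0 T) := continuousOn_primitive_timeMeasure hT.le hD
  have hPA : ∀ t ∈ Icc 0 T, |P t| ≤ A := fun t ht =>
    abs_intervalIntegral_le_timeMeasure hD le_rfl ht.1 ht.2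
  have hPi : Integrable P (timeMeasure T) :=
    (hPc.integrableOn_compact isCompact_Icc).mono_set Ioo_subset_Icc_self
  set G : ℝ → ℝ := fun t => 1 / 2 * ‖v t‖ ^ 2 + ξ t + P t with hG
  have hIoo : ∀ᵐ t ∂timeMeasure T, t ∈ Ioo 0 T := ae_restrict_mem measurableSet_Ioo
  obtain ⟨L₀, hL₀s, hL₀, hanti₀⟩ := exists_antitoneOn_of_ae (f := G) (hE.add hPi) (by
    filter_upwards [h1, hIoo] with s hs hsI
    filter_upwards [hs, hIoo] with t ht htI hst
    have h2 := intervalIntegral_sub_timeMeasure hD hsI.1.le hst.le htI.2.le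
    have h3 := ht hst
    simp only [hG, hP]
    linarith)
  set L : Set ℝ := {t | t ∈ L₀ ∧ v t = w t ∧ 0 ≤ ξ t ∧ G t ≤ e} with hLdef
  have hLL₀ : L ⊆ L₀ := fun t ht => ht.1
  have hLs : L ⊆ Ioo 0 T := hLL₀.trans hL₀s
  have hLI : L ⊆ Icc 0 T := hLs.trans Ioo_subset_Icc_self
  have hL : ∀ᵐ t ∂timeMeasure T, t ∈ L := by
    filter_upwards [hL₀, hwv, hξ, h0] with t a b c d
    exact ⟨a, b.symm, c, d⟩
  have hm : ∀ t ∈ L, -A ≤ G t := by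
    intro t ht
    have h2 := (abs_le.1 (hPA t (hLI ht))).1
    have h3 : 0 ≤ ‖v t‖ ^ 2 := sq_nonneg _
    have h4 := ht.2.2.1
    simp only [hG]
    linarith
  have hmem0 : (0 : ℝ) ∈ Icc 0 T := left_mem_Icc.2 hT.le
  have hbot0 := neBot_nhdsWithin_Icc hT hL hmem0
  have hme : -A ≤ e := by
    have h2 : ∀ᶠ t in 𝓝[L] (0 : ℝ), t ∈ L := self_mem_nhdsWithin
    obtain ⟨t, ht⟩ := h2.exists
    exact (hm t ht).trans ht.2.2.2
  obtain ⟨F, hFa, hF0, hFe, hFm, hFl⟩ := exists_antitone_leftLim hLs hL (hanti₀.mono hLL₀) hm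
    (fun t ht => ht.2.2.2) hme
  have hP0 : P 0 = 0 := intervalIntegral.integral_same
  have hηE : ∀ t, 1 / 2 * ‖w t‖ ^ 2 + (F t - P t - 1 / 2 * ‖w t‖ ^ 2) = F t - P t := fun t => by
    ring
  have hlim : ∀ t ∈ Ioc 0 T, Tendsto (fun s => 1 / 2 * ‖v s‖ ^ 2 + ξ s) (𝓝[L ∩ Iio t] t)
      (𝓝 (F t - P t)) := by
    intro t ht
    have h2 : Tendsto P (𝓝[L ∩ Iio t] t) (𝓝 (P t)) :=
      (hPc t (Ioc_subset_Icc_self ht)).mono_left (nhdsWithin_mono _ (inter_subset_left.trans hLI))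
    refine ((hFl t ht).sub h2).congr fun s => ?_
    simp only [hG]
    ring
  -- Weak lower semicontinuity in affine form: the left-hand side is weakly continuous in `w s` and
  -- tends to `½‖w t‖²`.
  have hlow : ∀ t, ∀ s ∈ L, ⟪w s, w t⟫ - 1 / 2 * ‖w t‖ ^ 2 ≤ 1 / 2 * ‖v s‖ ^ 2 + ξ s := by
    intro t s hs
    have h2 := inner_sub_half_sq_le (w s) (w t)
    rw [hs.2.1]
    linarith [hs.2.2.1]
  refine ⟨fun t => F t - P t - 1 / 2 * ‖w t‖ ^ 2, L, hLs, hL, ?_, ?_, ?_, ?_, ?_,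
    fun t ht => ht.2.1, ?_⟩
  · filter_upwards [hFe, hwv] with t h2 h3
    rw [h2, h3]
    simp only [hG]
    ring
  · simp only [hF0, hP0, hw0]
    linarith
  · intro t ht
    rcases ht.1.eq_or_lt with rfl | ht0
    -- There is no left limit at `0`; the energy inequality from time `0` is used with `s ↓ 0`
    -- instead.
    · have h2 : Tendsto (fun s => ⟪w s, w 0⟫ - 1 / 2 * ‖w 0‖ ^ 2 + P s) (𝓝[L] 0)
          (𝓝 (⟪w 0, w 0⟫ - 1 / 2 * ‖w 0‖ ^ 2 + P 0)) :=
        ((((hwc (w 0) 0 hmem0).mono_left (nhdsWithin_mono _ hLI)).sub_const _).add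
          ((hPc 0 hmem0).mono_left (nhdsWithin_mono _ hLI)))
      have h3 := le_of_tendsto (b := e) h2 (by
        filter_upwards [self_mem_nhdsWithin] with s hs
        have h4 := hlow 0 s hs
        have h5 := hs.2.2.2
        simp only [hG] at h5
        linarith)
      rw [real_inner_self_eq_norm_sq, hP0] at h3
      simp only [hF0, hP0]
      linarith
    · have ht' : t ∈ Ioc 0 T := ⟨ht0, ht.2⟩
      have := neBot_nhdsWithin_Iio hL ht'
      have h2 : Tendsto (fun s => ⟪w s, w t⟫ - 1 / 2 * ‖w t‖ ^ 2) (𝓝[L ∩ Iio t] t)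
          (𝓝 (⟪w t, w t⟫ - 1 / 2 * ‖w t‖ ^ 2)) :=
        ((hwc (w t) t ht).mono_left
          (nhdsWithin_mono _ (inter_subset_left.trans hLI))).sub_const _
      have h3 := le_of_tendsto_of_tendsto h2 (hlim t ht') (by
        filter_upwards [self_mem_nhdsWithin] with s hs
        exact hlow t s hs.1)
      rw [real_inner_self_eq_norm_sq] at h3
      linarith
  · simp only [hηE]
    -- This monotone function dominates the increments of `F - P`. Its total increase is at most `e
    -- + 2A`, because `F` starts at `e` and stays above `-A`.
    set K : ℝ → ℝ := fun t => -F t + ∫ τ in (0 : ℝ)..t, |D τ| with hK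
    have hkey : ∀ s ∈ Icc 0 T, ∀ t ∈ Icc 0 T, s ≤ t →
        |(F t - P t) - (F s - P s)| ≤ K t - K s := by
      intro s hs t ht hst
      have h2 := intervalIntegral_sub_timeMeasure hD hs.1 hst ht.2
      have h3 := intervalIntegral_sub_timeMeasure hD.abs hs.1 hst ht.2
      have h4 : |∫ τ in s..t, D τ| ≤ ∫ τ in s..t, |D τ| :=
        intervalIntegral.abs_integral_le_integral_abs hst
      have h5 := hFa hst
      have h6 := abs_le.1 h4
      simp only [hK]
      simp only [hP]
      rw [abs_le]
      constructor <;> linarith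
    have hKm : MonotoneOn K (Icc 0 T) := fun s hs t ht hst => by
      have := (abs_nonneg _).trans (hkey s hs t ht hst)
      linarith
    have hle : eVariationOn (fun t => F t - P t) (Icc 0 T) ≤ eVariationOn K (Icc 0 T) := by
      refine iSup_mono fun q => Finset.sum_le_sum fun i _ => ?_
      have h2 := hkey _ (q.2.2.2 i) _ (q.2.2.2 (i + 1)) (q.2.2.1 (Nat.le_succ i))
      rw [edist_dist, edist_dist]
      refine ENNReal.ofReal_le_ofReal ?_
      rw [Real.dist_eq, Real.dist_eq]
      exact h2.trans (le_abs_self _)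
    refine hle.trans ?_
    have h2 := (hKm.eVariationOn_eq hmem0 (right_mem_Icc.2 hT.le)).le
    rw [inter_self] at h2
    refine h2.trans (ENNReal.ofReal_le_ofReal ?_)
    have h3 : ∫ τ in (0 : ℝ)..T, |D τ| = A := (integral_timeMeasure_eq hT.le _).symm
    simp only [hK, h3, intervalIntegral.integral_same, hF0]
    linarith [hFm T]
  · intro t ht
    rw [hηE]
    have h2 := hFa ht.1
    rw [hF0] at h2
    linarith [(abs_le.1 (hPA t ht)).1]
  · intro t ht
    rw [hηE]
    exact hlim t ht

end EnergyRepresentative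

/-! ### The relative energy inequality at all times -/

section Pointwise

variable {T : ℝ} {H : Type*} [NormedAddCommGroup H] [InnerProductSpace ℝ H]

/-- A bounded weakly continuous path paired with a strongly continuous one. -/
theorem continuousOn_inner_of_weak {S : Set ℝ} {w u : ℝ → H} {M : ℝ}
    (hM : ∀ t ∈ S, ‖w t‖ ≤ M) (hw : ∀ φ : H, ContinuousOn (fun t => ⟪w t, φ⟫) S)
    (hu : ContinuousOn u S) : ContinuousOn (fun t => ⟪w t, u t⟫) S := by
  intro t ht
  have h1 : Tendsto (fun s => ⟪w s, u s - u t⟫) (𝓝[S] t) (𝓝 0) := by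
    have h2 : Tendsto (fun s => M * ‖u s - u t‖) (𝓝[S] t) (𝓝 (M * ‖u t - u t‖)) :=
      ((hu t ht).sub_const (u t)).norm.const_mul M
    rw [sub_self, norm_zero, mul_zero] at h2
    refine squeeze_zero_norm' ?_ h2
    filter_upwards [self_mem_nhdsWithin] with s hs
    exact (norm_inner_le_norm _ _).trans
      (mul_le_mul_of_nonneg_right (hM s hs) (norm_nonneg _))
  have h3 := h1.add (hw (u t) t ht)
  rw [zero_add] at h3
  refine h3.congr fun s => ?_
  rw [← inner_add_right, sub_add_cancel]

/-- Relative energy plus the primitive of `I` is the energy plus a continuous function, so it has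
the left limits known for the energy. It is antitone on a set of full measure, and antitonicity
passes to those limits. -/
theorem ineq_of_ae_ineq (hT : 0 < T) {v w u : ℝ → H} {ξ η I : ℝ → ℝ} {L : Set ℝ} {M : ℝ}
    (hLs : L ⊆ Ioo 0 T) (hL : ∀ᵐ t ∂timeMeasure T, t ∈ L) (hvw : ∀ t ∈ L, v t = w t)
    (hw0 : w 0 = v 0) (hη0 : η 0 = ξ 0) (hM : ∀ t ∈ Icc 0 T, ‖w t‖ ≤ M)
    (hwc : ∀ φ : H, ContinuousOn (fun t => ⟪w t, φ⟫) (Icc 0 T))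
    (hu : ContinuousOn u (Icc 0 T))
    (hE : Integrable (fun t => 1 / 2 * ‖v t‖ ^ 2 + ξ t) (timeMeasure T))
    (hlim : ∀ t ∈ Ioc 0 T, Tendsto (fun s => 1 / 2 * ‖v s‖ ^ 2 + ξ s) (𝓝[L ∩ Iio t] t)
        (𝓝 (1 / 2 * ‖w t‖ ^ 2 + η t)))
    (hI : Integrable I (timeMeasure T))
    (h0 : ∀ᵐ t ∂timeMeasure T, 1 / 2 * ‖v t - u t‖ ^ 2 + ξ t + ∫ τ in (0 : ℝ)..t, I τ ≤
      1 / 2 * ‖v 0 - u 0‖ ^ 2 + ξ 0)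
    (h1 : ∀ᵐ s ∂timeMeasure T, ∀ᵐ t ∂timeMeasure T, s < t →
      1 / 2 * ‖v t - u t‖ ^ 2 + ξ t + ∫ τ in s..t, I τ ≤ 1 / 2 * ‖v s - u s‖ ^ 2 + ξ s)
    {s t : ℝ} (hs : 0 ≤ s) (hst : s ≤ t) (ht : t ≤ T) :
    1 / 2 * ‖w t - u t‖ ^ 2 + η t + ∫ τ in s..t, I τ ≤ 1 / 2 * ‖w s - u s‖ ^ 2 + η s := by
  set P : ℝ → ℝ := fun t => ∫ τ in (0 : ℝ)..t, I τ with hP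
  have hPc : ContinuousOn P (Icc 0 T) := continuousOn_primitive_timeMeasure hT.le hI
  -- `R` contains everything except the energy. It is written with the weakly continuous `w`, which
  -- equals `v` on `L`, and is therefore continuous.
  set R : ℝ → ℝ := fun t => 1 / 2 * ‖u t‖ ^ 2 - ⟪w t, u t⟫ + P t with hR
  have hRc : ContinuousOn R (Icc 0 T) :=
    (((hu.norm.pow 2).const_mul (1 / 2)).sub (continuousOn_inner_of_weak hM hwc hu)).add hPc
  have hRi : Integrable R (timeMeasure T) :=
    (hRc.integrableOn_compact isCompact_Icc).mono_set Ioo_subset_Icc_self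
  have hIoo : ∀ᵐ t ∂timeMeasure T, t ∈ Ioo 0 T := ae_restrict_mem measurableSet_Ioo
  set Q : ℝ → ℝ := fun t => 1 / 2 * ‖v t‖ ^ 2 + ξ t + R t with hQ
  have hex : ∀ a b : H, 1 / 2 * ‖a - b‖ ^ 2 = 1 / 2 * ‖a‖ ^ 2 + 1 / 2 * ‖b‖ ^ 2 - ⟪a, b⟫ := by
    intro a b
    rw [norm_sub_sq_real]
    ring
  have hQL : ∀ t ∈ L, Q t = 1 / 2 * ‖v t - u t‖ ^ 2 + ξ t + P t := by
    intro t ht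
    rw [hex, hvw t ht]
    simp only [hQ, hR, hvw t ht]
    ring
  obtain ⟨L₁, hL₁s, hL₁, hanti⟩ := exists_antitoneOn_of_ae (f := Q) (hE.add hRi) (by
    filter_upwards [h1, hL] with s hs hsL
    filter_upwards [hs, hL] with t ht htL hst
    have h2 := intervalIntegral_sub_timeMeasure hI (hLs hsL).1.le hst.le (hLs htL).2.le
    have h3 := ht hst
    rw [hQL s hsL, hQL t htL]
    simp only [hP]
    linarith)
  set L' : Set ℝ := {t | t ∈ L ∧ t ∈ L₁ ∧ Q t ≤ 1 / 2 * ‖v 0 - u 0‖ ^ 2 + ξ 0} with hL'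
  have hL'ae : ∀ᵐ t ∂timeMeasure T, t ∈ L' := by
    filter_upwards [hL, hL₁, h0] with t a b c
    refine ⟨a, b, ?_⟩
    rw [hQL t a]
    exact c
  have hlimQ : ∀ t ∈ Ioc 0 T, Tendsto Q (𝓝[L' ∩ Iio t] t)
      (𝓝 (1 / 2 * ‖w t - u t‖ ^ 2 + η t + P t)) := by
    intro t ht
    have h2 := (hlim t ht).mono_left
      (nhdsWithin_mono t (inter_subset_inter_left (Iio t) fun x (hx : x ∈ L') => hx.1))
    have h3 : Tendsto R (𝓝[L' ∩ Iio t] t) (𝓝 (R t)) :=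
      (hRc t (Ioc_subset_Icc_self ht)).mono_left
        (nhdsWithin_mono _ fun x hx => Ioo_subset_Icc_self (hLs hx.1.1))
    have h4 := h2.add h3
    refine h4.trans_eq ?_
    congr 1
    rw [hex]
    simp only [hR]
    ring
  rcases hst.eq_or_lt with rfl | hst'
  · rw [intervalIntegral.integral_same, add_zero]
  have ht' : t ∈ Ioc 0 T := ⟨hs.trans_lt hst', ht⟩
  have := neBot_nhdsWithin_Iio hL'ae ht'
  -- For `s > 0` two left limits are compared. For `s = 0` the right-hand side is the prescribed
  -- initial value, and the inequality from time `0` was built into `L'`.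
  have key : 1 / 2 * ‖w t - u t‖ ^ 2 + η t + P t ≤ 1 / 2 * ‖w s - u s‖ ^ 2 + η s + P s := by
    rcases hs.eq_or_lt with rfl | hs0
    · have hP0 : P 0 = 0 := intervalIntegral.integral_same
      rw [hP0, add_zero, hw0, hη0]
      refine le_of_tendsto (hlimQ t ht') ?_
      filter_upwards [self_mem_nhdsWithin] with r hr
      exact hr.1.2.2
    · have hs' : s ∈ Ioc 0 T := ⟨hs0, hst.trans ht⟩
      have := neBot_nhdsWithin_Iio hL'ae hs'
      exact limit_le_limit_of_antitoneOn (hanti.mono fun x (hx : x ∈ L') => hx.2.1) hst'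
        (nhdsWithin_mono _ inter_subset_left) (nhdsWithin_mono _ inter_subset_left)
        (hlimQ s hs') (hlimQ t ht')
  have h2 := intervalIntegral_sub_timeMeasure hI hs hst ht
  simp only [hP] at key
  linarith

end Pointwise

/-! ### Application to the integrand of the relative energy inequality -/

section RelEnergy

variable {d : ℕ} {Ω : Set (Vec d)} {T ν : ℝ}
  {f₁ : ℝ → StrongDual ℝ (H10 Ω)} {f₂ : ℝ → LpΩ Ω (Vec d) 2} {v₀ : L2sigma Ω}
  {v w : ℝ → L2sigma Ω} {ξ η : ℝ → ℝ}

/-- The integrand of the relative energy inequality. -/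
def relIntegrand (ν : ℝ) (f₁ : ℝ → StrongDual ℝ (H10 Ω)) (f₂ : ℝ → LpΩ Ω (Vec d) 2)
    (K : L2sigma Ω → ℝ≥0∞) (v : ℝ → L2sigma Ω) (ξ : ℝ → ℝ) (v' : ℝ → L2sigma Ω)
    (g : ℝ → StrongDual ℝ (L2sigma Ω)) (r : ℝ) : ℝ :=
  relForm ν (v r) (v' r) (K (v' r)).toReal
    + systemOp ν (f₁ r) (f₂ r) (g r) (v' r) (v r - v' r)
    - (K (v' r)).toReal * (relEnergy (v r) (v' r) + ξ r)

/-- Integrability is read off from the cancelled form of the integrand. It is indispensable, since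
the inequalities on adjacent intervals are combined through a primitive. -/
theorem integrable_relIntegrand (hΩ : IsBoundedLipschitzDomain Ω) (hν : 0 ≤ ν)
    (hf : InZ Ω T ν f₁ f₂) (hv : InX Ω T ν v) (hξ : MemLp ξ ∞ (timeMeasure T))
    {K : L2sigma Ω → ℝ≥0∞} {v' : ℝ → L2sigma Ω} {g : ℝ → StrongDual ℝ (L2sigma Ω)}
    (hv' : IsTestPath Ω T ν v' g) (hK : v' ∈ KDomain Ω T ν K) :
    Integrable (relIntegrand ν f₁ f₂ K v ξ v' g) (timeMeasure T) := by
  refine hv.exists_lift.elim fun W hW => hv'.inX.exists_lift.elim fun W' hW' =>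
    (isTestPath_exists_grad hΩ hv').elim fun k hk => ?_
  have h1 := integrable_integrand (ν := ν) hW.1 hW'.1 hv.1 hv'.inX.1 hf.1 hf.2.1 hv'.deriv_memLp
    (memLp_snd hk.1) (integrable_K ⟨v', hK⟩) hξ
  refine h1.congr ?_
  filter_upwards [hW.2, hW'.2, hk.2] with t a b c
  exact (integrand_eq hΩ hν a b (fun h => congrFun (hf.2.2 h) t) c.1 c.2.1 _ _).symm

theorem relIntegrand_congr (hw : w =ᵐ[timeMeasure T] v) (hη : η =ᵐ[timeMeasure T] ξ)
    (K : L2sigma Ω → ℝ≥0∞) (v' : ℝ → L2sigma Ω) (g : ℝ → StrongDual ℝ (L2sigma Ω)) :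
    relIntegrand ν f₁ f₂ K w η v' g =ᵐ[timeMeasure T] relIntegrand ν f₁ f₂ K v ξ v' g := by
  filter_upwards [hw, hη] with t a b
  unfold relIntegrand
  rw [a, b]

theorem integrable_energy (hv : MemLp v ∞ (timeMeasure T)) (hξ : MemLp ξ ∞ (timeMeasure T)) :
    Integrable (fun t => 1 / 2 * ‖v t‖ ^ 2 + ξ t) (timeMeasure T) :=
  ((integrable_sq_norm (hv.mono_exponent le_top)).const_mul (1 / 2)).add
    (integrable_of_memLp le_top hξ)

/-- The relative energy inequality passes to all times for the representatives. -/
theorem IsEnergyVariationalSolution.relEnergyIneq_of_le (hT : 0 < T)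
    (hΩ : IsBoundedLipschitzDomain Ω) (hν : 0 ≤ ν) (hf : InZ Ω T ν f₁ f₂)
    (h : IsEnergyVariationalSolution Ω T ν f₁ f₂ v₀ v ξ) {L : Set ℝ} {M : ℝ}
    (hLs : L ⊆ Ioo 0 T) (hL : ∀ᵐ t ∂timeMeasure T, t ∈ L) (hvw : ∀ t ∈ L, v t = w t)
    (hw0 : w 0 = v 0) (hη0 : η 0 = ξ 0) (hηξ : η =ᵐ[timeMeasure T] ξ)
    (hM : ∀ t ∈ Icc 0 T, ‖w t‖ ≤ M)
    (hwc : ∀ φ : L2sigma Ω, ContinuousOn (fun t => ⟪w t, φ⟫) (Icc 0 T))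
    (hlim : ∀ t ∈ Ioc 0 T, Tendsto (fun s => 1 / 2 * ‖v s‖ ^ 2 + ξ s) (𝓝[L ∩ Iio t] t)
        (𝓝 (1 / 2 * ‖w t‖ ^ 2 + η t)))
    {K : L2sigma Ω → ℝ≥0∞} (hKa : IsAdmissible Ω T ν K) {v' : ℝ → L2sigma Ω}
    {g : ℝ → StrongDual ℝ (L2sigma Ω)} (hv' : IsTestPath Ω T ν v' g)
    (hK : v' ∈ KDomain Ω T ν K) {s t : ℝ} (hs : 0 ≤ s) (hst : s ≤ t) (ht : t ≤ T) :
    RelEnergyIneq ν f₁ f₂ K w η v' g s t := by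
  have hwv : w =ᵐ[timeMeasure T] v := by
    filter_upwards [hL] with t ht
    exact (hvw t ht).symm
  have hI := integrable_relIntegrand hΩ hν hf h.inX h.memLp_xi hv' hK
  have h1 := ineq_of_ae_ineq hT hLs hL hvw hw0 hη0 hM hwc hv'.continuousOn
    (integrable_energy h.inX.1 h.memLp_xi) hlim hI (h.ineq_zero K hKa v' g hv' hK)
    (h.ineq K hKa v' g hv' hK) hs hst ht
  rw [← intervalIntegral_congr_timeMeasure (relIntegrand_congr hwv hηξ K v' g) hs hst ht] at h1
  exact h1

end RelEnergy

/-! ### Density of `H^1_{0,σ} ∩ W^{2,p}` in `L²_σ` -/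

section DenseVSpace

variable {d : ℕ} {Ω : Set (Vec d)} {p : ℝ≥0∞} [hp1 : Fact (1 ≤ p)]

/-- The second derivatives `∂_k ∂_j φ_i`, indexed by `((i, j), k)`. -/
def classicalHess (φ : Vec d → Vec d) (x : Vec d) : Ten d :=
  WithLp.toLp 2 fun ijk => classicalGrad (fun y => fderiv ℝ φ y (basisVec d ijk.1.2)) x
    (ijk.1.1, ijk.2)

theorem contDiff_partial {φ : Vec d → Vec d} (hφ : ContDiff ℝ ∞ φ) (j : Fin d) :
    ContDiff ℝ ∞ fun y => fderiv ℝ φ y (basisVec d j) :=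
  (hφ.fderiv_right (m := ∞) (by simp)).clm_apply contDiff_const

theorem isWeakGrad_classicalHess {φ : Vec d → Vec d} (hφ : ContDiff ℝ ∞ φ) :
    IsWeakGrad Ω (classicalGrad φ) (classicalHess φ) := fun χ h1 h2 h3 ij k =>
  isWeakGrad_classicalGrad (contDiff_partial hφ ij.2) χ h1 h2 h3 ij.1 k

theorem memLp_classicalHess {φ : Vec d → Vec d} (h : IsTestField Ω φ) (q : ℝ≥0∞) :
    MemLp (classicalHess φ) q (volume.restrict Ω) := by
  refine (Continuous.memLp_of_hasCompactSupport ?_ ?_).restrict _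
  · refine (PiLp.continuous_toLp 2 _).comp (continuous_pi fun ijk => ?_)
    exact (EuclideanSpace.proj (ijk.1.1, ijk.2) : Mat d →L[ℝ] ℝ).continuous.comp
      (continuous_classicalGrad (contDiff_partial h.1 ijk.1.2))
  · refine HasCompactSupport.intro h.2.1 fun x hx => ?_
    ext ijk
    have h1 : x ∉ tsupport (classicalGrad fun y => fderiv ℝ φ y (basisVec d ijk.1.2)) := fun h =>
      hx (tsupport_fderiv_apply_subset ℝ _ (tsupport_classicalGrad_subset _ h))
    have h2 := image_eq_zero_of_notMem_tsupport h1
    exact congrArg (fun m : Mat d => m (ijk.1.1, ijk.2)) h2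

/-- Solenoidal test fields are in `H^1_{0,σ} ∩ W^{2,p}`. -/
theorem exists_toL2_eq {φ : Vec d → Vec d} (h : IsSolTestField Ω φ) {u : LpΩ Ω (Vec d) 2}
    (hu : u =ᵐ[volume.restrict Ω] φ) : ∃ x : VSpace Ω p, VSpace.toL2 Ω p x = u := by
  have m0 := memLp_classicalGrad h.1 2
  have n0 := memLp_testField h.1 p
  have n1 := memLp_classicalGrad h.1 p
  have n2 := memLp_classicalHess h.1 p
  refine ⟨⟨((u, m0.toLp _), (n0.toLp _, n1.toLp _, n2.toLp _)),
    mem_H10sigma h hu m0.coeFn_toLp, ⟨?_, ?_⟩, hu.trans n0.coeFn_toLp.symm⟩, rfl⟩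
  · exact (isWeakGrad_classicalGrad h.1.1).congr n0.coeFn_toLp.symm n1.coeFn_toLp.symm
  · exact (isWeakGrad_classicalHess h.1.1).congr n1.coeFn_toLp.symm n2.coeFn_toLp.symm

/-- The solenoidal test fields, whose span is dense in `L²_σ` by definition, already belong to `V`.
-/
theorem denseRange_toSigma : DenseRange (VSpace.toSigma (Ω := Ω) (p := p)) := by
  intro u
  rw [closure_subtype]
  have h1 : L2sigma Ω ≤ (LinearMap.range (VSpace.toL2 Ω p).toLinearMap).topologicalClosure := by
    refine Submodule.topologicalClosure_mono (Submodule.span_le.2 ?_)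
    rintro w ⟨φ, hφ, hw⟩
    exact exists_toL2_eq hφ hw
  refine closure_mono ?_ (h1 u.2)
  rintro _ ⟨x, rfl⟩
  exact ⟨VSpace.toSigma x, mem_range_self x, rfl⟩

end DenseVSpace

/-! ### Bounds in terms of the data -/

section NormBounds

variable {T : ℝ}

theorem eLpNorm_one_le_of_norm_le {E : Type*} [NormedAddCommGroup E] {u : ℝ → E} {a : ℝ → ℝ}
    (ha : Integrable a (timeMeasure T)) (hu : ∀ᵐ t ∂timeMeasure T, ‖u t‖ ≤ a t) :
    eLpNorm u 1 (timeMeasure T) ≤ ENNReal.ofReal (∫ t, a t ∂timeMeasure T) := by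
  have h0 : 0 ≤ᵐ[timeMeasure T] a := hu.mono fun t ht => (norm_nonneg _).trans ht
  rw [eLpNorm_one_eq_lintegral_enorm, ofReal_integral_eq_lintegral_ofReal ha h0]
  refine lintegral_mono_ae ?_
  filter_upwards [hu] with t ht
  rw [← ofReal_norm]
  exact ENNReal.ofReal_le_ofReal ht

theorem eLpNorm_two_le_of_norm_le {E : Type*} [NormedAddCommGroup E] {u : ℝ → E} {a : ℝ → ℝ}
    (ha : MemLp a 2 (timeMeasure T)) (hu : ∀ᵐ t ∂timeMeasure T, ‖u t‖ ≤ a t) :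
    eLpNorm u 2 (timeMeasure T) ≤ ENNReal.ofReal √(∫ t, a t ^ 2 ∂timeMeasure T) := by
  refine (eLpNorm_mono_ae_real hu).trans ?_
  rw [ha.eLpNorm_eq_integral_rpow_norm (by simp) (by simp)]
  refine le_of_eq ?_
  rw [Real.sqrt_eq_rpow]
  congr 2
  · refine integral_congr_ae (Eventually.of_forall fun t => ?_)
    simp
  · simp

/-- Pointwise, `n² + 2ξ ≤ 2S` by the energy bound and `ν N ≤ ν + ν N²`, the latter being controlled
by the dissipation. -/
theorem integral_density_le (hT : 0 ≤ T) {ν S : ℝ} (hν : 0 ≤ ν) {N n F ξ : ℝ → ℝ}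
    (hN : Integrable (fun t => ν * N t ^ 2 / 2) (timeMeasure T))
    (hF : Integrable F (timeMeasure T))
    (hγ : Integrable (fun t => ν * N t + n t ^ 2 + F t + 2 * |ξ t|) (timeMeasure T))
    (hξ : ∀ᵐ t ∂timeMeasure T, 0 ≤ ξ t)
    (hS : ∀ᵐ t ∂timeMeasure T, 1 / 2 * n t ^ 2 + ξ t ≤ S)
    (hNS : ∫ t, ν * N t ^ 2 / 2 ∂timeMeasure T ≤ S) :
    ∫ t, (ν * N t + n t ^ 2 + F t + 2 * |ξ t|) ∂timeMeasure T ≤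
      (ν + 2 * S) * T + 2 * S + ∫ t, F t ∂timeMeasure T := by
  have hc : Integrable (fun t => (ν + 2 * S) + 2 * (ν * N t ^ 2 / 2)) (timeMeasure T) :=
    (integrable_const _).add (hN.const_mul 2)
  have h1 : ∫ t, (ν * N t + n t ^ 2 + F t + 2 * |ξ t|) ∂timeMeasure T ≤
      ∫ t, ((ν + 2 * S) + 2 * (ν * N t ^ 2 / 2) + F t) ∂timeMeasure T := by
    refine integral_mono_ae hγ (hc.add hF) ?_
    filter_upwards [hξ, hS] with t a b
    have h2 : ν * N t ≤ ν * (1 + N t ^ 2) :=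
      mul_le_mul_of_nonneg_left (by nlinarith [sq_nonneg (N t - 1 / 2)]) hν
    have h3 := abs_of_nonneg a
    linarith
  rw [integral_add hc hF, integral_add (integrable_const _) (hN.const_mul 2), integral_const_mul,
    integral_timeMeasure_eq hT (fun _ => ν + 2 * S), intervalIntegral.integral_const,
    sub_zero, smul_eq_mul] at h1
  linarith

/-- The density is at most `ν N + F₁ + F₂ + 2S`, and the square of four summands is at most four
times the sum of their squares; `4 ν² N²` is `8ν` times the integrand `ν N² / 2`. -/
theorem integral_density_sq_le (hT : 0 ≤ T) {ν S : ℝ} (hν : 0 ≤ ν) {N n F₁ F₂ ξ : ℝ → ℝ}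
    (hN0 : ∀ t, 0 ≤ N t) (hF₁0 : ∀ t, 0 ≤ F₁ t) (hF₂0 : ∀ t, 0 ≤ F₂ t)
    (hN : Integrable (fun t => ν * N t ^ 2 / 2) (timeMeasure T))
    (hF₁ : Integrable (fun t => F₁ t ^ 2) (timeMeasure T))
    (hF₂ : Integrable (fun t => F₂ t ^ 2) (timeMeasure T))
    (hγ : Integrable (fun t => ν * N t + n t ^ 2 + F₁ t + F₂ t + 2 * |ξ t|) (timeMeasure T))
    (hξ : ∀ᵐ t ∂timeMeasure T, 0 ≤ ξ t)
    (hS : ∀ᵐ t ∂timeMeasure T, 1 / 2 * n t ^ 2 + ξ t ≤ S)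
    (hNS : ∫ t, ν * N t ^ 2 / 2 ∂timeMeasure T ≤ S) :
    MemLp (fun t => ν * N t + n t ^ 2 + F₁ t + F₂ t + 2 * |ξ t|) 2 (timeMeasure T) ∧
    ∫ t, (ν * N t + n t ^ 2 + F₁ t + F₂ t + 2 * |ξ t|) ^ 2 ∂timeMeasure T ≤
      16 * S ^ 2 * T + 8 * ν * S + 4 * (∫ t, F₁ t ^ 2 ∂timeMeasure T) +
        4 * ∫ t, F₂ t ^ 2 ∂timeMeasure T := by
  have ha : Integrable (fun t => 16 * S ^ 2 + 8 * ν * (ν * N t ^ 2 / 2)) (timeMeasure T) :=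
    (integrable_const _).add (hN.const_mul _)
  have ha' : Integrable (fun t => 16 * S ^ 2 + 8 * ν * (ν * N t ^ 2 / 2) + 4 * F₁ t ^ 2)
      (timeMeasure T) := ha.add (hF₁.const_mul _)
  have hb : Integrable (fun t => 16 * S ^ 2 + 8 * ν * (ν * N t ^ 2 / 2) + 4 * F₁ t ^ 2 +
      4 * F₂ t ^ 2) (timeMeasure T) := ha'.add (hF₂.const_mul _)
  have hle : ∀ᵐ t ∂timeMeasure T, (ν * N t + n t ^ 2 + F₁ t + F₂ t + 2 * |ξ t|) ^ 2 ≤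
      16 * S ^ 2 + 8 * ν * (ν * N t ^ 2 / 2) + 4 * F₁ t ^ 2 + 4 * F₂ t ^ 2 := by
    filter_upwards [hξ, hS] with t a b
    have h1 : ν * N t + n t ^ 2 + F₁ t + F₂ t + 2 * |ξ t| ≤ ν * N t + F₁ t + F₂ t + 2 * S := by
      rw [abs_of_nonneg a]
      linarith
    have h2 : 0 ≤ ν * N t + n t ^ 2 + F₁ t + F₂ t + 2 * |ξ t| := by
      have := mul_nonneg hν (hN0 t)
      have := hF₁0 t
      have := hF₂0 t
      positivity
    have h3 : (ν * N t + n t ^ 2 + F₁ t + F₂ t + 2 * |ξ t|) ^ 2 ≤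
        (ν * N t + F₁ t + F₂ t + 2 * S) ^ 2 := by gcongr
    nlinarith [sq_nonneg (ν * N t - F₁ t), sq_nonneg (ν * N t - F₂ t),
      sq_nonneg (ν * N t - 2 * S), sq_nonneg (F₁ t - F₂ t), sq_nonneg (F₁ t - 2 * S),
      sq_nonneg (F₂ t - 2 * S)]
  have hsq : Integrable (fun t => (ν * N t + n t ^ 2 + F₁ t + F₂ t + 2 * |ξ t|) ^ 2)
      (timeMeasure T) := by
    refine hb.mono' (hγ.1.pow 2) ?_
    filter_upwards [hle] with t ht
    rw [Real.norm_eq_abs, abs_of_nonneg (sq_nonneg _)]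
    exact ht
  refine ⟨(memLp_two_iff_integrable_sq hγ.1).2 hsq, ?_⟩
  have h1 := integral_mono_ae hsq hb hle
  rw [integral_add ha' (hF₂.const_mul _), integral_add ha (hF₁.const_mul _),
    integral_add (integrable_const _) (hN.const_mul _),
    integral_timeMeasure_eq hT (fun _ => 16 * S ^ 2), intervalIntegral.integral_const,
    sub_zero, smul_eq_mul, integral_const_mul, integral_const_mul, integral_const_mul] at h1
  have h2 := mul_le_mul_of_nonneg_left hNS (by positivity : 0 ≤ 8 * ν)
  linarith

end NormBounds

/-! ### Explicit constants in terms of the data -/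

section DataBounds

variable {T ν : ℝ} {F₁ F₂ : ℝ → ℝ}

/-- The bound for the energy of a solution with initial energy `e`, in terms of the norms of the
two parts of the force. -/
def dataBound (T ν : ℝ) (F₁ F₂ : ℝ → ℝ) (e : ℝ) : ℝ :=
  energyBound e (∫ t, 1 / (2 * ν) * F₁ t ^ 2 ∂timeMeasure T) (∫ t, (F₁ t + F₂ t) ∂timeMeasure T)

/-- The bound for the `L^1` norm of the time derivative. -/
def derivBoundOne (T ν : ℝ) (F₁ F₂ : ℝ → ℝ) (e : ℝ) : ℝ :=
  (ν + 2 * dataBound T ν F₁ F₂ e) * T + 2 * dataBound T ν F₁ F₂ e +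
    ∫ t, (F₁ t + F₂ t) ∂timeMeasure T

/-- The bound for the square of the `L²` norm of the time derivative. -/
def derivBoundTwo (T ν : ℝ) (F₁ F₂ : ℝ → ℝ) (e : ℝ) : ℝ :=
  16 * dataBound T ν F₁ F₂ e ^ 2 * T + 8 * ν * dataBound T ν F₁ F₂ e +
    4 * (∫ t, F₁ t ^ 2 ∂timeMeasure T) + 4 * ∫ t, F₂ t ^ 2 ∂timeMeasure T

/-- The a priori bounds in terms of the data. -/
theorem apriori_bounds (hT : 0 < T) (hν : 0 ≤ ν) {n N ξ D : ℝ → ℝ}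
    (hn : MemLp n ∞ (timeMeasure T)) (hN : MemLp N 2 (timeMeasure T))
    (hF₁ : MemLp F₁ 2 (timeMeasure T)) (hF₂ : MemLp F₂ 1 (timeMeasure T))
    (hD : Integrable D (timeMeasure T)) (hn0 : ∀ t, 0 ≤ n t)
    (hF₁0 : ∀ t, 0 ≤ F₁ t) (hF₂0 : ∀ t, 0 ≤ F₂ t) (hξ : ∀ᵐ t ∂timeMeasure T, 0 ≤ ξ t)
    (hDb : ∀ᵐ t ∂timeMeasure T,
      ν * N t ^ 2 / 2 - 1 / (2 * ν) * F₁ t ^ 2 - (F₁ t + F₂ t) * n t ≤ D t ∧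
      |D t| ≤ 3 * (ν * N t ^ 2 / 2) + 1 / (2 * ν) * F₁ t ^ 2 + (F₁ t + F₂ t) * n t) {e : ℝ}
    (hE : ∀ᵐ t ∂timeMeasure T, 1 / 2 * n t ^ 2 + ξ t + ∫ τ in (0 : ℝ)..t, D τ ≤ e) :
    (∃ M, ∀ᵐ t ∂timeMeasure T, n t ≤ M) ∧
    (∀ᵐ t ∂timeMeasure T, 1 / 2 * n t ^ 2 + ξ t ≤ dataBound T ν F₁ F₂ e) ∧
    ∫ τ, ν * N τ ^ 2 / 2 ∂timeMeasure T ≤ dataBound T ν F₁ F₂ e ∧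
    ∫ τ, |D τ| ∂timeMeasure T ≤ 4 * dataBound T ν F₁ F₂ e := by
  have h := bounds_of_energy_ineq hT hn hn0 hξ hD
    (q := fun t => ν * N t ^ 2 / 2) (a := fun t => 1 / (2 * ν) * F₁ t ^ 2)
    (b := fun t => F₁ t + F₂ t)
    ((hN.integrable_sq.const_mul ν).div_const 2) (hF₁.integrable_sq.const_mul _)
    ((hF₁.integrable (by norm_num)).add (hF₂.integrable le_rfl))
    (fun t => by positivity) (fun t => by positivity) (fun t => add_nonneg (hF₁0 t) (hF₂0 t))
    (hDb.mono fun t ht => ht.1) (hDb.mono fun t ht => ht.2) hE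
  exact ⟨⟨_, h.1⟩, h.2⟩

/-- The bounds for the density that controls the increments of the velocity. -/
theorem density_bounds (hT : 0 < T) (hν : 0 ≤ ν) {n N ξ : ℝ → ℝ}
    (hN : MemLp N 2 (timeMeasure T))
    (hF₁ : MemLp F₁ 2 (timeMeasure T)) (hF₂ : MemLp F₂ 1 (timeMeasure T))
    (hN0 : ∀ t, 0 ≤ N t) (hF₁0 : ∀ t, 0 ≤ F₁ t) (hF₂0 : ∀ t, 0 ≤ F₂ t)
    (hγ : Integrable (fun t => ν * N t + n t ^ 2 + F₁ t + F₂ t + 2 * |ξ t|) (timeMeasure T))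
    (hξ : ∀ᵐ t ∂timeMeasure T, 0 ≤ ξ t) {e : ℝ}
    (hS : ∀ᵐ t ∂timeMeasure T, 1 / 2 * n t ^ 2 + ξ t ≤ dataBound T ν F₁ F₂ e)
    (hNS : ∫ τ, ν * N τ ^ 2 / 2 ∂timeMeasure T ≤ dataBound T ν F₁ F₂ e) :
    ∫ t, (ν * N t + n t ^ 2 + F₁ t + F₂ t + 2 * |ξ t|) ∂timeMeasure T ≤
      derivBoundOne T ν F₁ F₂ e ∧
    (MemLp F₂ 2 (timeMeasure T) →
      MemLp (fun t => ν * N t + n t ^ 2 + F₁ t + F₂ t + 2 * |ξ t|) 2 (timeMeasure T) ∧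
      ∫ t, (ν * N t + n t ^ 2 + F₁ t + F₂ t + 2 * |ξ t|) ^ 2 ∂timeMeasure T ≤
        derivBoundTwo T ν F₁ F₂ e) := by
  have hNi : Integrable (fun t => ν * N t ^ 2 / 2) (timeMeasure T) :=
    (hN.integrable_sq.const_mul ν).div_const 2
  refine ⟨?_, fun hF₂' => integral_density_sq_le hT.le hν hN0 hF₁0 hF₂0 hNi hF₁.integrable_sq
    hF₂'.integrable_sq hγ hξ hS hNS⟩
  have he : (fun t => ν * N t + n t ^ 2 + F₁ t + F₂ t + 2 * |ξ t|) = fun t =>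
      ν * N t + n t ^ 2 + (F₁ t + F₂ t) + 2 * |ξ t| := by
    funext t
    ring
  rw [he] at hγ ⊢
  exact integral_density_le hT.le hν hNi
    ((hF₁.integrable (by norm_num)).add (hF₂.integrable le_rfl)) hγ hξ hS hNS

/-- A path whose norm is bounded by a multiple of a density with the bounds for solutions. -/
theorem eLpNorm_bounds_of_density {E : Type*} [NormedAddCommGroup E] {u : ℝ → E} {γ : ℝ → ℝ}
    {c A B : ℝ} (hc : 0 ≤ c) (hu : AEStronglyMeasurable u (timeMeasure T))
    (huγ : ∀ᵐ t ∂timeMeasure T, ‖u t‖ ≤ c * γ t) (hγ : Integrable γ (timeMeasure T))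
    (hA : ∫ t, γ t ∂timeMeasure T ≤ A) {P : Prop}
    (hB : P → MemLp γ 2 (timeMeasure T) ∧ ∫ t, γ t ^ 2 ∂timeMeasure T ≤ B) :
    (MemLp u 1 (timeMeasure T) ∧ eLpNorm u 1 (timeMeasure T) ≤ ENNReal.ofReal (c * A)) ∧
    (P → MemLp u 2 (timeMeasure T) ∧
      eLpNorm u 2 (timeMeasure T) ≤ ENNReal.ofReal √(c ^ 2 * B)) := by
  constructor
  · have h1 := eLpNorm_one_le_of_norm_le (hγ.const_mul c) huγ
    rw [integral_const_mul] at h1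
    have h2 := h1.trans (ENNReal.ofReal_le_ofReal (mul_le_mul_of_nonneg_left hA hc))
    exact ⟨⟨hu, h2.trans_lt ENNReal.ofReal_lt_top⟩, h2⟩
  · intro hP
    obtain ⟨h0, h3⟩ := hB hP
    have h1 := eLpNorm_two_le_of_norm_le (h0.const_mul c) huγ
    simp only [mul_pow] at h1
    rw [integral_const_mul] at h1
    have h2 := h1.trans (ENNReal.ofReal_le_ofReal
      (Real.sqrt_le_sqrt (mul_le_mul_of_nonneg_left h3 (sq_nonneg c))))
    exact ⟨⟨hu, h2.trans_lt ENNReal.ofReal_lt_top⟩, h2⟩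

end DataBounds

/-! ### Representatives of energy-variational solutions -/

section Representative

variable {d : ℕ} {Ω : Set (Vec d)} {T ν : ℝ} {p : ℝ≥0∞} [hp1 : Fact (1 ≤ p)]
  {f₁ : ℝ → StrongDual ℝ (H10 Ω)} {f₂ : ℝ → LpΩ Ω (Vec d) 2} {v₀ : L2sigma Ω}
  {v : ℝ → L2sigma Ω} {ξ : ℝ → ℝ} {W : ℝ → H10 Ω}

theorem toVDual_apply (u : L2sigma Ω) (x : VSpace Ω p) :
    toVDual Ω p u x = ⟪u, VSpace.toSigma x⟫ := rfl

theorem sub_apply_of_apply {S E : Type*} [NormedAddCommGroup S] [NormedSpace ℝ S]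
    [NormedAddCommGroup E] [InnerProductSpace ℝ E] {f g : StrongDual ℝ S} {a b c : E} {x : S}
    (hf : f x = ⟪a, c⟫) (hg : g x = ⟪b, c⟫) : (f - g) x = ⟪a - b, c⟫ := by
  rw [inner_sub_left, ← hf, ← hg]
  rfl

theorem toVDual_sub_apply (a b : L2sigma Ω) (x : VSpace Ω p) :
    (toVDual Ω p a - toVDual Ω p b) x = ⟪a - b, VSpace.toSigma x⟫ :=
  sub_apply_of_apply (toVDual_apply a x) (toVDual_apply b x)

theorem norm_memLp {E : Type*} [NormedAddCommGroup E] {a : ℝ → E} {q : ℝ≥0∞}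
    (h : MemLp a q (timeMeasure T)) : MemLp (fun t => ‖a t‖) q (timeMeasure T) := h.norm

theorem norm_memLp_dual {S : Type*} [NormedAddCommGroup S] [NormedSpace ℝ S]
    {a : ℝ → StrongDual ℝ S} {q : ℝ≥0∞} (h : MemLp a q (timeMeasure T)) :
    MemLp (fun t => ‖a t‖) q (timeMeasure T) := h.norm

theorem norm_nonneg_dual {S : Type*} [NormedAddCommGroup S] [NormedSpace ℝ S]
    (a : ℝ → StrongDual ℝ S) (t : ℝ) : 0 ≤ ‖a t‖ := norm_nonneg _

theorem IsEnergyVariationalSolution.nonneg_ae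
    (h : IsEnergyVariationalSolution Ω T ν f₁ f₂ v₀ v ξ) : ∀ᵐ t ∂timeMeasure T, 0 ≤ ξ t := by
  filter_upwards [ae_restrict_mem measurableSet_Ioo] with t ht
  exact h.nonneg_xi t ht

/-- The bounds for energy-variational solutions in terms of the data. -/
theorem IsEnergyVariationalSolution.bounds (hT : 0 < T) (hν : 0 ≤ ν) (hf : InZ Ω T ν f₁ f₂)
    (hWm : MemLp W 2 (timeMeasure T)) (hW : ∀ᵐ t ∂timeMeasure T, IsLift ν (v t) (W t))
    (h : IsEnergyVariationalSolution Ω T ν f₁ f₂ v₀ v ξ) {e : ℝ}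
    (hE : ∀ᵐ t ∂timeMeasure T, energy v ξ t + ∫ τ in (0 : ℝ)..t, dissip ν v W f₁ f₂ τ ≤ e) :
    (∃ M, ∀ᵐ t ∂timeMeasure T, ‖v t‖ ≤ M) ∧
    ∫ τ, |dissip ν v W f₁ f₂ τ| ∂timeMeasure T ≤
      4 * dataBound T ν (fun t => ‖f₁ t‖) (fun t => ‖f₂ t‖) e ∧
    ∫ t, velDensity ν v ξ W f₁ f₂ t ∂timeMeasure T ≤
      derivBoundOne T ν (fun t => ‖f₁ t‖) (fun t => ‖f₂ t‖) e ∧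
    (MemLp f₂ 2 (timeMeasure T) →
      MemLp (velDensity ν v ξ W f₁ f₂) 2 (timeMeasure T) ∧
      ∫ t, velDensity ν v ξ W f₁ f₂ t ^ 2 ∂timeMeasure T ≤
        derivBoundTwo T ν (fun t => ‖f₁ t‖) (fun t => ‖f₂ t‖) e) := by
  have hF₁ : MemLp (fun t => ‖f₁ t‖) 2 (timeMeasure T) := norm_memLp_dual hf.1
  have hF₂ : MemLp (fun t => ‖f₂ t‖) 1 (timeMeasure T) := norm_memLp hf.2.1
  have hF₁0 : ∀ t, 0 ≤ ‖f₁ t‖ := norm_nonneg_dual f₁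
  have hF₂0 : ∀ t, 0 ≤ ‖f₂ t‖ := fun t => norm_nonneg _
  have hN : MemLp (fun t => ‖(W t).1.2‖) 2 (timeMeasure T) := norm_memLp (memLp_snd hWm)
  have h1 := apriori_bounds hT hν (norm_memLp h.inX.1) hN hF₁ hF₂
    (integrable_dissip hWm h.inX.1 hf) (fun t => norm_nonneg _) hF₁0 hF₂0 h.nonneg_ae
    (hW.mono fun t ht => dissip_bounds hν hf ht) hE
  have h2 := density_bounds hT hν hN hF₁ hF₂ (fun t => norm_nonneg _) hF₁0 hF₂0
    (integrable_velDensity hWm h.inX.1 h.memLp_xi hf) h.nonneg_ae h1.2.1 h1.2.2.1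
  exact ⟨h1.1, h1.2.2.2, h2.1, fun hf₂ => h2.2 (norm_memLp hf₂)⟩

/-- The weakly continuous representative of the velocity. -/
theorem IsEnergyVariationalSolution.exists_velocity (hT : 0 < T)
    (hWm : MemLp W 2 (timeMeasure T)) (hf : InZ Ω T ν f₁ f₂)
    (h : IsEnergyVariationalSolution Ω T ν f₁ f₂ v₀ v ξ)
    (hM : ∃ M, ∀ᵐ t ∂timeMeasure T, ‖v t‖ ≤ M)
    (h0 : ∀ x : VSpace Ω p, ∀ᵐ t ∂timeMeasure T, |⟪v t - v 0, VSpace.toSigma x⟫| ≤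
      VSpace.size x * ∫ τ in (0 : ℝ)..t, velDensity ν v ξ W f₁ f₂ τ)
    (h1 : ∀ x : VSpace Ω p, ∀ᵐ s ∂timeMeasure T, ∀ᵐ t ∂timeMeasure T, s < t →
      |⟪v t - v s, VSpace.toSigma x⟫| ≤
        VSpace.size x * ∫ τ in s..t, velDensity ν v ξ W f₁ f₂ τ) :
    ∃ w : ℝ → L2sigma Ω, w 0 = v 0 ∧ w =ᵐ[timeMeasure T] v ∧ (∃ M, ∀ t ∈ Icc 0 T, ‖w t‖ ≤ M) ∧
      (∀ φ : L2sigma Ω, ContinuousOn (fun t => ⟪w t, φ⟫) (Icc 0 T)) ∧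
      ∀ s t, 0 ≤ s → s ≤ t → t ≤ T → ∀ x : VSpace Ω p,
        |(toVDual Ω p (w t) - toVDual Ω p (w s)) x| ≤
          VSpace.size x * ∫ τ in s..t, velDensity ν v ξ W f₁ f₂ τ := by
  have hγ := integrable_velDensity hWm h.inX.1 h.memLp_xi hf
  have hIoo : ∀ᵐ t ∂timeMeasure T, t ∈ Ioo 0 T := ae_restrict_mem measurableSet_Ioo
  have hsub := fun s t (hs : 0 ≤ s) (hst : s ≤ t) (ht : t ≤ T) =>
    intervalIntegral_sub_timeMeasure hγ hs hst ht
  refine hM.elim fun M hM => ?_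
  -- The essential bound says nothing about the single time `0`, hence the maximum with `‖v 0‖`.
  have key := exists_weaklyContinuous_representative hT (v₀ := v 0) (M := max M ‖v 0‖)
    (j := VSpace.toSigma (Ω := Ω) (p := p)) (size := VSpace.size)
    (Γ := fun t => ∫ τ in (0 : ℝ)..t, velDensity ν v ξ W f₁ f₂ τ) h.inX.1.1
    (hM.mono fun t ht => ht.trans (le_max_left _ _)) (le_max_right _ _) denseRange_toSigma
    (continuousOn_primitive_timeMeasure hT.le hγ)
    (fun x => by
      filter_upwards [h1 x, hIoo] with s hs hsI
      filter_upwards [hs, hIoo] with t ht htI hst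
      rw [hsub s t hsI.1.le hst.le htI.2.le]
      exact ht hst)
    (fun x => by
      filter_upwards [h0 x] with t ht
      rw [intervalIntegral.integral_same, sub_zero]
      exact ht)
  refine key.elim fun w hw => ⟨w, hw.1, hw.2.1, ⟨_, hw.2.2.1⟩, hw.2.2.2.1, ?_⟩
  intro s t hs hst ht x
  rw [toVDual_sub_apply, ← hsub s t hs hst ht]
  exact hw.2.2.2.2 x s t hs hst ht

/-- The properties of the representative of an energy-variational solution, with the bound `R`. -/
structure IsRepresentative (T ν : ℝ) (p : ℝ≥0∞) [Fact (1 ≤ p)] (f₁ : ℝ → StrongDual ℝ (H10 Ω))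
    (f₂ : ℝ → LpΩ Ω (Vec d) 2) (v : ℝ → L2sigma Ω) (ξ : ℝ → ℝ) (R : ℝ)
    (w : ℝ → L2sigma Ω) (η : ℝ → ℝ) (w' : ℝ → StrongDual ℝ (VSpace Ω p)) : Prop where
  velocity_eq : w =ᵐ[timeMeasure T] v
  defect_eq : η =ᵐ[timeMeasure T] ξ
  velocity_zero : w 0 = v 0
  defect_zero : η 0 = ξ 0
  defect_nonneg : ∀ t ∈ Icc 0 T, 0 ≤ η t
  variation : eVariationOn (energy w η) (Icc 0 T) ≤ ENNReal.ofReal R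
  energy_le : ∀ t ∈ Icc 0 T, energy w η t ≤ R
  weakly_continuous : ∀ φ : L2sigma Ω, ContinuousOn (fun t => ⟪w t, φ⟫) (Icc 0 T)
  deriv : HasWeakTimeDeriv T (fun t => toVDual Ω p (w t)) w'
  deriv_one : MemLp w' 1 (timeMeasure T) ∧ eLpNorm w' 1 (timeMeasure T) ≤ ENNReal.ofReal R
  deriv_two : MemLp f₂ 2 (timeMeasure T) →
    MemLp w' 2 (timeMeasure T) ∧ eLpNorm w' 2 (timeMeasure T) ≤ ENNReal.ofReal R
  relEnergyIneq : ∀ K, IsAdmissible Ω T ν K → ∀ v' g, IsTestPath Ω T ν v' g →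
    v' ∈ KDomain Ω T ν K → ∀ s t, 0 ≤ s → s ≤ t → t ≤ T → RelEnergyIneq ν f₁ f₂ K w η v' g s t

/-- Energy-variational solutions have a representative that satisfies the relative energy
inequality at all times. -/
theorem IsEnergyVariationalSolution.exists_representative (hd : 2 ≤ d)
    (hΩ : IsBoundedLipschitzDomain Ω) (hT : 0 < T) (hν : 0 ≤ ν) (hp : (d : ℝ≥0∞) < p)
    (hf : InZ Ω T ν f₁ f₂) {c : ℝ} (hc : 0 ≤ c) (hsize : ∀ x : VSpace Ω p, VSpace.size x ≤ c * ‖x‖)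
    (h : IsEnergyVariationalSolution Ω T ν f₁ f₂ v₀ v ξ) {e S A B R : ℝ}
    (he : e = 1 / 2 * ‖v₀‖ ^ 2 + ξ 0)
    (hS : S = dataBound T ν (fun t => ‖f₁ t‖) (fun t => ‖f₂ t‖) e)
    (hA : A = derivBoundOne T ν (fun t => ‖f₁ t‖) (fun t => ‖f₂ t‖) e)
    (hB : B = derivBoundTwo T ν (fun t => ‖f₁ t‖) (fun t => ‖f₂ t‖) e)
    (hR : e + 8 * S ≤ R ∧ e + 4 * S ≤ R ∧ c * A ≤ R ∧ √(c ^ 2 * B) ≤ R) :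
    ∃ (w : ℝ → L2sigma Ω) (η : ℝ → ℝ) (w' : ℝ → StrongDual ℝ (VSpace Ω p)),
      IsRepresentative T ν p f₁ f₂ v ξ R w η w' := by
  have hp2 : 2 ≤ p := le_trans (by exact_mod_cast hd) hp.le
  refine h.inX.exists_lift.elim fun W hW => ?_
  have hinc := fun x : VSpace Ω p =>
    h.energy_increment (by omega) hΩ hT.le hν hp hp2 hf hW.1 hW.2 x
  have hE0 : ∀ᵐ t ∂timeMeasure T,
      energy v ξ t + ∫ τ in (0 : ℝ)..t, dissip ν v W f₁ f₂ τ ≤ e := by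
    -- The energy inequality does not involve the test field, so `x = 0` may be taken.
    filter_upwards [(hinc 0).1] with t ht
    rw [he, ← h.initial]
    exact ht.1
  have hE1 : ∀ᵐ s ∂timeMeasure T, ∀ᵐ t ∂timeMeasure T, s < t →
      energy v ξ t + ∫ τ in s..t, dissip ν v W f₁ f₂ τ ≤ energy v ξ s := by
    filter_upwards [(hinc 0).2] with s hs
    filter_upwards [hs] with t ht hst
    exact (ht hst).1
  have hb := h.bounds hT hν hf hW.1 hW.2 hE0
  rw [← hS, ← hA, ← hB] at hb
  refine (h.exists_velocity hT hW.1 hf hb.1 (fun x => (hinc x).1.mono fun t ht => ht.2)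
    (fun x => (hinc x).2.mono fun s hs => hs.mono fun t ht hst => (ht hst).2)).elim fun w hw => ?_
  refine hw.2.2.1.elim fun M hM => ?_
  refine (exists_energy_representative hT hw.1 hw.2.1 hw.2.2.2.1 h.nonneg_ae
    (integrable_dissip hW.1 h.inX.1 hf) (integrable_energy h.inX.1 h.memLp_xi) (e := e)
    (by rw [he, h.initial]) hE0 hE1).elim fun η hη => hη.elim fun L hL => ?_
  refine (exists_hasWeakTimeDeriv hT (fun ε hε => VSpace.size_le hΩ hp hε) hc hsize
    (velDensity_nonneg hν v ξ W f₁ f₂) (integrable_velDensity hW.1 h.inX.1 h.memLp_xi hf)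
    hw.2.2.2.2).elim fun w' hw' => ?_
  have hn := eLpNorm_bounds_of_density hc hw'.2.1 hw'.2.2
    (integrable_velDensity hW.1 h.inX.1 h.memLp_xi hf) hb.2.2.1 hb.2.2.2
  have hD := hb.2.1
  -- The integral is at most `4S`, so the variation is bounded by `e + 8S` and, below, the supremum
  -- by `e + 4S`.
  have b1 : e + 2 * ∫ τ, |dissip ν v W f₁ f₂ τ| ∂timeMeasure T ≤ R := by linarith [hR.1]
  have b2 : e + ∫ τ, |dissip ν v W f₁ f₂ τ| ∂timeMeasure T ≤ R := by linarith [hR.2.1]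
  exact
    ⟨w, η, w',
      { velocity_eq := hw.2.1
        defect_eq := hL.2.2.1
        velocity_zero := hw.1
        defect_zero := hL.2.2.2.1
        defect_nonneg := hL.2.2.2.2.1
        variation := hL.2.2.2.2.2.1.trans (ENNReal.ofReal_le_ofReal b1)
        energy_le := fun t ht => (hL.2.2.2.2.2.2.1 t ht).trans b2
        weakly_continuous := hw.2.2.2.1
        deriv := hw'.1
        deriv_one := ⟨hn.1.1, hn.1.2.trans (ENNReal.ofReal_le_ofReal hR.2.2.1)⟩
        deriv_two := fun hf₂ => ⟨(hn.2 hf₂).1,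
          (hn.2 hf₂).2.trans (ENNReal.ofReal_le_ofReal hR.2.2.2)⟩
        relEnergyIneq := fun K hK v' g hv' hvK s t hs hst ht =>
          h.relEnergyIneq_of_le hT hΩ hν hf hL.1 hL.2.1 hL.2.2.2.2.2.2.2.1 hw.1 hL.2.2.2.1
            hL.2.2.1 hM hw.2.2.2.1 hL.2.2.2.2.2.2.2.2 hK hv' hvK hs hst ht }⟩

end Representative

/-! ### Choice of a common constant and the final statement -/

theorem exists_le_mul_norm {V : Type*} [NormedAddCommGroup V] [NormedSpace ℝ V] {size : V → ℝ}
    (h : ∃ (m : Type) (_ : Fintype m) (Λ : m → StrongDual ℝ V),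
      ∀ x, size x ≤ 1 * ‖x‖ + ∑ k, |Λ k x|) : ∃ c : ℝ, 0 ≤ c ∧ ∀ x, size x ≤ c * ‖x‖ := by
  obtain ⟨m, hm, Λ, h⟩ := h
  refine ⟨1 + ∑ k, ‖Λ k‖, by positivity, fun x => (h x).trans ?_⟩
  rw [add_mul, Finset.sum_mul]
  gcongr with k
  exact (Λ k).le_opNorm x

theorem VSpace.exists_size_le {d : ℕ} {Ω : Set (Vec d)} {p : ℝ≥0∞} [Fact (1 ≤ p)]
    (hΩ : IsBoundedLipschitzDomain Ω) (hp : (d : ℝ≥0∞) < p) :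
    ∃ c : ℝ, 0 ≤ c ∧ ∀ x : VSpace Ω p, VSpace.size x ≤ c * ‖x‖ :=
  exists_le_mul_norm (VSpace.size_le hΩ hp one_pos)

theorem exists_upper_bound_four (a b c d : ℝ) : ∃ R : ℝ, a ≤ R ∧ b ≤ R ∧ c ≤ R ∧ d ≤ R :=
  ⟨max (max a b) (max c d), (le_max_left _ _).trans (le_max_left _ _),
    (le_max_right _ _).trans (le_max_left _ _), (le_max_left _ _).trans (le_max_right _ _),
    (le_max_right _ _).trans (le_max_right _ _)⟩

/-- The bound can be chosen in terms of the data. -/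
theorem exists_bound_representative {d : ℕ} {Ω : Set (Vec d)} {T ν : ℝ} {p : ℝ≥0∞}
    [Fact (1 ≤ p)] {f₁ : ℝ → StrongDual ℝ (H10 Ω)} {f₂ : ℝ → LpΩ Ω (Vec d) 2} (hd : 2 ≤ d)
    (hΩ : IsBoundedLipschitzDomain Ω) (hT : 0 < T) (hν : 0 ≤ ν) (hp : (d : ℝ≥0∞) < p)
    (hf : InZ Ω T ν f₁ f₂) (v₀ : L2sigma Ω) (ξ₀ : ℝ) :
    ∃ R : ℝ, ∀ (v : ℝ → L2sigma Ω) (ξ : ℝ → ℝ),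
      IsEnergyVariationalSolution Ω T ν f₁ f₂ v₀ v ξ → ξ 0 = ξ₀ →
      ∃ (w : ℝ → L2sigma Ω) (η : ℝ → ℝ) (w' : ℝ → StrongDual ℝ (VSpace Ω p)),
        IsRepresentative T ν p f₁ f₂ v ξ R w η w' :=
  -- The bounds involve only `c`, the initial energy and the norms of the force, so the constant is
  -- fixed before the solution is chosen.
  (VSpace.exists_size_le (p := p) hΩ hp).elim fun _ hc =>
    (exists_upper_bound_four _ _ _ _).elim fun _ hR => ⟨_, fun _ _ h hξ =>
      h.exists_representative hd hΩ hT hν hp hf hc.1 hc.2 (congrArg _ hξ.symm) rfl rfl rfl hR⟩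

end EnVar

end

theorem corollary2 (d : ℕ) (hd : 2 ≤ d) (Ω : Set (EnVar.Vec d))
    (hΩ : EnVar.IsBoundedLipschitzDomain Ω) (T : ℝ) (hT : 0 < T) (ν : ℝ) (hν : 0 ≤ ν)
    (p : ℝ≥0∞) [Fact (1 ≤ p)] (hp : (d : ℝ≥0∞) < p)
    (f₁ : ℝ → StrongDual ℝ (EnVar.H10 Ω)) (f₂ : ℝ → EnVar.LpΩ Ω (EnVar.Vec d) 2)
    (hf : EnVar.InZ Ω T ν f₁ f₂) (v₀ : EnVar.L2sigma Ω) (ξ₀ : ℝ) :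
    ∃ C : ℝ≥0, ∀ (v : ℝ → EnVar.L2sigma Ω) (ξ : ℝ → ℝ),
      EnVar.IsEnergyVariationalSolution Ω T ν f₁ f₂ v₀ v ξ → ξ 0 = ξ₀ →
      ∃ (w : ℝ → EnVar.L2sigma Ω) (η : ℝ → ℝ) (w' : ℝ → StrongDual ℝ (EnVar.VSpace Ω p)),
        -- `(w, η)` is a representative of `(v, ξ)` with the same initial values
        w =ᵐ[EnVar.timeMeasure T] v ∧ η =ᵐ[EnVar.timeMeasure T] ξ ∧
        w 0 = v₀ ∧ η 0 = ξ₀ ∧ (∀ t ∈ Icc 0 T, 0 ≤ η t) ∧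
        -- the energy is a function of bounded variation
        eVariationOn (EnVar.energy w η) (Icc 0 T) ≤ C ∧
        (∀ t ∈ Icc 0 T, EnVar.energy w η t ≤ C) ∧
        -- weak continuity with values in `L²_σ`
        (∀ φ : EnVar.L2sigma Ω, ContinuousOn (fun t => ⟪w t, φ⟫) (Icc 0 T)) ∧
        -- the time derivative in the dual of `H^1_{0,σ} ∩ W^{2,p}`
        EnVar.HasWeakTimeDeriv T (fun t => EnVar.toVDual Ω p (w t)) w' ∧
        MemLp w' 1 (EnVar.timeMeasure T) ∧ eLpNorm w' 1 (EnVar.timeMeasure T) ≤ C ∧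
        (MemLp f₂ 2 (EnVar.timeMeasure T) →
          MemLp w' 2 (EnVar.timeMeasure T) ∧ eLpNorm w' 2 (EnVar.timeMeasure T) ≤ C) ∧
        -- the relative energy inequality holds at all times
        (∀ K, EnVar.IsAdmissible Ω T ν K → ∀ v' g, EnVar.IsTestPath Ω T ν v' g →
          v' ∈ EnVar.KDomain Ω T ν K → ∀ s t, 0 ≤ s → s ≤ t → t ≤ T →
            EnVar.RelEnergyIneq ν f₁ f₂ K w η v' g s t) := by
  refine (EnVar.exists_bound_representative hd hΩ hT hν hp hf v₀ ξ₀).elim fun R hR =>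
    ⟨R.toNNReal, fun v ξ h hξ => (hR v ξ h hξ).elim fun w hw => hw.elim fun η hw =>
      hw.elim fun w' hw => ?_⟩
  exact ⟨w, η, w', hw.velocity_eq, hw.defect_eq, hw.velocity_zero.trans h.initial,
    hw.defect_zero.trans hξ, hw.defect_nonneg, hw.variation,
    fun t ht => (hw.energy_le t ht).trans (Real.le_coe_toNNReal R),
    hw.weakly_continuous, hw.deriv, hw.deriv_one.1, hw.deriv_one.2, hw.deriv_two,
    hw.relEnergyIneq⟩
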